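/- Let $b$ be a prime, let $m,s,\alpha,d$ be positive integers with $\alpha\ge 2$, and let $\boldsymbol\gamma=(\gamma_u)_{u\subseteq I_s}$ be non-negative weights, where $I_t=\{1,\dots,t\}$. **Function space.** $H_{s,\alpha,\boldsymbol\gamma}$ is the space of continuous functions $f:[0,1)^s\to\mathbb R$ whose weak mixed partial derivatives up to order $\alpha$ in each variable are square integrable, with inner product $$\langle f,g\rangle=\sum_{u\subseteq I_s}\gamma_u^{-1}\sum_{v\subseteq u}\ \sum_{\mathbf r\in\{1,\dots,\alpha-1\}^{u\setminus v}}\int_{[0,1)^{|v|}}\Big(\int_{[0,1)^{s-|v|}}f^{(\mathbf r_{u\setminus v},\boldsymbol\alpha_v,\mathbf 0)}\,d\mathbf x_{-v}\Big)\Big(\int_{[0,1)^{s-|v|}}g^{(\mathbf r_{u\setminus v},\boldsymbol\alpha_v,\mathbf 0)}\,d\mathbf x_{-v}\Big)d\mathbf x_v .$$ Here $(\mathbf r_{u\setminus v},\boldsymbol\alpha_v,\mathbf 0)$ has $j$-th entry $r_j$ for $j\in u\setminus v$, $\alpha$ for $j\in v$ and $0$ for $j\notin u$. For $\gamma_u=0$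 the inner double sum of $\langle f,f\rangle$ is required to vanish, and $0/0:=0$. For points $\mathbf x_0,\dots,\mathbf x_{N-1}$ put $$e(\{\mathbf x_n\})=\sup_{\|f\|\le 1}\Big|\int_{[0,1)^s}f-\frac1N\sum_{n}f(\mathbf x_n)\Big|,\qquad \tilde e^2(\{\mathbf x_n\})=\int_{[0,1)^s}e^2(\{\mathbf x_n\oplus\boldsymbol\sigma\})\,d\boldsymbol\sigma ,$$ where $\oplus$ is componentwise digitwise addition modulo $b$ of base $b$ expansions. **Point set.** Let $p\in\mathbb F_b[x]$ with $\deg p=m$ and $\mathbf q=(q_1,\dots,q_{ds})\in\mathbb F_b[x]^{ds}$. Identify $n=\sum_i n_ib^i$, $0\le n_i<b$, with $n(x)=\sum_i n_ix^i\in\mathbb F_b[x]$. For $0\le n<b^m$ let $\mathbf y_n=(v_m(nq_1/p),\dots,v_m(nq_{ds}/p))$, where $v_m(\sum_l t_lx^{-l})=\sum_{1\le l\le m}t_lb^{-l}$ on $\mathbb F_b((x^{-1}))$. Let $\mathbf x_n\in[0,1)^s$ be the point whose $j$-th coordinate is $\sum_{a\ge1}\sum_{r=1}^d\eta_{d(j-1)+r,a}\,b^{-(r+(a-1)d)}$,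 where $\eta_{i,a}$ is the $a$-th base $b$ digit of the $i$-th coordinate of $\mathbf y_n$. Let $P_{b^m}=\{\mathbf x_0,\dots,\mathbf x_{b^m-1}\}$. The dual net $D^\perp(\mathbf q,p)$ is the set of $\mathbf k\in\mathbb N_0^{ds}$ with $\sum_j \mathrm{tr}_m(k_j)\,q_j\equiv 0\pmod p$, where $\mathrm{tr}_m(k)\in\mathbb F_b[x]$ is the polynomial whose coefficients are the first $m$ base $b$ digits of $k$ (starting with the least significant). **Constants.** Put $c_b=2\sin(\pi/b)$ and $\theta_b=1+\frac1b+\frac1{b(b+1)}$. Let $C_{1,b}=c_b^{-1}$, $C_{\tau,b}=\theta_b^{\tau-2}c_b^{-\tau}$ for $\tau\ge2$, $\tilde C_{2\alpha,b}=2\theta_b^{2\alpha-2}c_b^{-2\alpha}$, and $$D_{\alpha,b}=\max_{1\le\nu\le\alpha}\Big(\sum_{\tau=\nu}^{\alpha}C_{\tau,b}^2b^{-2(\tau-\nu)}+\tilde C_{2\alpha,b}b^{-2(\alpha-\nu)}\Big),\qquad \tilde D_{\alpha,b,d}=b^{(2d-1)\alpha}D_{\alpha,b}.$$ For $l\ge1$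 let $\mu_1(l)$ be the number of base $b$ digits of $l$ and $r_{\alpha,d}(l)=b^{-2\min(\alpha,d)\mu_1(l)-\alpha}$. For $w\subseteq I_{ds}$ let $\phi(w)=\{1\le j\le s: w\cap\{d(j-1)+1,\dots,dj\}\neq\emptyset\}$. **Theorem.** The constant $\tilde D_{\alpha,b,d}$ is positive, and $$\tilde e^2(P_{b^m})\ \le\ \sum_{\emptyset\ne w\subseteq I_{ds}}\gamma_{\phi(w)}\,\tilde D_{\alpha,b,d}^{|\phi(w)|}\sum_{\substack{\mathbf l_w\in\mathbb N^{|w|}\\(\mathbf l_w,\mathbf 0)\in D^\perp(\mathbf q,p)}}\ \prod_{j\in w}r_{\alpha,d}(l_j)\ <\ \infty ,$$ where $\mathbb N=\{1,2,\dots\}$ and $(\mathbf l_w,\mathbf 0)\in\mathbb N_0^{ds}$ has $j$-th entry $l_j$ for $j\in w$ and $0$ otherwise. -/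

import Mathlib

open MeasureTheory
open scoped ENNReal NNReal

noncomputable section

namespace HODN

/-! ### Cubes and digit operations -/

/-- The half-open unit cube `[0,1)^ι`. -/
def unitCube (ι : Type*) : Set (ι → ℝ) := Set.univ.pi fun _ => Set.Ico 0 1

/-- The open unit cube `(0,1)^ι`. -/
def openCube (ι : Type*) : Set (ι → ℝ) := Set.univ.pi fun _ => Set.Ioo 0 1

/-- Digitwise addition modulo `b` of two numbers in `[0,1)`. -/
def digitAdd (b : ℕ) [Fact b.Prime] (x y : ℝ) : ℝ :=
  Real.ofDigits fun i => Real.digits x b i + Real.digits y b i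

/-- The digit interlacing map `[0,1)^d → [0,1)`. Here digits and components are counted from `0`,
so that the summand is (digit `a+1` of component `r+1`) divided by `b^((r+1) + a d)`. -/
def interlace (b : ℕ) [Fact b.Prime] {d : ℕ} (y : Fin d → ℝ) : ℝ :=
  ∑' a : ℕ, ∑ r : Fin d, ((Real.digits (y r) b a).val : ℝ) / (b : ℝ) ^ ((r : ℕ) + 1 + a * d)

/-- Interlacing of the consecutive blocks of `d` components of a point in `[0,1)^{ds}`;
`finProdFinEquiv (j, r)` is the index `r + d * j`. -/
def interlaceVec (b : ℕ) [Fact b.Prime] {s d : ℕ} (y : Fin (s * d) → ℝ) : Fin s → ℝ :=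
  fun j => interlace b fun r : Fin d => y (finProdFinEquiv (j, r))

/-! ### Polynomial lattice point sets -/

/-- The polynomial over `𝔽_b` whose coefficients are the first `m` base `b` digits of `k`
(all digits, if there are fewer than `m`). -/
def truncPoly (b m k : ℕ) : Polynomial (ZMod b) :=
  ∑ i ∈ Finset.range (min (Nat.digits b k).length m),
    Polynomial.C ((k / b ^ i % b : ℕ) : ZMod b) * Polynomial.X ^ i

/-- The polynomial over `𝔽_b` whose coefficients are the base `b` digits of `n`. -/
def natPoly (b n : ℕ) : Polynomial (ZMod b) :=
  ∑ i ∈ Finset.range (Nat.digits b n).length,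
    Polynomial.C ((n / b ^ i % b : ℕ) : ZMod b) * Polynomial.X ^ i

/-- The embedding of `𝔽_b[x]` into the field of formal Laurent series in `x⁻¹`. The variable of
`LaurentSeries` plays the role of `x⁻¹`, so `x` is sent to the monomial of exponent `-1` and
`L.coeff l` is the coefficient of `x^{-l}` in `L`. -/
def toLaurent (b : ℕ) [Fact b.Prime] (q : Polynomial (ZMod b)) : LaurentSeries (ZMod b) :=
  Polynomial.aeval (HahnSeries.single (-1 : ℤ) (1 : ZMod b) : LaurentSeries (ZMod b)) q

/-- The map `∑ t_l x^{-l} ↦ ∑_{1 ≤ l ≤ m} t_l b^{-l}` from `𝔽_b((x⁻¹))` to `[0,1)`. -/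
def laurentTrunc (b m : ℕ) (L : LaurentSeries (ZMod b)) : ℝ :=
  ∑ l ∈ Finset.Icc 1 m, ((L.coeff (l : ℤ)).val : ℝ) / (b : ℝ) ^ l

/-- The `n`-th point of the polynomial lattice point set with modulus `p` and generating
vector `q`. -/
def polyLatticePoint (b m : ℕ) [Fact b.Prime] {t : ℕ} (q : Fin t → Polynomial (ZMod b))
    (p : Polynomial (ZMod b)) (n : ℕ) : Fin t → ℝ :=
  fun j => laurentTrunc b m (toLaurent b (natPoly b n * q j) / toLaurent b p)

/-- The dual net of the polynomial lattice point set with modulus `p` and generating vector `q`. -/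
def dualNet (b m : ℕ) {t : ℕ} (q : Fin t → Polynomial (ZMod b)) (p : Polynomial (ZMod b)) :
    Set (Fin t → ℕ) :=
  {k | p ∣ ∑ j, truncPoly b m (k j) * q j}

/-- The higher order digital net obtained by interlacing (factor `d`) a polynomial lattice point
set in dimension `ds`. -/
def higherOrderNet (b m s d : ℕ) [Fact b.Prime] (q : Fin (s * d) → Polynomial (ZMod b))
    (p : Polynomial (ZMod b)) : Fin (b ^ m) → Fin s → ℝ :=
  fun n => interlaceVec b (polyLatticePoint b m q p n)

/-! ### Weighted unanchored Sobolev spaces -/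

/-- The partial derivative of `φ` with respect to the `j`-th coordinate. -/
def partialDeriv {s : ℕ} (j : Fin s) (φ : (Fin s → ℝ) → ℝ) : (Fin s → ℝ) → ℝ :=
  fun x => fderiv ℝ φ x (Pi.single j 1)

/-- The mixed partial derivative of order `τ j` in the `j`-th coordinate, for every `j`. -/
def classicalDeriv {s : ℕ} (τ : Fin s → ℕ) (φ : (Fin s → ℝ) → ℝ) : (Fin s → ℝ) → ℝ :=
  (List.finRange s).foldr (fun j ψ => (partialDeriv j)^[τ j] ψ) φ

/-- `g` is a square integrable weak derivative of `f` of order `τ` on the unit cube. -/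
def IsWeakDeriv {s : ℕ} (τ : Fin s → ℕ) (f g : (Fin s → ℝ) → ℝ) : Prop :=
  MemLp g 2 (volume.restrict (unitCube (Fin s))) ∧
    ∀ φ : (Fin s → ℝ) → ℝ, ContDiff ℝ ((⊤ : ℕ∞) : WithTop ℕ∞) φ → HasCompactSupport φ →
      tsupport φ ⊆ openCube (Fin s) →
      ∫ x in unitCube (Fin s), f x * classicalDeriv τ φ x
        = (-1) ^ (∑ j, τ j) * ∫ x in unitCube (Fin s), g x * φ x

open Classical in
/-- The weak derivative `f^{(τ)}` (unique almost everywhere; zero if there is none). -/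
def weakDeriv {s : ℕ} (τ : Fin s → ℕ) (f : (Fin s → ℝ) → ℝ) : (Fin s → ℝ) → ℝ :=
  if h : ∃ g, IsWeakDeriv τ f g then h.choose else 0

/-- `f` has square integrable weak mixed derivatives up to order `α` in each variable.
Continuity selects the representative for which point evaluation makes sense. -/
def IsSmooth {s : ℕ} (α : ℕ) (f : (Fin s → ℝ) → ℝ) : Prop :=
  ContinuousOn f (unitCube (Fin s)) ∧
    ∀ τ : Fin s → ℕ, (∀ j, τ j ≤ α) → ∃ g, IsWeakDeriv τ f g

/-- The point with coordinates `y` in `v` and `z` outside `v`. -/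
def glue {s : ℕ} (v : Finset (Fin s)) (y : {j // j ∈ v} → ℝ) (z : {j // j ∉ v} → ℝ) :
    Fin s → ℝ :=
  fun j => if h : j ∈ v then y ⟨j, h⟩ else z ⟨j, h⟩

/-- The function of `x_v` obtained by integrating `F` over the coordinates outside `v`. -/
def marginal {s : ℕ} (v : Finset (Fin s)) (F : (Fin s → ℝ) → ℝ) (y : {j // j ∈ v} → ℝ) : ℝ :=
  ∫ z in unitCube {j // j ∉ v}, F (glue v y z)

/-- The multi-index `(r_{u∖v}, α_v, 0)`. -/
def orderVec {s : ℕ} (α : ℕ) (u v : Finset (Fin s)) (r : {j // j ∈ u \ v} → ℕ) : Fin s → ℕ :=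
  fun j => if h : j ∈ u \ v then r ⟨j, h⟩ else if j ∈ v then α else 0

/-- The inner double sum (over `v ⊆ u` and `r ∈ {1, …, α-1}^{u∖v}`) belonging to the index set `u`
in the inner product. -/
def innerPart {s : ℕ} (α : ℕ) (u : Finset (Fin s)) (f g : (Fin s → ℝ) → ℝ) : ℝ :=
  ∑ v ∈ u.powerset,
    ∑ r ∈ Fintype.piFinset (fun _ : {j // j ∈ u \ v} => Finset.Icc 1 (α - 1)),
      ∫ y in unitCube {j // j ∈ v},
        marginal v (weakDeriv (orderVec α u v r) f) y *
          marginal v (weakDeriv (orderVec α u v r) g) y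

/-- The inner product of the weighted unanchored Sobolev space of order `α`. -/
def sobolevInner {s : ℕ} (α : ℕ) (γ : Finset (Fin s) → ℝ≥0) (f g : (Fin s → ℝ) → ℝ) : ℝ :=
  ∑ u : Finset (Fin s), ((γ u : ℝ))⁻¹ * innerPart α u f g

/-- The norm of the weighted unanchored Sobolev space of order `α`. -/
def sobolevNorm {s : ℕ} (α : ℕ) (γ : Finset (Fin s) → ℝ≥0) (f : (Fin s → ℝ) → ℝ) : ℝ :=
  Real.sqrt (sobolevInner α γ f f)

/-- The weighted unanchored Sobolev space of order `α`. For `γ_u = 0` the inner double sum is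
required to vanish (and the summand `0/0` of the inner product is `0`). -/
def sobolevSpace {s : ℕ} (α : ℕ) (γ : Finset (Fin s) → ℝ≥0) : Set ((Fin s → ℝ) → ℝ) :=
  {f | IsSmooth α f ∧ ∀ u : Finset (Fin s), γ u = 0 → innerPart α u f f = 0}

/-! ### Worst-case errors -/

/-- The integral of `f` over the unit cube. -/
def exactIntegral {s : ℕ} (f : (Fin s → ℝ) → ℝ) : ℝ := ∫ x in unitCube (Fin s), f x

/-- The QMC rule with point set `P`. -/
def qmc {s N : ℕ} (P : Fin N → Fin s → ℝ) (f : (Fin s → ℝ) → ℝ) : ℝ :=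
  (1 / (N : ℝ)) * ∑ n, f (P n)

/-- The worst-case error of the QMC rule with point set `P`, as an extended real number. -/
def worstCaseError {s N : ℕ} (α : ℕ) (γ : Finset (Fin s) → ℝ≥0) (P : Fin N → Fin s → ℝ) : ℝ≥0∞ :=
  ⨆ f ∈ {f | f ∈ sobolevSpace α γ ∧ sobolevNorm α γ f ≤ 1},
    ENNReal.ofReal |exactIntegral f - qmc P f|

/-- The digitally shifted point set. -/
def digitalShift (b : ℕ) [Fact b.Prime] {s N : ℕ} (P : Fin N → Fin s → ℝ) (σ : Fin s → ℝ) :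
    Fin N → Fin s → ℝ :=
  fun n j => digitAdd b (P n j) (σ j)

/-- The mean square worst-case error with respect to a random digital shift, uniformly
distributed in `[0,1)^s`. -/
def meanSquareError (b : ℕ) [Fact b.Prime] {s N : ℕ} (α : ℕ) (γ : Finset (Fin s) → ℝ≥0)
    (P : Fin N → Fin s → ℝ) : ℝ≥0∞ :=
  ∫⁻ σ in unitCube (Fin s), worstCaseError α γ (digitalShift b P σ) ^ 2

/-! ### The bound -/

/-- The weight `μ_α(k)`: the sum of the `min(ν,α)` largest positions (counted from `1`) of the `ν`
nonzero base `b` digits of `k`. -/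
def dickWeight (b α k : ℕ) : ℕ :=
  (((((List.range (Nat.digits b k).length).reverse.filter
    (fun i => k / b ^ i % b ≠ 0)).map (fun i => i + 1)).take α)).sum

/-- The constants `C_{τ,b}`, `τ ≥ 1`. -/
def constC (b τ : ℕ) : ℝ :=
  if τ = 1 then (2 * Real.sin (Real.pi / b))⁻¹
  else (1 + 1 / (b : ℝ) + 1 / ((b : ℝ) * (b + 1))) ^ (τ - 2) / (2 * Real.sin (Real.pi / b)) ^ τ

/-- The constant `C̃_{2α,b}`. -/
def constCtilde (b α : ℕ) : ℝ :=
  2 * (1 + 1 / (b : ℝ) + 1 / ((b : ℝ) * (b + 1))) ^ (2 * α - 2) /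
    (2 * Real.sin (Real.pi / b)) ^ (2 * α)

/-- The constants `C'_{α,b,ν}`, `1 ≤ ν ≤ α`. -/
def constCprime (b α ν : ℕ) : ℝ :=
  ∑ τ ∈ Finset.Icc ν α, constC b τ ^ 2 / (b : ℝ) ^ (2 * (τ - ν))

/-- The constant `D_{α,b}`: a maximum over `1 ≤ ν ≤ α`. -/
def constD (b α : ℕ) : ℝ :=
  ⨆ ν : Finset.Icc 1 α, (constCprime b α ν + constCtilde b α / (b : ℝ) ^ (2 * (α - (ν : ℕ))))

/-- The constant `b^{(2d-1)α} D_{α,b}`. -/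
def constDtilde (b α d : ℕ) : ℝ := (b : ℝ) ^ ((2 * d - 1) * α) * constD b α

/-- The function `r_{α,d}` on nonnegative integers. -/
def rFun (b α d l : ℕ) : ℝ :=
  if l = 0 then 1 else (b : ℝ) ^ (-(2 * (min α d : ℕ) * (dickWeight b 1 l : ℕ) + α : ℤ))

/-- The set of blocks `{d(j-1)+1, …, dj}` that meet `w`. -/
def blocks {s d : ℕ} (w : Finset (Fin (s * d))) : Finset (Fin s) :=
  Finset.univ.filter fun j => ∃ r : Fin d, finProdFinEquiv (j, r) ∈ w

/-- The vector `(l_w, 0)`. -/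
def extendZero {t : ℕ} (w : Finset (Fin t)) (l : {j // j ∈ w} → ℕ+) : Fin t → ℕ :=
  fun j => if h : j ∈ w then (l ⟨j, h⟩ : ℕ) else 0

/-- The quality criterion `B_{α,d,γ}(q,p)`, a sum of nonnegative terms in `[0,∞]`. -/
def criterion (b m s α d : ℕ) (γ : Finset (Fin s) → ℝ≥0)
    (q : Fin (s * d) → Polynomial (ZMod b)) (p : Polynomial (ZMod b)) : ℝ≥0∞ :=
  ∑ w ∈ (Finset.univ : Finset (Finset (Fin (s * d)))).filter (fun w => w.Nonempty),
    ENNReal.ofReal ((γ (blocks w) : ℝ) * constDtilde b α d ^ (blocks w).card) *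
      ∑' l : {l : {j // j ∈ w} → ℕ+ // extendZero w l ∈ dualNet b m q p},
        ENNReal.ofReal (∏ j, rFun b α d (l.1 j))

end HODN

end

/-!
The argument has an analytic half, which bounds the mean square worst-case error of any point set
with finitely many digits by a Walsh series, and an arithmetic half, which evaluates the exponential
sums in that series for the interlaced net.

*Representation.* Integration by parts against product test functions, extended by density to
products of square integrable functions, expresses `f (x)` through the weak derivatives of `f` of
all orders `ρ ≤ α`, integrated against products of the one-dimensional reproducing functions
`sobKer` (`eq_sum_integral_weakDeriv_mul`). The boundary terms disappear because the adjoint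
`adjPrim` of the primitive of mean zero produces functions vanishing at both endpoints. Kernels with
a coordinate of order below `α` do not depend on the integration variable of that coordinate, so
that only the marginals in the norm matter, and the Cauchy–Schwarz inequality bounds the squared
worst-case error by an explicit double sum of products of kernels (`worstCaseError_sq_le`).
Bernoulli polynomials are never needed: all kernels are iterates of `adjPrim`.

*Walsh expansion.* Averaging the kernel over all digital shifts leaves a function whose Walsh
expansion is diagonal. Its partial sums are integrals against a Dirichlet kernel, the normalized
indicator function of an elementary interval, and they converge because the kernel is Lipschitz
(`tendsto_sum_walCoef_mul_wal`). The coefficient of a frequency `k` consists of the squared means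
of the `r`-fold images of the `k`-th Walsh function under `adjPrim`, `r < α`, and the square
integral of the `α`-fold image. The Walsh expansion of one such image (`adjPrim_wal`) gives a
recursion that yields the decay `walCoef_le`; the square integral is treated by duality, as the
pairing of the image with its own conjugate.

*The net.* A frequency `k` is the interlacing of `d` frequencies, its components. An averaging
argument over the leading digits of the nonzero components (`sum_topPos_deint_le`) turns the decay
in `k` into a product of decays in the components, at the cost of the factor `b^{(2d-1)α}`
(`walCoef_le_prod_rFun`). On the points of the net, Walsh functions are characters of `𝔽_b^m`, so
that their sums vanish unless the components belong to the dual net (`walSum_eq_zero`). As the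
components determine the frequency, what remains is bounded by the criterion, which is finite
because `rFun` is summable.
-/

noncomputable section

namespace HODN

/-! ### The adjoint of the zero-mean primitive -/

/-- Lebesgue measure on `[0,1)`. -/
abbrev unitMeas : Measure ℝ := volume.restrict (Set.Ico 0 1)

instance : IsProbabilityMeasure unitMeas := ⟨by simp [unitMeas]⟩

section adjPrim

variable {E : Type*} [NormedAddCommGroup E] [NormedSpace ℝ E]

/-- The `L²`-adjoint of the operator sending a function on `[0,1]` to its primitive of mean zero:
up to sign, the primitive vanishing at `0` and `1` of `F` minus its mean. -/
def adjPrim (F : ℝ → E) (y : ℝ) : E :=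
  y • (∫ t in (0 : ℝ)..1, F t) - ∫ t in (0 : ℝ)..y, F t

lemma integral_unitMeas (F : ℝ → E) : ∫ t, F t ∂unitMeas = ∫ t in (0 : ℝ)..1, F t := by
  rw [intervalIntegral.integral_of_le zero_le_one, integral_Ico_eq_integral_Ioc]

omit [NormedSpace ℝ E] in
lemma integrable_unitMeas_iff {F : ℝ → E} :
    Integrable F unitMeas ↔ IntervalIntegrable F volume 0 1 := by
  rw [intervalIntegrable_iff_integrableOn_Ico_of_le zero_le_one]; rfl

omit [NormedSpace ℝ E] in
lemma intervalIntegrable_of_unitMeas {F : ℝ → E} (hF : Integrable F unitMeas) {x y : ℝ}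
    (hx : x ∈ Set.Icc (0 : ℝ) 1) (hy : y ∈ Set.Icc (0 : ℝ) 1) :
    IntervalIntegrable F volume x y := by
  refine (integrable_unitMeas_iff.1 hF).mono_set ?_
  rw [Set.uIcc_of_le (zero_le_one' ℝ)]
  exact Set.uIcc_subset_Icc hx hy

lemma norm_intervalIntegral_le_unitMeas {F : ℝ → E} (hF : Integrable F unitMeas) {y : ℝ}
    (hy : y ∈ Set.Icc (0 : ℝ) 1) :
    ‖∫ t in (0 : ℝ)..y, F t‖ ≤ ∫ t, ‖F t‖ ∂unitMeas := by
  refine (intervalIntegral.norm_integral_le_integral_norm hy.1).trans ?_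
  rw [integral_unitMeas]
  exact intervalIntegral.integral_mono_interval le_rfl hy.1 hy.2
    (Filter.Eventually.of_forall fun _ => norm_nonneg _) (integrable_unitMeas_iff.1 hF).norm

lemma norm_adjPrim_le {F : ℝ → E} (hF : Integrable F unitMeas) {y : ℝ}
    (hy : y ∈ Set.Icc (0 : ℝ) 1) : ‖adjPrim F y‖ ≤ 2 * ∫ t, ‖F t‖ ∂unitMeas := by
  have h1 := norm_intervalIntegral_le_unitMeas hF hy
  have h2 := norm_intervalIntegral_le_unitMeas hF (y := 1) (by simp)
  have h3 : ‖y • ∫ t in (0 : ℝ)..1, F t‖ ≤ ∫ t, ‖F t‖ ∂unitMeas := by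
    rw [norm_smul, Real.norm_of_nonneg hy.1]
    exact (mul_le_of_le_one_left (norm_nonneg _) hy.2).trans h2
  calc _ ≤ _ := norm_sub_le _ _
    _ ≤ _ := by linarith

lemma continuousOn_adjPrim {F : ℝ → E} (hF : Integrable F unitMeas) :
    ContinuousOn (adjPrim F) (Set.Icc 0 1) := by
  unfold adjPrim
  refine ContinuousOn.sub (by fun_prop) ?_
  have := intervalIntegral.continuousOn_primitive_interval (a := 0) (b := 1) (f := F) (μ := volume)
    (by rw [Set.uIcc_of_le (zero_le_one' ℝ), integrableOn_Icc_iff_integrableOn_Ico]; exact hF)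
  rwa [Set.uIcc_of_le (zero_le_one' ℝ)] at this

omit [NormedSpace ℝ E] in
lemma aestronglyMeasurable_unitMeas_of_continuousOn {F : ℝ → E}
    (hF : ContinuousOn F (Set.Icc 0 1)) : AEStronglyMeasurable F unitMeas :=
  (hF.mono Set.Ico_subset_Icc_self).aestronglyMeasurable measurableSet_Ico

lemma integrable_adjPrim {F : ℝ → E} (hF : Integrable F unitMeas) :
    Integrable (adjPrim F) unitMeas :=
  (continuousOn_adjPrim hF).integrableOn_Icc.mono_set Set.Ico_subset_Icc_self

lemma integrable_iterate_adjPrim {F : ℝ → E} (hF : Integrable F unitMeas) (r : ℕ) :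
    Integrable (adjPrim^[r] F) unitMeas := by
  induction r with
  | zero => exact hF
  | succ r ih => rw [Function.iterate_succ_apply']; exact integrable_adjPrim ih

lemma norm_iterate_adjPrim_le {F : ℝ → E} (hF : Integrable F unitMeas) (r : ℕ) {y : ℝ}
    (hy : y ∈ Set.Icc (0 : ℝ) 1) :
    ‖adjPrim^[r + 1] F y‖ ≤ 2 ^ (r + 1) * ∫ t, ‖F t‖ ∂unitMeas := by
  induction r generalizing y with
  | zero => simpa using norm_adjPrim_le hF hy
  | succ r ih =>
    rw [Function.iterate_succ_apply']
    refine (norm_adjPrim_le (integrable_iterate_adjPrim hF _) hy).trans ?_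
    rw [pow_succ' _ (r + 1), mul_assoc]
    gcongr
    have h : ∀ᵐ t ∂unitMeas, ‖adjPrim^[r + 1] F t‖ ≤ 2 ^ (r + 1) * ∫ t, ‖F t‖ ∂unitMeas := by
      filter_upwards [ae_restrict_mem measurableSet_Ico] with t ht
      exact ih (Set.Ico_subset_Icc_self ht)
    refine (integral_mono_ae (integrable_iterate_adjPrim hF _).norm (integrable_const _) h).trans ?_
    simp

lemma adjPrim_congr_ae {F G : ℝ → E} (h : F =ᵐ[unitMeas] G) {y : ℝ}
    (hy : y ∈ Set.Icc (0 : ℝ) 1) : adjPrim F y = adjPrim G y := by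
  have h' : ∀ z ∈ Set.Icc (0 : ℝ) 1, ∫ t in (0 : ℝ)..z, F t = ∫ t in (0 : ℝ)..z, G t := by
    intro z hz
    rw [intervalIntegral.integral_of_le hz.1, intervalIntegral.integral_of_le hz.1,
      ← integral_Ico_eq_integral_Ioc, ← integral_Ico_eq_integral_Ioc]
    exact integral_congr_ae (ae_mono (Measure.restrict_mono
      (Set.Ico_subset_Ico_right hz.2) le_rfl) h)
  rw [adjPrim, adjPrim, h' 1 (by simp), h' y hy]

lemma adjPrim_congr {F G : ℝ → E} (h : ∀ t ∈ Set.Icc (0 : ℝ) 1, F t = G t) {y : ℝ}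
    (hy : y ∈ Set.Icc (0 : ℝ) 1) : adjPrim F y = adjPrim G y :=
  adjPrim_congr_ae (by
    filter_upwards [ae_restrict_mem measurableSet_Ico] with t ht
    exact h t (Set.Ico_subset_Icc_self ht)) hy

lemma iterate_adjPrim_congr {F G : ℝ → E} (h : ∀ t ∈ Set.Icc (0 : ℝ) 1, F t = G t) (r : ℕ) :
    ∀ y ∈ Set.Icc (0 : ℝ) 1, adjPrim^[r] F y = adjPrim^[r] G y := by
  induction r with
  | zero => exact h
  | succ r ih =>
    intro y hy
    rw [Function.iterate_succ_apply', Function.iterate_succ_apply']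
    exact adjPrim_congr ih hy

lemma adjPrim_add {F G : ℝ → E} (hF : Integrable F unitMeas) (hG : Integrable G unitMeas) {y : ℝ}
    (hy : y ∈ Set.Icc (0 : ℝ) 1) :
    adjPrim (fun t => F t + G t) y = adjPrim F y + adjPrim G y := by
  have h0 : (0 : ℝ) ∈ Set.Icc (0 : ℝ) 1 := by simp
  have h1 : (1 : ℝ) ∈ Set.Icc (0 : ℝ) 1 := by simp
  simp only [adjPrim]
  rw [intervalIntegral.integral_add (intervalIntegrable_of_unitMeas hF h0 h1)
      (intervalIntegrable_of_unitMeas hG h0 h1),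
    intervalIntegral.integral_add (intervalIntegrable_of_unitMeas hF h0 hy)
      (intervalIntegrable_of_unitMeas hG h0 hy), smul_add]
  abel

lemma adjPrim_smul {𝕜 : Type*} [RCLike 𝕜] [NormedSpace 𝕜 E] [SMulCommClass ℝ 𝕜 E] (c : 𝕜)
    (F : ℝ → E) (y : ℝ) :
    adjPrim (fun t => c • F t) y = c • adjPrim F y := by
  simp only [adjPrim, intervalIntegral.integral_smul]
  rw [smul_sub, smul_comm]

lemma iterate_adjPrim_add {F G : ℝ → E} (hF : Integrable F unitMeas) (hG : Integrable G unitMeas)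
    (r : ℕ) : ∀ y ∈ Set.Icc (0 : ℝ) 1,
    adjPrim^[r] (fun t => F t + G t) y = adjPrim^[r] F y + adjPrim^[r] G y := by
  induction r with
  | zero => intro y _; rfl
  | succ r ih =>
    intro y hy
    simp only [Function.iterate_succ_apply']
    rw [adjPrim_congr ih hy]
    exact adjPrim_add (integrable_iterate_adjPrim hF r) (integrable_iterate_adjPrim hG r) hy

lemma iterate_adjPrim_smul {𝕜 : Type*} [RCLike 𝕜] [NormedSpace 𝕜 E] [SMulCommClass ℝ 𝕜 E] (c : 𝕜)
    (F : ℝ → E) (r : ℕ) (y : ℝ) :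
    adjPrim^[r] (fun t => c • F t) y = c • adjPrim^[r] F y := by
  induction r generalizing y with
  | zero => rfl
  | succ r ih =>
    simp only [Function.iterate_succ_apply']
    rw [show adjPrim^[r] (fun t => c • F t) = fun t => c • adjPrim^[r] F t from funext ih,
      adjPrim_smul]

lemma iterate_adjPrim_sub {F G : ℝ → E} (hF : Integrable F unitMeas) (hG : Integrable G unitMeas)
    (r : ℕ) : ∀ y ∈ Set.Icc (0 : ℝ) 1,
    adjPrim^[r] (fun t => F t - G t) y = adjPrim^[r] F y - adjPrim^[r] G y := by
  intro y hy
  have h := iterate_adjPrim_add (F := F) (G := fun t => (-1 : ℝ) • G t) hF (hG.smul (-1 : ℝ)) r y hy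
  rw [iterate_adjPrim_smul] at h
  simpa [sub_eq_add_neg] using h

lemma adjPrim_const [CompleteSpace E] (c : E) (y : ℝ) : adjPrim (fun _ => c) y = 0 := by
  simp [adjPrim]

lemma measurable_adjPrim_uncurry {X : Type*} [MeasurableSpace X] {g : X → ℝ → ℝ}
    (hg : Measurable (Function.uncurry g)) :
    Measurable (Function.uncurry fun x => adjPrim (g x)) := by
  have key : ∀ {h₁ h₂ : X × ℝ → ℝ}, Measurable h₁ → Measurable h₂ →
      Measurable fun p : X × ℝ => ∫ t in Set.Ioc (h₁ p) (h₂ p), g p.1 t := by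
    intro h₁ h₂ m₁ m₂
    simp_rw [← integral_indicator measurableSet_Ioc]
    refine (StronglyMeasurable.integral_prod_right (f := fun (p : X × ℝ) (t : ℝ) =>
      (Set.Ioc (h₁ p) (h₂ p)).indicator (g p.1) t) ?_).measurable
    have : (Function.uncurry fun (p : X × ℝ) (t : ℝ) =>
        (Set.Ioc (h₁ p) (h₂ p)).indicator (g p.1) t) =
        {q : (X × ℝ) × ℝ | h₁ q.1 < q.2 ∧ q.2 ≤ h₂ q.1}.indicator (fun q => g q.1.1 q.2) := by
      ext ⟨p, t⟩
      simp [Set.indicator_apply]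
    rw [this]
    refine Measurable.stronglyMeasurable (Measurable.indicator ?_ ?_)
    · exact hg.comp (by fun_prop : Measurable fun q : (X × ℝ) × ℝ => (q.1.1, q.2))
    · have n₁ : Measurable fun q : (X × ℝ) × ℝ => h₁ q.1 := m₁.comp measurable_fst
      have n₂ : Measurable fun q : (X × ℝ) × ℝ => h₂ q.1 := m₂.comp measurable_fst
      exact (measurableSet_lt n₁ measurable_snd).inter (measurableSet_le measurable_snd n₂)
  simp only [adjPrim, intervalIntegral, Function.uncurry_def, smul_eq_mul]
  have m2 : Measurable fun p : X × ℝ => p.2 := measurable_snd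
  exact (m2.mul ((key measurable_const measurable_const).sub
    (key measurable_const measurable_const))).sub
    ((key measurable_const m2).sub (key m2 measurable_const))

end adjPrim

/-! ### Kernels of the iterated zero-mean primitive -/

lemma ae_unitMeas_of_forall {P : ℝ → Prop} (h : ∀ t ∈ Set.Ico (0 : ℝ) 1, P t) :
    ∀ᵐ t ∂unitMeas, P t := by
  filter_upwards [ae_restrict_mem measurableSet_Ico] with t ht
  exact h t ht

lemma integral_unitMeas_le_of_forall {F : ℝ → ℝ} {C : ℝ} (h0 : ∀ t ∈ Set.Ico (0 : ℝ) 1, 0 ≤ F t)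
    (h : ∀ t ∈ Set.Ico (0 : ℝ) 1, F t ≤ C) : ∫ t, F t ∂unitMeas ≤ C := by
  refine (integral_mono_of_nonneg (ae_unitMeas_of_forall h0) (integrable_const C)
    (ae_unitMeas_of_forall h)).trans ?_
  simp

/-- The kernel, as a function of `(x, z)`, of the operator sending a function of `z` to its
primitive of mean zero in `x`. -/
def stepKer (x z : ℝ) : ℝ := z - if x < z then 1 else 0

/-- The kernel of the `(n+1)`-fold iterate of the zero-mean primitive. -/
def iterKer (n : ℕ) (x : ℝ) : ℝ → ℝ := adjPrim^[n] (stepKer x)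

lemma iterKer_succ (n : ℕ) (x : ℝ) : iterKer (n + 1) x = adjPrim (iterKer n x) :=
  Function.iterate_succ_apply' _ _ _

lemma measurable_stepKer : Measurable (Function.uncurry stepKer) := by
  refine measurable_snd.sub (Measurable.ite ?_ measurable_const measurable_const)
  exact measurableSet_lt measurable_fst measurable_snd

lemma measurable_iterKer_uncurry (n : ℕ) : Measurable (Function.uncurry (iterKer n)) := by
  induction n with
  | zero => exact measurable_stepKer
  | succ n ih =>
    have : iterKer (n + 1) = fun x => adjPrim (iterKer n x) := funext (iterKer_succ n)
    rw [this]
    exact measurable_adjPrim_uncurry ih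

lemma abs_stepKer_le (x : ℝ) {z : ℝ} (hz : z ∈ Set.Icc (0 : ℝ) 1) : |stepKer x z| ≤ 1 := by
  obtain ⟨h0, h1⟩ := hz
  unfold stepKer
  split_ifs <;> rw [abs_le] <;> constructor <;> linarith

lemma integrable_of_measurable_of_bound {F : ℝ → ℝ} (hF : Measurable F) {C : ℝ}
    (h : ∀ t ∈ Set.Ico (0 : ℝ) 1, |F t| ≤ C) : Integrable F unitMeas :=
  Integrable.of_bound hF.aestronglyMeasurable C (ae_unitMeas_of_forall h)

lemma integrable_stepKer (x : ℝ) : Integrable (stepKer x) unitMeas :=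
  integrable_of_measurable_of_bound (measurable_stepKer.comp measurable_prodMk_left)
    fun _ ht => abs_stepKer_le x (Set.Ico_subset_Icc_self ht)

lemma integrable_iterKer (n : ℕ) (x : ℝ) : Integrable (iterKer n x) unitMeas :=
  integrable_iterate_adjPrim (integrable_stepKer x) n

lemma abs_iterKer_le (n : ℕ) (x : ℝ) {z : ℝ} (hz : z ∈ Set.Icc (0 : ℝ) 1) :
    |iterKer n x z| ≤ 2 ^ n := by
  cases n with
  | zero => simpa [iterKer] using abs_stepKer_le x hz
  | succ n =>
    refine (norm_iterate_adjPrim_le (integrable_stepKer x) n hz).trans ?_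
    refine mul_le_of_le_one_right (by positivity) ?_
    exact integral_unitMeas_le_of_forall (fun _ _ => norm_nonneg _)
      fun t ht => abs_stepKer_le x (Set.Ico_subset_Icc_self ht)

lemma integral_abs_stepKer_sub_le (x x' : ℝ) :
    ∫ z, |stepKer x z - stepKer x' z| ∂unitMeas ≤ |x - x'| := by
  wlog h : x ≤ x' generalizing x x'
  · have := this x' x (le_of_not_ge h)
    rw [abs_sub_comm x x']
    simpa only [abs_sub_comm (stepKer x _)] using this
  have h1 : ∀ z, |stepKer x z - stepKer x' z| = (Set.Ioc x x').indicator (fun _ => (1 : ℝ)) z := by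
    intro z
    simp only [stepKer, Set.indicator_apply, Set.mem_Ioc]
    split_ifs <;> simp <;> grind
  simp_rw [h1]
  rw [integral_indicator measurableSet_Ioc]
  simp only [integral_const, smul_eq_mul, mul_one]
  rw [abs_sub_comm, abs_of_nonneg (sub_nonneg.2 h)]
  have h2 : (unitMeas.restrict (Set.Ioc x x')).real Set.univ ≤ (volume (Set.Ioc x x')).toReal := by
    rw [Measure.real, Measure.restrict_apply_univ]
    exact ENNReal.toReal_mono (by simp) (Measure.restrict_apply_le _ _)
  refine h2.trans ?_
  simp [h]

lemma integral_abs_iterate_adjPrim_le {F : ℝ → ℝ} (hF : Integrable F unitMeas) (r : ℕ) :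
    ∫ z, |adjPrim^[r] F z| ∂unitMeas ≤ 2 ^ r * ∫ z, |F z| ∂unitMeas := by
  cases r with
  | zero => simp
  | succ r =>
    exact integral_unitMeas_le_of_forall (fun _ _ => abs_nonneg _)
      fun t ht => norm_iterate_adjPrim_le hF r (Set.Ico_subset_Icc_self ht)

/-- The kernels depend on `x` in a Lipschitz way: in the `L¹` norm, already the kernel of a single
primitive does. -/
lemma integral_abs_iterKer_sub_le (n : ℕ) (x x' : ℝ) :
    ∫ z, |iterKer n x z - iterKer n x' z| ∂unitMeas ≤ 2 ^ n * |x - x'| := by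
  have h : ∫ z, |iterKer n x z - iterKer n x' z| ∂unitMeas =
      ∫ z, |adjPrim^[n] (fun t => stepKer x t - stepKer x' t) z| ∂unitMeas := by
    refine integral_congr_ae (ae_unitMeas_of_forall fun t ht => ?_)
    simp only
    rw [iterate_adjPrim_sub (integrable_stepKer x) (integrable_stepKer x') n t
      (Set.Ico_subset_Icc_self ht)]
    rfl
  rw [h]
  refine (integral_abs_iterate_adjPrim_le
    ((integrable_stepKer x).sub (integrable_stepKer x')) n).trans ?_
  gcongr
  exact integral_abs_stepKer_sub_le x x'

lemma abs_iterKer_succ_sub_le (n : ℕ) (x x' : ℝ) {z : ℝ} (hz : z ∈ Set.Icc (0 : ℝ) 1) :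
    |iterKer (n + 1) x z - iterKer (n + 1) x' z| ≤ 2 ^ (n + 1) * |x - x'| := by
  rw [iterKer, iterKer, ← iterate_adjPrim_sub (integrable_stepKer x) (integrable_stepKer x') _ z hz]
  refine (norm_iterate_adjPrim_le ((integrable_stepKer x).sub (integrable_stepKer x')) n
    hz).trans ?_
  gcongr
  exact integral_abs_stepKer_sub_le x x'

/-- Integrating the kernel of the iterated primitive against `w` in its first variable applies the
iterate of the adjoint to `w`. -/
lemma integral_iterKer_mul (n : ℕ) {w : ℝ → ℂ} (hw : Integrable w unitMeas) :
    ∀ z ∈ Set.Icc (0 : ℝ) 1, ∫ x, (iterKer n x z : ℂ) * w x ∂unitMeas = adjPrim^[n + 1] w z := by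
  induction n with
  | zero =>
    intro z hz
    have h1 : ∀ x, (iterKer 0 x z : ℂ) * w x = (z : ℂ) * w x - (Set.Iio z).indicator w x := by
      intro x
      simp only [iterKer, Function.iterate_zero, id, stepKer, Set.indicator_apply, Set.mem_Iio]
      split_ifs <;> simp [sub_mul]
    simp_rw [h1]
    rw [integral_sub (hw.const_mul _) (hw.indicator measurableSet_Iio), integral_const_mul,
      integral_indicator measurableSet_Iio, Measure.restrict_restrict measurableSet_Iio,
      integral_unitMeas]
    simp only [zero_add, Function.iterate_one, adjPrim, Complex.real_smul]
    congr 1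
    rw [intervalIntegral.integral_of_le hz.1, ← integral_Ico_eq_integral_Ioc]
    congr 2
    ext t
    simp only [Set.mem_inter_iff, Set.mem_Iio, Set.mem_Ico]
    constructor
    · rintro ⟨h, h', _⟩; exact ⟨h', h⟩
    · rintro ⟨h, h'⟩; exact ⟨h', h, h'.trans_le hz.2⟩
  | succ n ih =>
    intro z hz
    rw [Function.iterate_succ_apply', ← adjPrim_congr ih hz]
    have key : ∀ y ∈ Set.Icc (0 : ℝ) 1, ∫ t in (0 : ℝ)..y, ∫ x, (iterKer n x t : ℂ) * w x ∂unitMeas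
        = ∫ x, ((∫ t in (0 : ℝ)..y, iterKer n x t : ℝ) : ℂ) * w x ∂unitMeas := by
      intro y hy
      rw [intervalIntegral.integral_of_le hy.1, integral_integral_swap]
      · refine integral_congr_ae (Filter.Eventually.of_forall fun x => ?_)
        simp only
        rw [integral_mul_const, integral_complex_ofReal, intervalIntegral.integral_of_le hy.1]
      · have hm : AEStronglyMeasurable (Function.uncurry fun t x => (iterKer n x t : ℂ) * w x)
            ((volume.restrict (Set.Ioc 0 y)).prod unitMeas) := by
          refine AEStronglyMeasurable.mul ?_ ?_
          · exact (Complex.measurable_ofReal.comp ((measurable_iterKer_uncurry n).comp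
              measurable_swap)).aestronglyMeasurable
          · exact hw.aestronglyMeasurable.comp_snd
        refine Integrable.mono' (g := fun p : ℝ × ℝ => 2 ^ n * ‖w p.2‖) ?_ hm ?_
        · exact Integrable.comp_snd (f := fun x => 2 ^ n * ‖w x‖) (hw.norm.const_mul _) _
        · have : ∀ᵐ p ∂((volume.restrict (Set.Ioc 0 y)).prod unitMeas), p.1 ∈ Set.Ioc 0 y :=
            Measure.quasiMeasurePreserving_fst.ae (ae_restrict_mem measurableSet_Ioc)
          filter_upwards [this] with p hp
          simp only [Function.uncurry, norm_mul, Complex.norm_real]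
          gcongr
          exact abs_iterKer_le n _ ⟨hp.1.le, hp.2.trans hy.2⟩
    have h1 : ∀ y ∈ Set.Icc (0 : ℝ) 1, Integrable
        (fun x => ((∫ t in (0 : ℝ)..y, iterKer n x t : ℝ) : ℂ) * w x) unitMeas := by
      intro y hy
      have hm : AEStronglyMeasurable (fun x => ((∫ t in (0 : ℝ)..y, iterKer n x t : ℝ) : ℂ))
          unitMeas := by
        refine Measurable.aestronglyMeasurable (Complex.measurable_ofReal.comp ?_)
        simp_rw [intervalIntegral.integral_of_le hy.1]
        exact ((measurable_iterKer_uncurry n).stronglyMeasurable.integral_prod_right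
          (ν := volume.restrict (Set.Ioc 0 y))).measurable
      refine hw.bdd_mul (c := 2 ^ n) hm ?_
      refine Filter.Eventually.of_forall fun x => ?_
      rw [Complex.norm_real]
      refine (norm_intervalIntegral_le_unitMeas (integrable_iterKer n x) hy).trans ?_
      exact integral_unitMeas_le_of_forall (fun _ _ => norm_nonneg _)
        fun t ht => abs_iterKer_le n x (Set.Ico_subset_Icc_self ht)
    rw [adjPrim, key 1 (by simp), key z hz, Complex.real_smul, ← integral_const_mul,
      ← integral_sub ((h1 1 (by simp)).const_mul _) (h1 z hz)]
    refine integral_congr_ae (Filter.Eventually.of_forall fun x => ?_)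
    simp only [iterKer_succ, adjPrim, smul_eq_mul]
    push_cast
    ring

/-- The one-dimensional reproducing functions of the Sobolev space: `1` for `r = 0`, the
(scaled Bernoulli) polynomial in `x` for `1 ≤ r < α`, and the kernel of the iterated primitive for
`r = α`. A function with weak derivatives `f^{(r)}` is
`∑_{r ≤ α} ∫ f^{(r)}(z) sobKer α r x z dz`. -/
def sobKer (α r : ℕ) (x z : ℝ) : ℝ :=
  if r = 0 then 1 else if r < α then ∫ t, iterKer (r - 1) x t ∂unitMeas else iterKer (α - 1) x z

/-- The adjoint of the integral operator with kernel `sobKer α r`. -/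
def sobDual (α r : ℕ) (φ : ℝ → ℝ) (z : ℝ) : ℝ :=
  if r < α then ∫ t, adjPrim^[r] φ t ∂unitMeas else adjPrim^[α] φ z

lemma measurable_sobKer_uncurry (α r : ℕ) : Measurable (Function.uncurry (sobKer α r)) := by
  unfold sobKer
  split_ifs
  · exact measurable_const
  · exact ((measurable_iterKer_uncurry (r - 1)).stronglyMeasurable.integral_prod_right
      (ν := unitMeas)).measurable.comp measurable_fst
  · exact measurable_iterKer_uncurry _

lemma measurable_sobKer (α r : ℕ) (x : ℝ) : Measurable (sobKer α r x) :=
  (measurable_sobKer_uncurry α r).comp measurable_prodMk_left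

lemma abs_sobKer_le (α r : ℕ) (x : ℝ) {z : ℝ} (hz : z ∈ Set.Icc (0 : ℝ) 1) :
    |sobKer α r x z| ≤ 2 ^ α := by
  have h1 : (1 : ℝ) ≤ 2 ^ α := one_le_pow₀ (by norm_num)
  unfold sobKer
  split_ifs with h h'
  · simpa using h1
  · refine (abs_integral_le_integral_abs).trans ?_
    refine integral_unitMeas_le_of_forall (fun _ _ => abs_nonneg _) fun t ht =>
      (abs_iterKer_le _ x (Set.Ico_subset_Icc_self ht)).trans ?_
    exact pow_le_pow_right₀ (by norm_num) (by omega)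
  · exact (abs_iterKer_le _ x hz).trans (pow_le_pow_right₀ (by norm_num) (by omega))

lemma abs_sobKer_sub_le {α : ℕ} (hα : 2 ≤ α) (r : ℕ) (x x' : ℝ) {z : ℝ}
    (hz : z ∈ Set.Icc (0 : ℝ) 1) :
    |sobKer α r x z - sobKer α r x' z| ≤ 2 ^ α * |x - x'| := by
  unfold sobKer
  split_ifs with h h'
  · simp
  · rw [← integral_sub (integrable_iterKer _ x) (integrable_iterKer _ x')]
    refine (abs_integral_le_integral_abs).trans ((integral_abs_iterKer_sub_le _ x x').trans ?_)
    gcongr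
    · norm_num
    · omega
  · obtain ⟨n, rfl⟩ : ∃ n, α = n + 2 := ⟨α - 2, by omega⟩
    refine (abs_iterKer_succ_sub_le n x x' hz).trans ?_
    gcongr
    · norm_num
    · omega

/-- The normalized indicator function of `[x, x+ε)`. -/
def bump (x ε : ℝ) : ℝ → ℝ := (Set.Ico x (x + ε)).indicator fun _ => ε⁻¹

lemma integrable_bump (x ε : ℝ) : Integrable (bump x ε) unitMeas :=
  (integrable_const _).indicator measurableSet_Ico

lemma intervalIntegral_bump {x ε : ℝ} (hx : 0 ≤ x) {y : ℝ}
    (hy : y ∈ Set.Icc (0 : ℝ) 1) :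
    ∫ t in (0 : ℝ)..y, bump x ε t = ε⁻¹ * max (min y (x + ε) - x) 0 := by
  rw [intervalIntegral.integral_of_le hy.1, ← integral_Ico_eq_integral_Ioc, bump,
    integral_indicator measurableSet_Ico, Measure.restrict_restrict measurableSet_Ico,
    Set.Ico_inter_Ico, setIntegral_const, smul_eq_mul, mul_comm]
  congr 1
  rw [Measure.real, Real.volume_Ico, ENNReal.toReal_ofReal', sup_eq_left.2 hx, inf_comm]

lemma integral_bump {x ε : ℝ} (hx : 0 ≤ x) (hε : 0 < ε) (h : x + ε ≤ 1) :
    ∫ t, bump x ε t ∂unitMeas = 1 := by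
  rw [integral_unitMeas, intervalIntegral_bump hx (by simp), min_eq_right h, add_sub_cancel_left,
    max_eq_left hε.le, inv_mul_cancel₀ hε.ne']

lemma integral_abs_adjPrim_bump_sub_le {x ε : ℝ} (hx : 0 ≤ x) (hε : 0 < ε) (h : x + ε ≤ 1) :
    ∫ z, |adjPrim (bump x ε) z - stepKer x z| ∂unitMeas ≤ ε := by
  have h1 : ∀ z ∈ Set.Ico (0 : ℝ) 1, |adjPrim (bump x ε) z - stepKer x z| ≤
      (Set.Ioc x (x + ε)).indicator (fun _ => (1 : ℝ)) z := by
    intro z hz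
    have e1 : ∫ t in (0 : ℝ)..1, bump x ε t = 1 := by
      rw [← integral_unitMeas, integral_bump hx hε h]
    rw [adjPrim, e1, intervalIntegral_bump hx (Set.Ico_subset_Icc_self hz), stepKer,
      Set.indicator_apply, smul_eq_mul, mul_one, sub_sub_sub_cancel_left]
    by_cases c1 : x < z
    · by_cases c2 : z ≤ x + ε
      · rw [if_pos c1, if_pos ⟨c1, c2⟩, min_eq_left c2, max_eq_left (by linarith),
          inv_mul_eq_div]
        have : (z - x) / ε ≤ 1 := (div_le_one hε).2 (by linarith)
        have : 0 ≤ (z - x) / ε := div_nonneg (by linarith) hε.le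
        rw [abs_le]; constructor <;> linarith
      · rw [if_pos c1, if_neg (fun h => c2 h.2), min_eq_right (by linarith), add_sub_cancel_left,
          max_eq_left hε.le, inv_mul_cancel₀ hε.ne']
        simp
    · rw [if_neg c1, if_neg (fun h => c1 h.1), max_eq_right]
      · simp
      · have := min_le_left z (x + ε); linarith
  refine (integral_mono_of_nonneg (Filter.Eventually.of_forall fun _ => abs_nonneg _)
    ((integrable_const _).indicator measurableSet_Ioc) (ae_unitMeas_of_forall h1)).trans ?_
  rw [integral_indicator measurableSet_Ioc]
  simp only [integral_const, smul_eq_mul, mul_one]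
  have h2 : (unitMeas.restrict (Set.Ioc x (x + ε))).real Set.univ ≤
      (volume (Set.Ioc x (x + ε))).toReal := by
    rw [Measure.real, Measure.restrict_apply_univ]
    exact ENNReal.toReal_mono (by simp) (Measure.restrict_apply_le _ _)
  refine h2.trans ?_
  simp [hε.le]

lemma abs_sobDual_bump_sub_le {α : ℕ} (hα : 2 ≤ α) (r : ℕ) {x ε : ℝ} (hx : 0 ≤ x) (hε : 0 < ε)
    (h : x + ε ≤ 1) {z : ℝ} (hz : z ∈ Set.Icc (0 : ℝ) 1) :
    |sobDual α r (bump x ε) z - sobKer α r x z| ≤ 2 ^ α * ε := by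
  have hI := integrable_adjPrim (integrable_bump x ε)
  have hd : ∀ n, ∀ y ∈ Set.Icc (0 : ℝ) 1, adjPrim^[n + 1] (bump x ε) y - iterKer n x y =
      adjPrim^[n] (fun t => adjPrim (bump x ε) t - stepKer x t) y := by
    intro n y hy
    rw [iterate_adjPrim_sub hI (integrable_stepKer x) n y hy, Function.iterate_succ_apply]
    rfl
  unfold sobDual sobKer
  by_cases h0 : r = 0
  · subst h0
    rw [if_pos (by omega), if_pos rfl, Function.iterate_zero, id, integral_bump hx hε h]
    simp; positivity
  by_cases h1 : r < α
  · rw [if_pos h1, if_neg h0, if_pos h1]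
    obtain ⟨n, rfl⟩ : ∃ n, r = n + 1 := ⟨r - 1, by omega⟩
    rw [Nat.add_sub_cancel, ← integral_sub (integrable_iterate_adjPrim (integrable_bump x ε) _)
      (integrable_iterKer n x)]
    refine abs_integral_le_integral_abs.trans ?_
    have e : ∫ a, |adjPrim^[n + 1] (bump x ε) a - iterKer n x a| ∂unitMeas =
        ∫ a, |adjPrim^[n] (fun t => adjPrim (bump x ε) t - stepKer x t) a| ∂unitMeas :=
      integral_congr_ae (ae_unitMeas_of_forall fun t ht => by
        simp only [hd n t (Set.Ico_subset_Icc_self ht)])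
    rw [e]
    refine (integral_abs_iterate_adjPrim_le (hI.sub (integrable_stepKer x)) n).trans ?_
    gcongr
    · norm_num
    · omega
    · exact integral_abs_adjPrim_bump_sub_le hx hε h
  · rw [if_neg h1, if_neg h0, if_neg h1]
    obtain ⟨n, rfl⟩ : ∃ n, α = n + 2 := ⟨α - 2, by omega⟩
    rw [show n + 2 - 1 = n + 1 from rfl, hd (n + 1) z hz]
    refine (norm_iterate_adjPrim_le (hI.sub (integrable_stepKer x)) n hz).trans ?_
    gcongr
    · norm_num
    · omega
    · exact integral_abs_adjPrim_bump_sub_le hx hε h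

/-! ### Product test functions -/

/-- Smooth functions on the line with compact support in `(0,1)`. -/
structure IsTest (ψ : ℝ → ℝ) : Prop where
  contDiff : ContDiff ℝ ((⊤ : ℕ∞) : WithTop ℕ∞) ψ
  hasCompactSupport : HasCompactSupport ψ
  tsupport_subset : tsupport ψ ⊆ Set.Ioo 0 1

/-- The tensor product `x ↦ ∏ j, ψ j (x j)`. -/
def tensor {s : ℕ} (ψ : Fin s → ℝ → ℝ) (x : Fin s → ℝ) : ℝ := ∏ j, ψ j (x j)

lemma IsTest.deriv {ψ : ℝ → ℝ} (h : IsTest ψ) : IsTest (deriv ψ) where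
  contDiff := (contDiff_infty_iff_deriv.1 h.contDiff).2
  hasCompactSupport := h.hasCompactSupport.deriv
  tsupport_subset := (tsupport_deriv_subset (𝕜 := ℝ)).trans h.tsupport_subset

lemma IsTest.iterate_deriv {ψ : ℝ → ℝ} (h : IsTest ψ) (n : ℕ) : IsTest (_root_.deriv^[n] ψ) := by
  induction n with
  | zero => exact h
  | succ n ih => rw [Function.iterate_succ_apply']; exact ih.deriv

lemma contDiff_tensor {s : ℕ} {ψ : Fin s → ℝ → ℝ} (h : ∀ j, IsTest (ψ j)) :
    ContDiff ℝ ((⊤ : ℕ∞) : WithTop ℕ∞) (tensor ψ) := by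
  unfold tensor
  exact contDiff_prod fun j _ => (h j).contDiff.comp (contDiff_apply ℝ ℝ j)

lemma tsupport_tensor_subset {s : ℕ} (ψ : Fin s → ℝ → ℝ) :
    tsupport (tensor ψ) ⊆ Set.univ.pi fun j => tsupport (ψ j) := by
  refine closure_minimal ?_ (isClosed_set_pi fun j _ => isClosed_tsupport _)
  intro x hx j _
  refine subset_tsupport _ ?_
  rw [Function.mem_support] at hx ⊢
  exact fun h0 => hx (Finset.prod_eq_zero (Finset.mem_univ j) h0)

lemma hasCompactSupport_tensor {s : ℕ} {ψ : Fin s → ℝ → ℝ} (h : ∀ j, IsTest (ψ j)) :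
    HasCompactSupport (tensor ψ) :=
  (isCompact_univ_pi fun j => (h j).hasCompactSupport.isCompact).of_isClosed_subset
    (isClosed_tsupport _) (tsupport_tensor_subset ψ)

lemma tsupport_tensor_subset_openCube {s : ℕ} {ψ : Fin s → ℝ → ℝ} (h : ∀ j, IsTest (ψ j)) :
    tsupport (tensor ψ) ⊆ openCube (Fin s) :=
  (tsupport_tensor_subset ψ).trans (Set.pi_mono fun j _ => (h j).tsupport_subset)

lemma tensor_update {s : ℕ} (ψ : Fin s → ℝ → ℝ) (j : Fin s) (φ : ℝ → ℝ) (x : Fin s → ℝ) :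
    tensor (Function.update ψ j φ) x = φ (x j) * ∏ i ∈ Finset.univ.erase j, ψ i (x i) := by
  rw [tensor, ← Finset.mul_prod_erase _ _ (Finset.mem_univ j), Function.update_self]
  congr 1
  refine Finset.prod_congr rfl fun i hi => ?_
  rw [Function.update_of_ne (Finset.ne_of_mem_erase hi)]

lemma partialDeriv_tensor {s : ℕ} {ψ : Fin s → ℝ → ℝ} (h : ∀ j, IsTest (ψ j)) (j : Fin s) :
    partialDeriv j (tensor ψ) = tensor (Function.update ψ j (deriv (ψ j))) := by
  ext x
  have h1 : HasDerivAt (tensor ψ ∘ Function.update x j) (fderiv ℝ (tensor ψ) x (Pi.single j 1))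
      (x j) := by
    have hd : DifferentiableAt ℝ (tensor ψ) (Function.update x j (x j)) :=
      ((contDiff_tensor h).differentiable (by simp)).differentiableAt
    have := hd.hasFDerivAt.comp_hasDerivAt (x j) (hasDerivAt_update x j (x j))
    rwa [Function.update_eq_self] at this
  have h2 : HasDerivAt (tensor ψ ∘ Function.update x j)
      (deriv (ψ j) (x j) * ∏ i ∈ Finset.univ.erase j, ψ i (x i)) (x j) := by
    have e : tensor ψ ∘ Function.update x j =
        fun t => ψ j t * ∏ i ∈ Finset.univ.erase j, ψ i (x i) := by
      ext t
      simp only [Function.comp]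
      rw [← Function.update_eq_self j ψ, tensor_update, Function.update_self,
        Function.update_eq_self]
      congr 1
      refine Finset.prod_congr rfl fun i hi => ?_
      rw [Function.update_of_ne (Finset.ne_of_mem_erase hi)]
    rw [e]
    exact ((((h j).contDiff.differentiable (by simp)) (x j)).hasDerivAt).mul_const _
  rw [partialDeriv, h1.unique h2, tensor_update]

lemma iterate_partialDeriv_tensor {s : ℕ} {ψ : Fin s → ℝ → ℝ} (h : ∀ j, IsTest (ψ j)) (j : Fin s)
    (n : ℕ) :
    (partialDeriv j)^[n] (tensor ψ) = tensor (Function.update ψ j (deriv^[n] (ψ j))) := by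
  induction n with
  | zero => simp
  | succ n ih =>
    rw [Function.iterate_succ_apply', ih, partialDeriv_tensor]
    · rw [Function.update_idem, Function.update_self, Function.iterate_succ_apply']
    · intro i
      rcases eq_or_ne i j with rfl | hi
      · rw [Function.update_self]; exact (h i).iterate_deriv n
      · rw [Function.update_of_ne hi]; exact h i

lemma classicalDeriv_tensor {s : ℕ} {ψ : Fin s → ℝ → ℝ} (h : ∀ j, IsTest (ψ j))
    (τ : Fin s → ℕ) :
    classicalDeriv τ (tensor ψ) = tensor fun j => deriv^[τ j] (ψ j) := by
  have key : ∀ l : List (Fin s), l.Nodup →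
      l.foldr (fun j ψ => (partialDeriv j)^[τ j] ψ) (tensor ψ) =
        tensor fun j => if j ∈ l then deriv^[τ j] (ψ j) else ψ j := by
    intro l
    induction l with
    | nil => intro _; simp
    | cons a l ih =>
      intro hl
      rw [List.nodup_cons] at hl
      rw [List.foldr_cons, ih hl.2, iterate_partialDeriv_tensor]
      · congr 1
        ext i : 1
        rcases eq_or_ne i a with rfl | hi
        · simp [hl.1]
        · simp [hi]
      · intro i
        split_ifs
        · exact (h i).iterate_deriv _
        · exact h i
  rw [classicalDeriv, key _ (List.nodup_finRange s)]
  simp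

/-- A test function with vanishing integral is the derivative of a test function. -/
lemma IsTest.exists_primitive {ω : ℝ → ℝ} (h : IsTest ω) (h0 : ∫ t in (0 : ℝ)..1, ω t = 0) :
    IsTest (fun x => ∫ t in (0 : ℝ)..x, ω t) ∧
      _root_.deriv (fun x => ∫ t in (0 : ℝ)..x, ω t) = ω := by
  have hc := h.contDiff.continuous
  have hd : _root_.deriv (fun x => ∫ t in (0 : ℝ)..x, ω t) = ω :=
    funext fun x => hc.deriv_integral _ 0 x
  have hz : ∀ t, t ∉ tsupport ω → ω t = 0 := fun t ht => image_eq_zero_of_notMem_tsupport ht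
  have hsupp : ∃ a b : ℝ, 0 < a ∧ b < 1 ∧ a ≤ b ∧ tsupport ω ⊆ Set.Icc a b := by
    rcases (tsupport ω).eq_empty_or_nonempty with he | hne
    · exact ⟨1 / 2, 1 / 2, by norm_num, by norm_num, le_rfl, by simp [he]⟩
    · have hK := h.hasCompactSupport.isCompact
      obtain ⟨a, ha, ha'⟩ := hK.exists_isLeast hne
      obtain ⟨b, hb, hb'⟩ := hK.exists_isGreatest hne
      exact ⟨a, b, (h.tsupport_subset ha).1, (h.tsupport_subset hb).2, ha' hb,
        fun t ht => ⟨ha' ht, hb' ht⟩⟩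
  obtain ⟨a, b, ha, hb, hab, hs⟩ := hsupp
  have hv : ∀ x, x ∉ Set.Icc a b → ∫ t in (0 : ℝ)..x, ω t = 0 := by
    intro x hx
    rw [Set.mem_Icc, not_and_or, not_le, not_le] at hx
    rcases hx with hx | hx
    · rw [intervalIntegral.integral_congr (g := fun _ => 0)]
      · simp
      · intro t ht
        refine hz t fun ht' => ?_
        have := (hs ht').1
        rcases Set.mem_uIcc.1 ht with h' | h' <;> linarith
    · rw [← intervalIntegral.integral_add_adjacent_intervals (hc.intervalIntegrable 0 1)
        (hc.intervalIntegrable 1 x), h0, zero_add,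
        intervalIntegral.integral_congr (g := fun _ => 0)]
      · simp
      · intro t ht
        refine hz t fun ht' => ?_
        have := (hs ht').2
        rcases Set.mem_uIcc.1 ht with h' | h' <;> linarith
  have hts : tsupport (fun x => ∫ t in (0 : ℝ)..x, ω t) ⊆ Set.Icc a b := by
    refine closure_minimal ?_ isClosed_Icc
    intro x hx
    by_contra hx'
    exact hx (hv x hx')
  refine ⟨⟨?_, ?_, ?_⟩, hd⟩
  · rw [contDiff_infty_iff_deriv, hd]
    exact ⟨fun x => (intervalIntegral.integral_hasDerivAt_right (hc.intervalIntegrable 0 x)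
      hc.aestronglyMeasurable.stronglyMeasurableAtFilter hc.continuousAt).differentiableAt,
      h.contDiff⟩
  · exact isCompact_Icc.of_isClosed_subset (isClosed_tsupport _) hts
  · exact hts.trans fun t ht => ⟨ha.trans_le ht.1, ht.2.trans_lt hb⟩

/-! ### Density of test functions -/

/-- The Cauchy–Schwarz inequality. -/
lemma integral_mul_sq_le {X : Type*} [MeasurableSpace X] {μ : Measure X} {f g : X → ℝ}
    (hf : MemLp f 2 μ) (hg : MemLp g 2 μ) :
    (∫ x, f x * g x ∂μ) ^ 2 ≤ (∫ x, f x ^ 2 ∂μ) * ∫ x, g x ^ 2 ∂μ := by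
  have hfg : Integrable (fun x => f x * g x) μ := hf.integrable_mul hg
  have h : ∀ t : ℝ, 0 ≤ (∫ x, f x ^ 2 ∂μ) * (t * t) + (-2 * ∫ x, f x * g x ∂μ) * t
      + ∫ x, g x ^ 2 ∂μ := by
    intro t
    have h1 : (∫ x, f x ^ 2 ∂μ) * (t * t) + (-2 * ∫ x, f x * g x ∂μ) * t + ∫ x, g x ^ 2 ∂μ =
        ∫ x, (t * f x - g x) ^ 2 ∂μ := by
      have e : ∀ x, (t * f x - g x) ^ 2 = (t * t) * f x ^ 2 + (-2 * t) * (f x * g x) + g x ^ 2 :=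
        fun x => by ring
      have i1 := hf.integrable_sq.const_mul (t * t)
      have i2 := hfg.const_mul (-2 * t)
      have i3 : Integrable (fun x => t * t * f x ^ 2 + -2 * t * (f x * g x)) μ := i1.add i2
      simp_rw [e]
      rw [integral_add i3 hg.integrable_sq, integral_add i1 i2, integral_const_mul,
        integral_const_mul]
      ring
    rw [h1]
    exact integral_nonneg fun x => sq_nonneg _
  have := discrim_le_zero h
  rw [discrim] at this
  nlinarith

lemma IsTest.sub {φ ψ : ℝ → ℝ} (hφ : IsTest φ) (hψ : IsTest ψ) :
    IsTest (fun t => φ t - ψ t) where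
  contDiff := hφ.contDiff.sub hψ.contDiff
  hasCompactSupport := hφ.hasCompactSupport.sub hψ.hasCompactSupport
  tsupport_subset := (tsupport_sub φ ψ).trans
    (Set.union_subset hφ.tsupport_subset hψ.tsupport_subset)

lemma IsTest.smul {φ : ℝ → ℝ} (hφ : IsTest φ) (c : ℝ) : IsTest (fun t => c * φ t) where
  contDiff := contDiff_const.mul hφ.contDiff
  hasCompactSupport := hφ.hasCompactSupport.mul_left
  tsupport_subset := (tsupport_mul_subset_right (f := fun _ => c) (g := φ)).trans hφ.tsupport_subset

lemma IsTest.memLp {φ : ℝ → ℝ} (hφ : IsTest φ) : MemLp φ 2 unitMeas :=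
  hφ.contDiff.continuous.memLp_of_hasCompactSupport hφ.hasCompactSupport

/-- The smooth cutoff function that is `1` on `[2δ, 1 - 2δ]` and supported in `[δ, 1 - δ]`, with
`δ = 1/(4(n+2))`. -/
def cutoff (n : ℕ) : ContDiffBump (1 / 2 : ℝ) where
  rIn := 1 / 2 - 2 * (1 / (4 * (n + 2)))
  rOut := 1 / 2 - 1 / (4 * (n + 2))
  rIn_pos := by
    have h : (0 : ℝ) < n + 2 := by positivity
    rw [sub_pos, mul_one_div, div_lt_div_iff₀ (by positivity) (by norm_num)]
    linarith [show (0 : ℝ) ≤ n from n.cast_nonneg]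
  rIn_lt_rOut := by
    have h : (0 : ℝ) < 1 / (4 * (n + 2)) := by positivity
    linarith

lemma isTest_mul_cutoff {g : ℝ → ℝ} (hg : ContDiff ℝ ((⊤ : ℕ∞) : WithTop ℕ∞) g) (n : ℕ) :
    IsTest (fun t => g t * cutoff n t) where
  contDiff := hg.mul (cutoff n).contDiff
  hasCompactSupport := (cutoff n).hasCompactSupport.mul_left
  tsupport_subset := by
    refine (tsupport_mul_subset_right (f := g)).trans ?_
    rw [(cutoff n).tsupport_eq, Real.closedBall_eq_Icc]
    have h : (0 : ℝ) < 1 / (4 * (n + 2)) := by positivity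
    have e : (cutoff n).rOut = 1 / 2 - 1 / (4 * (n + 2)) := rfl
    rw [e]
    intro t ht
    exact ⟨by linarith [ht.1], by linarith [ht.2]⟩

lemma tendsto_cutoff {t : ℝ} (ht : t ∈ Set.Ioo (0 : ℝ) 1) :
    ∀ᶠ n : ℕ in Filter.atTop, cutoff n t = 1 := by
  have h1 : Filter.Tendsto (fun n : ℕ => 2 * (1 / (4 * ((n : ℝ) + 2)))) Filter.atTop (nhds 0) := by
    have h2 : Filter.Tendsto (fun n : ℕ => 1 / (((n + 2 : ℕ) : ℝ))) Filter.atTop (nhds 0) :=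
      (tendsto_one_div_atTop_nhds_zero_nat).comp (Filter.tendsto_add_atTop_nat 2)
    have h3 := h2.const_mul (1 / 2)
    rw [mul_zero] at h3
    refine h3.congr fun n => ?_
    push_cast
    field_simp
    norm_num
  have hmin : 0 < min t (1 - t) := lt_min ht.1 (by linarith [ht.2])
  filter_upwards [h1.eventually (gt_mem_nhds hmin)] with n hn
  refine (cutoff n).one_of_mem_closedBall ?_
  rw [Real.closedBall_eq_Icc]
  have e : (cutoff n).rIn = 1 / 2 - 2 * (1 / (4 * (n + 2))) := rfl
  rw [e]
  have := hn.trans_le (min_le_left _ _)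
  have := hn.trans_le (min_le_right _ _)
  constructor <;> linarith

lemma exists_isTest_approx {φ : ℝ → ℝ} (hφ : MemLp φ 2 unitMeas) {ε : ℝ} (hε : 0 < ε) :
    ∃ η, IsTest η ∧ ∫ t, (η t - φ t) ^ 2 ∂unitMeas < ε := by
  obtain ⟨g, hgc, hgs, hg⟩ := hφ.exist_eLpNorm_sub_le (by norm_num) (by norm_num)
    (ε := Real.sqrt (ε / 5)) (Real.sqrt_pos.2 (by positivity))
  have hgL : MemLp g 2 unitMeas := hgs.continuous.memLp_of_hasCompactSupport hgc
  have h1 : ∫ t, (g t - φ t) ^ 2 ∂unitMeas ≤ ε / 5 := by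
    have e : ∫ t, (g t - φ t) ^ 2 ∂unitMeas = (eLpNorm (φ - g) 2 unitMeas).toReal ^ 2 := by
      rw [(hφ.sub hgL).eLpNorm_eq_integral_rpow_norm (by norm_num) (by norm_num)]
      rw [ENNReal.toReal_ofReal (by positivity)]
      simp only [ENNReal.toReal_ofNat, Real.rpow_ofNat, Pi.sub_apply]
      rw [← Real.rpow_natCast, ← Real.rpow_mul (by positivity)]
      norm_num
      exact integral_congr_ae (Filter.Eventually.of_forall fun t => by simp only; ring)
    rw [e, ← Real.sq_sqrt (show 0 ≤ ε / 5 by positivity)]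
    gcongr
    exact ENNReal.toReal_le_of_le_ofReal (Real.sqrt_nonneg _) hg
  obtain ⟨C, hC⟩ := hgc.exists_bound_of_continuous hgs.continuous
  have h2 : Filter.Tendsto (fun n : ℕ => ∫ t, (g t * cutoff n t - g t) ^ 2 ∂unitMeas)
      Filter.atTop (nhds (∫ t, (0 : ℝ) ∂unitMeas)) := by
    refine tendsto_integral_of_dominated_convergence (fun _ => C ^ 2) ?_ (integrable_const _) ?_ ?_
    · intro n
      exact (((hgs.continuous.mul (cutoff n).continuous).sub
        hgs.continuous).pow 2).aestronglyMeasurable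
    · intro n
      refine Filter.Eventually.of_forall fun t => ?_
      rw [Real.norm_of_nonneg (sq_nonneg _), ← sq_abs]
      have e : g t * cutoff n t - g t = -(g t * (1 - cutoff n t)) := by ring
      rw [e, abs_neg, abs_mul, abs_of_nonneg (sub_nonneg.2 (cutoff n).le_one)]
      refine pow_le_pow_left₀ (mul_nonneg (abs_nonneg _) (sub_nonneg.2 (cutoff n).le_one)) ?_ 2
      refine (mul_le_of_le_one_right (abs_nonneg _) ?_).trans (hC t)
      linarith [(cutoff n).nonneg (x := t)]
    · have : ∀ᵐ t ∂unitMeas, t ∈ Set.Ioo (0 : ℝ) 1 := by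
        rw [unitMeas, ← restrict_Ioo_eq_restrict_Ico]
        exact ae_restrict_mem measurableSet_Ioo
      filter_upwards [this] with t ht
      refine tendsto_const_nhds.congr' ?_
      filter_upwards [tendsto_cutoff ht] with n hn
      simp [hn]
  rw [integral_zero] at h2
  obtain ⟨n, hn⟩ := (h2.eventually (gt_mem_nhds (show 0 < ε / 5 by positivity))).exists
  refine ⟨_, isTest_mul_cutoff hgs n, ?_⟩
  have hL := (isTest_mul_cutoff hgs n).memLp
  have i1 : Integrable (fun t => 2 * (g t * cutoff n t - g t) ^ 2) unitMeas :=
    (hL.sub hgL).integrable_sq.const_mul 2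
  have i2 : Integrable (fun t => 2 * (g t - φ t) ^ 2) unitMeas :=
    (hgL.sub hφ).integrable_sq.const_mul 2
  have h3 : ∫ t, (g t * cutoff n t - φ t) ^ 2 ∂unitMeas ≤
      ∫ t, (2 * (g t * cutoff n t - g t) ^ 2 + 2 * (g t - φ t) ^ 2) ∂unitMeas := by
    refine integral_mono_of_nonneg (Filter.Eventually.of_forall fun t => sq_nonneg _) (i1.add i2)
      (Filter.Eventually.of_forall fun t => ?_)
    simp only
    nlinarith [sq_nonneg (g t * cutoff n t - g t - (g t - φ t))]
  rw [integral_add i1 i2, integral_const_mul, integral_const_mul] at h3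
  linarith

lemma exists_isTest_tendsto {φ : ℝ → ℝ} (hφ : MemLp φ 2 unitMeas) :
    ∃ η : ℕ → ℝ → ℝ, (∀ n, IsTest (η n)) ∧
      Filter.Tendsto (fun n => ∫ t, (η n t - φ t) ^ 2 ∂unitMeas) Filter.atTop (nhds 0) := by
  choose η h1 h2 using fun n : ℕ => exists_isTest_approx hφ (ε := 1 / ((n : ℝ) + 1)) (by positivity)
  refine ⟨η, h1, squeeze_zero (fun n => integral_nonneg fun t => sq_nonneg _) (fun n => (h2 n).le)
    tendsto_one_div_add_atTop_nhds_zero_nat⟩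

/-- The approximants are corrected by multiples of a test function of integral `1`, so that they
have mean zero as well; then their primitives are again test functions. -/
lemma exists_isTest_tendsto_of_integral_eq_zero {φ : ℝ → ℝ} (hφ : MemLp φ 2 unitMeas)
    (h0 : ∫ t, φ t ∂unitMeas = 0) :
    ∃ η : ℕ → ℝ → ℝ, (∀ n, IsTest (η n)) ∧ (∀ n, ∫ t, η n t ∂unitMeas = 0) ∧
      Filter.Tendsto (fun n => ∫ t, (η n t - φ t) ^ 2 ∂unitMeas) Filter.atTop (nhds 0) := by
  obtain ⟨η, hη, hlim⟩ := exists_isTest_tendsto hφ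
  have hI : ∀ n, Integrable (η n) unitMeas := fun n => (hη n).memLp.integrable (by norm_num)
  obtain ⟨ρ, hρ, hρ1⟩ : ∃ ρ, IsTest ρ ∧ ∫ t, ρ t ∂unitMeas = 1 := by
    have h1L : MemLp (fun _ : ℝ => (1 : ℝ)) 2 unitMeas := memLp_const 1
    obtain ⟨θ, hθ, hθ1⟩ := exists_isTest_approx h1L zero_lt_one
    have hne : ∫ t, θ t ∂unitMeas ≠ 0 := by
      intro hz
      have h2 := integral_mul_sq_le (hθ.memLp.sub h1L) h1L
      simp only [Pi.sub_apply, mul_one, one_pow, integral_const, probReal_univ, smul_eq_mul,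
        integral_sub (hθ.memLp.integrable (by norm_num)) (integrable_const (1 : ℝ)), hz] at h2
      linarith
    refine ⟨_, hθ.smul (∫ t, θ t ∂unitMeas)⁻¹, ?_⟩
    rw [integral_const_mul, inv_mul_cancel₀ hne]
  refine ⟨fun n t => η n t - (∫ t, η n t ∂unitMeas) * ρ t, fun n => (hη n).sub (hρ.smul _),
    fun n => ?_, ?_⟩
  · rw [integral_sub (hI n) ((hρ.memLp.integrable (by norm_num)).const_mul _),
      integral_const_mul, hρ1, mul_one, sub_self]
  · have hb : ∀ n, ∫ t, (η n t - (∫ t, η n t ∂unitMeas) * ρ t - φ t) ^ 2 ∂unitMeas ≤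
        (2 + 2 * ∫ t, ρ t ^ 2 ∂unitMeas) * ∫ t, (η n t - φ t) ^ 2 ∂unitMeas := by
      intro n
      set m := ∫ t, η n t ∂unitMeas with hm
      have h1 : m ^ 2 ≤ ∫ t, (η n t - φ t) ^ 2 ∂unitMeas := by
        have h2 := integral_mul_sq_le ((hη n).memLp.sub hφ) (memLp_const (μ := unitMeas) (1 : ℝ))
        simp only [Pi.sub_apply, mul_one, one_pow, integral_const, probReal_univ, smul_eq_mul,
          integral_sub (hI n) (hφ.integrable (by norm_num)), h0, sub_zero] at h2
        exact h2
      have i1 : Integrable (fun t => 2 * (η n t - φ t) ^ 2) unitMeas :=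
        ((hη n).memLp.sub hφ).integrable_sq.const_mul 2
      have i2 : Integrable (fun t => 2 * m ^ 2 * ρ t ^ 2) unitMeas :=
        hρ.memLp.integrable_sq.const_mul _
      have h3 : ∫ t, (η n t - m * ρ t - φ t) ^ 2 ∂unitMeas ≤
          ∫ t, (2 * (η n t - φ t) ^ 2 + 2 * m ^ 2 * ρ t ^ 2) ∂unitMeas := by
        refine integral_mono_of_nonneg (Filter.Eventually.of_forall fun t => sq_nonneg _)
          (i1.add i2) (Filter.Eventually.of_forall fun t => ?_)
        simp only
        nlinarith [sq_nonneg (η n t - φ t + m * ρ t)]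
      rw [integral_add i1 i2, integral_const_mul, integral_const_mul] at h3
      have h4 : 0 ≤ ∫ t, ρ t ^ 2 ∂unitMeas := integral_nonneg fun _ => sq_nonneg _
      nlinarith [mul_le_mul_of_nonneg_right h1 h4]
    refine squeeze_zero (fun n => integral_nonneg fun t => sq_nonneg _) hb ?_
    simpa using hlim.const_mul (2 + 2 * ∫ t, ρ t ^ 2 ∂unitMeas)

/-! ### Weak derivatives tested against products of square integrable functions -/

lemma restrict_unitCube_eq_pi (ι : Type*) [Fintype ι] :
    (volume : Measure (ι → ℝ)).restrict (unitCube ι) = Measure.pi fun _ => unitMeas := by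
  rw [unitCube, volume_pi, Measure.restrict_pi_pi]

instance (ι : Type*) [Fintype ι] :
    IsProbabilityMeasure ((volume : Measure (ι → ℝ)).restrict (unitCube ι)) := by
  rw [restrict_unitCube_eq_pi]; infer_instance

lemma measurableSet_unitCube (ι : Type*) [Fintype ι] : MeasurableSet (unitCube ι) :=
  MeasurableSet.univ_pi fun _ => measurableSet_Ico

variable {s : ℕ}

lemma integral_tensor (ψ : Fin s → ℝ → ℝ) :
    ∫ x in unitCube (Fin s), tensor ψ x = ∏ j, ∫ t, ψ j t ∂unitMeas := by
  rw [restrict_unitCube_eq_pi]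
  exact integral_fintype_prod_eq_prod ψ

lemma memLp_tensor {ψ : Fin s → ℝ → ℝ} (h : ∀ j, MemLp (ψ j) 2 unitMeas) :
    MemLp (tensor ψ) 2 (volume.restrict (unitCube (Fin s))) := by
  rw [restrict_unitCube_eq_pi]
  have hm : AEStronglyMeasurable (tensor ψ) (Measure.pi fun _ : Fin s => unitMeas) := by
    have := Finset.aestronglyMeasurable_prod (μ := Measure.pi fun _ : Fin s => unitMeas)
      (f := fun j (x : Fin s → ℝ) => ψ j (x j)) Finset.univ fun j _ =>
      (h j).aestronglyMeasurable.comp_quasiMeasurePreserving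
        (Measure.quasiMeasurePreserving_eval (fun _ : Fin s => unitMeas) j)
    refine this.congr (Filter.Eventually.of_forall fun x => ?_)
    simp [tensor]
  rw [memLp_two_iff_integrable_sq hm]
  have := Integrable.fintype_prod (μ := fun _ : Fin s => unitMeas) (f := fun j t => ψ j t ^ 2)
    fun j => (h j).integrable_sq
  refine this.congr (Filter.Eventually.of_forall fun x => ?_)
  simp [tensor, Finset.prod_pow]

/-- The integral of `G` over the unit cube against a product of functions. -/
def pairing (G : (Fin s → ℝ) → ℝ) (ψ : Fin s → ℝ → ℝ) : ℝ :=
  ∫ x in unitCube (Fin s), G x * tensor ψ x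

lemma pairing_sq_le {G : (Fin s → ℝ) → ℝ} (hG : MemLp G 2 (volume.restrict (unitCube (Fin s))))
    {ψ : Fin s → ℝ → ℝ} (h : ∀ j, MemLp (ψ j) 2 unitMeas) :
    pairing G ψ ^ 2 ≤
      (∫ x in unitCube (Fin s), G x ^ 2) * ∏ j, ∫ t, ψ j t ^ 2 ∂unitMeas := by
  refine (integral_mul_sq_le hG (memLp_tensor h)).trans_eq ?_
  congr 1
  rw [← integral_tensor fun j t => ψ j t ^ 2]
  simp [tensor, Finset.prod_pow]

lemma memLp_update {ψ : Fin s → ℝ → ℝ} (h : ∀ j, MemLp (ψ j) 2 unitMeas) (j : Fin s)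
    {φ : ℝ → ℝ} (hφ : MemLp φ 2 unitMeas) (i : Fin s) :
    MemLp (Function.update ψ j φ i) 2 unitMeas := by
  rcases eq_or_ne i j with rfl | hi
  · rwa [Function.update_self]
  · rw [Function.update_of_ne hi]; exact h i

lemma pairing_update_sub {G : (Fin s → ℝ) → ℝ}
    (hG : MemLp G 2 (volume.restrict (unitCube (Fin s))))
    {ψ : Fin s → ℝ → ℝ} (h : ∀ j, MemLp (ψ j) 2 unitMeas) (j : Fin s) {φ₁ φ₂ : ℝ → ℝ}
    (h₁ : MemLp φ₁ 2 unitMeas) (h₂ : MemLp φ₂ 2 unitMeas) :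
    pairing G (Function.update ψ j fun t => φ₁ t - φ₂ t) =
      pairing G (Function.update ψ j φ₁) - pairing G (Function.update ψ j φ₂) := by
  unfold pairing
  have i₁ : Integrable (fun x => G x * tensor (Function.update ψ j φ₁) x) _ :=
    hG.integrable_mul (memLp_tensor (memLp_update h j h₁))
  have i₂ : Integrable (fun x => G x * tensor (Function.update ψ j φ₂) x) _ :=
    hG.integrable_mul (memLp_tensor (memLp_update h j h₂))
  rw [← integral_sub i₁ i₂]
  congr 1
  ext x
  simp only [tensor_update]
  ring

lemma pairing_update_smul (G : (Fin s → ℝ) → ℝ) (ψ : Fin s → ℝ → ℝ) (j : Fin s) (c : ℝ)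
    (φ : ℝ → ℝ) :
    pairing G (Function.update ψ j fun t => c * φ t) = c * pairing G (Function.update ψ j φ) := by
  unfold pairing
  rw [← integral_const_mul]
  congr 1
  ext x
  simp only [tensor_update]
  ring

lemma pairing_congr {G : (Fin s → ℝ) → ℝ} {ψ ψ' : Fin s → ℝ → ℝ}
    (h : ∀ j, ∀ t ∈ Set.Ico (0 : ℝ) 1, ψ j t = ψ' j t) : pairing G ψ = pairing G ψ' := by
  refine setIntegral_congr_fun (measurableSet_unitCube _) fun x hx => ?_
  simp only [tensor]
  congr 1
  exact Finset.prod_congr rfl fun j _ => h j _ (hx j (Set.mem_univ j))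

/-- The pairing is continuous in each factor with respect to the `L²` norm. -/
lemma tendsto_pairing_update {G : (Fin s → ℝ) → ℝ}
    (hG : MemLp G 2 (volume.restrict (unitCube (Fin s))))
    {ψ : Fin s → ℝ → ℝ} (h : ∀ j, MemLp (ψ j) 2 unitMeas) (j : Fin s) {φ : ℝ → ℝ}
    (hφ : MemLp φ 2 unitMeas) {η : ℕ → ℝ → ℝ} (hη : ∀ n, MemLp (η n) 2 unitMeas)
    (hlim : Filter.Tendsto (fun n => ∫ t, (η n t - φ t) ^ 2 ∂unitMeas) Filter.atTop (nhds 0)) :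
    Filter.Tendsto (fun n => pairing G (Function.update ψ j (η n))) Filter.atTop
      (nhds (pairing G (Function.update ψ j φ))) := by
  rw [tendsto_iff_norm_sub_tendsto_zero]
  have hb : ∀ n, ‖pairing G (Function.update ψ j (η n)) - pairing G (Function.update ψ j φ)‖ ^ 2 ≤
      ((∫ x in unitCube (Fin s), G x ^ 2) * ∏ i ∈ Finset.univ.erase j, ∫ t, ψ i t ^ 2 ∂unitMeas)
        * ∫ t, (η n t - φ t) ^ 2 ∂unitMeas := by
    intro n
    rw [← pairing_update_sub hG h j (hη n) hφ, Real.norm_eq_abs, sq_abs]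
    refine (pairing_sq_le hG (memLp_update h j ((hη n).sub hφ))).trans_eq ?_
    rw [← Finset.mul_prod_erase _ _ (Finset.mem_univ j), Function.update_self]
    rw [Finset.prod_congr rfl (g := fun i => ∫ t, ψ i t ^ 2 ∂unitMeas) fun i hi => by
      rw [Function.update_of_ne (Finset.ne_of_mem_erase hi)]]
    simp only [Pi.sub_apply]
    ring
  have h2 := squeeze_zero (fun n => sq_nonneg _) hb (by simpa using hlim.const_mul _)
  have h3 := (Real.continuous_sqrt.tendsto 0).comp h2
  rw [Real.sqrt_zero] at h3
  refine h3.congr fun n => ?_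
  simp [Function.comp, Real.sqrt_sq_eq_abs]

lemma memLp_two_of_continuousOn {F : ℝ → ℝ} (hF : ContinuousOn F (Set.Icc 0 1)) :
    MemLp F 2 unitMeas := by
  obtain ⟨C, hC⟩ := isCompact_Icc.exists_bound_of_continuousOn hF
  exact MemLp.of_bound (aestronglyMeasurable_unitMeas_of_continuousOn hF) C
    (ae_unitMeas_of_forall fun t ht => hC t (Set.Ico_subset_Icc_self ht))

lemma memLp_adjPrim {F : ℝ → ℝ} (hF : MemLp F 2 unitMeas) : MemLp (adjPrim F) 2 unitMeas :=
  memLp_two_of_continuousOn (continuousOn_adjPrim (hF.integrable (by norm_num)))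

lemma memLp_iterate_adjPrim {F : ℝ → ℝ} (hF : MemLp F 2 unitMeas) (r : ℕ) :
    MemLp (adjPrim^[r] F) 2 unitMeas := by
  induction r with
  | zero => exact hF
  | succ r ih => rw [Function.iterate_succ_apply']; exact memLp_adjPrim ih

lemma integral_adjPrim_sq_le {F : ℝ → ℝ} (hF : MemLp F 2 unitMeas) :
    ∫ t, adjPrim F t ^ 2 ∂unitMeas ≤ 4 * ∫ t, F t ^ 2 ∂unitMeas := by
  have hI := hF.integrable (by norm_num)
  have h1 : (∫ t, ‖F t‖ ∂unitMeas) ^ 2 ≤ ∫ t, F t ^ 2 ∂unitMeas := by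
    have := integral_mul_sq_le hF.norm (memLp_const (μ := unitMeas) (1 : ℝ))
    simpa using this
  refine integral_unitMeas_le_of_forall (fun _ _ => sq_nonneg _) fun t ht => ?_
  have h2 := norm_adjPrim_le hI (Set.Ico_subset_Icc_self ht)
  rw [← sq_abs]
  calc |adjPrim F t| ^ 2 ≤ (2 * ∫ t, ‖F t‖ ∂unitMeas) ^ 2 := by
        gcongr; exact h2
    _ ≤ _ := by rw [mul_pow]; linarith

/-- If `H` is the weak derivative of `G` in the direction `j` with respect to product test
functions, then the integration by parts formula also holds for products of square integrable
functions, whatever the boundary values, once the mean of the `j`-th factor is split off. -/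
lemma pairing_eq_of_weakDeriv {G H : (Fin s → ℝ) → ℝ}
    (hG : MemLp G 2 (volume.restrict (unitCube (Fin s))))
    (hH : MemLp H 2 (volume.restrict (unitCube (Fin s)))) (j : Fin s)
    (hGH : ∀ ψ : Fin s → ℝ → ℝ, (∀ i, IsTest (ψ i)) →
      pairing G (Function.update ψ j (deriv (ψ j))) = -pairing H ψ)
    {ψ : Fin s → ℝ → ℝ} (hψ : ∀ i, MemLp (ψ i) 2 unitMeas) :
    pairing G ψ = (∫ t, ψ j t ∂unitMeas) * pairing G (Function.update ψ j fun _ => 1) +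
      pairing H (Function.update ψ j (adjPrim (ψ j))) := by
  have hone : MemLp (fun _ : ℝ => (1 : ℝ)) 2 unitMeas := memLp_const 1
  -- The factors with index in `S` are arbitrary, those outside `S ∪ {j}` are test functions.
  have key : ∀ S : Finset (Fin s), ∀ ψ : Fin s → ℝ → ℝ, (∀ i, MemLp (ψ i) 2 unitMeas) →
      (∀ i, i ∉ S → i ≠ j → IsTest (ψ i)) →
      pairing G ψ = (∫ t, ψ j t ∂unitMeas) * pairing G (Function.update ψ j fun _ => 1) +
        pairing H (Function.update ψ j (adjPrim (ψ j))) := by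
    intro S
    induction S using Finset.induction_on with
    | empty =>
      intro ψ hψ ht
      set m := ∫ t, ψ j t ∂unitMeas with hm
      have hIj : Integrable (ψ j) unitMeas := (hψ j).integrable (by norm_num)
      -- Test functions of mean zero approximating `ψ j - m` have test functions as primitives.
      have hφ : MemLp (fun t => ψ j t - m) 2 unitMeas := (hψ j).sub (memLp_const m)
      obtain ⟨η, hη, hη0, hlim⟩ := exists_isTest_tendsto_of_integral_eq_zero hφ (by
        rw [integral_sub hIj (integrable_const m)]; simp [hm])
      have hη0' : ∀ n, ∫ t in (0 : ℝ)..1, η n t = 0 := fun n => by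
        rw [← integral_unitMeas]; exact hη0 n
      have hstep : ∀ n, pairing G (Function.update ψ j (η n)) =
          pairing H (Function.update ψ j (adjPrim (η n))) := by
        intro n
        obtain ⟨h1, h2⟩ := (hη n).exists_primitive (hη0' n)
        have h3 := hGH (Function.update ψ j fun x => ∫ t in (0 : ℝ)..x, η n t) (by
          intro i
          rcases eq_or_ne i j with rfl | hi
          · rwa [Function.update_self]
          · rw [Function.update_of_ne hi]; exact ht i (by simp) hi)
        rw [Function.update_idem, Function.update_self, h2] at h3
        rw [h3, neg_eq_neg_one_mul, ← pairing_update_smul]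
        congr 2
        ext x
        simp [adjPrim, hη0' n]
      have l1 := tendsto_pairing_update hG hψ j hφ (fun n => (hη n).memLp) hlim
      have l2 : Filter.Tendsto (fun n => pairing H (Function.update ψ j (adjPrim (η n))))
          Filter.atTop (nhds (pairing H (Function.update ψ j (adjPrim fun t => ψ j t - m)))) := by
        refine tendsto_pairing_update hH hψ j (memLp_adjPrim hφ)
          (fun n => memLp_adjPrim (hη n).memLp) ?_
        refine squeeze_zero (fun n => integral_nonneg fun t => sq_nonneg _) (fun n => ?_)
          (by simpa using hlim.const_mul 4)
        refine le_trans (le_of_eq ?_) (integral_adjPrim_sq_le ((hη n).memLp.sub hφ))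
        refine integral_congr_ae (ae_unitMeas_of_forall fun t ht => ?_)
        have := iterate_adjPrim_sub ((hη n).memLp.integrable (by norm_num))
          (hφ.integrable (by norm_num)) 1 t (Set.Ico_subset_Icc_self ht)
        simp only [Function.iterate_one] at this
        beta_reduce
        rw [← this]
      have l3 := tendsto_nhds_unique l1 (l2.congr fun n => (hstep n).symm)
      rw [pairing_update_sub hG hψ j (hψ j) (memLp_const m), Function.update_eq_self] at l3
      have e1 : pairing G (Function.update ψ j fun _ => m) =
          m * pairing G (Function.update ψ j fun _ => 1) := by
        rw [← pairing_update_smul]; simp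
      have e2 : pairing H (Function.update ψ j (adjPrim fun t => ψ j t - m)) =
          pairing H (Function.update ψ j (adjPrim (ψ j))) := by
        refine pairing_congr fun i t ht' => ?_
        rcases eq_or_ne i j with rfl | hi
        · rw [Function.update_self, Function.update_self]
          have := iterate_adjPrim_sub hIj (integrable_const m) 1 t (Set.Ico_subset_Icc_self ht')
          simp only [Function.iterate_one, adjPrim_const, sub_zero] at this
          exact this
        · rw [Function.update_of_ne hi, Function.update_of_ne hi]
      rw [e1, e2] at l3
      linarith
    | insert i S hi ih =>
      intro ψ hψ ht
      by_cases hij : i = j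
      · refine ih ψ hψ fun k hk hkj => ht k ?_ hkj
        rw [Finset.mem_insert, not_or]
        exact ⟨hij ▸ hkj, hk⟩
      obtain ⟨η, hη, hlim⟩ := exists_isTest_tendsto (hψ i)
      have hstep := fun n => ih (Function.update ψ i (η n)) (memLp_update hψ i (hη n).memLp) (by
          intro k hk hkj
          rcases eq_or_ne k i with rfl | hki
          · rw [Function.update_self]; exact hη n
          · rw [Function.update_of_ne hki]
            exact ht k (by simp [hki, hk]) hkj)
      simp only [Function.update_of_ne (Ne.symm hij)] at hstep
      simp_rw [Function.update_comm hij] at hstep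
      have l1 := tendsto_pairing_update hG hψ i (hψ i) (fun n => (hη n).memLp) hlim
      have l2 := tendsto_pairing_update hG (memLp_update hψ j hone) i (hψ i)
        (fun n => (hη n).memLp) hlim
      have l3 := tendsto_pairing_update hH (memLp_update hψ j (memLp_adjPrim (hψ j))) i (hψ i)
        (fun n => (hη n).memLp) hlim
      have := tendsto_nhds_unique l1 (((l2.const_mul _).add l3).congr fun n => (hstep n).symm)
      have hu : ∀ φ : ℝ → ℝ, Function.update (Function.update ψ j φ) i (ψ i) =
          Function.update ψ j φ := fun φ => by
        rw [Function.update_comm (Ne.symm hij), Function.update_eq_self]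
      rwa [Function.update_eq_self, hu, hu] at this
  exact key Finset.univ ψ hψ fun i hi => absurd (Finset.mem_univ i) hi

variable {s : ℕ}

/-! ### The representation formula -/

lemma isWeakDeriv_weakDeriv {α : ℕ} {f : (Fin s → ℝ) → ℝ} (hf : IsSmooth α f) {τ : Fin s → ℕ}
    (hτ : ∀ j, τ j ≤ α) : IsWeakDeriv τ f (weakDeriv τ f) := by
  have h := hf.2 τ hτ
  rw [weakDeriv, dif_pos h]
  exact h.choose_spec

lemma pairing_weakDeriv_deriv {α : ℕ} {f : (Fin s → ℝ) → ℝ} (hf : IsSmooth α f) {τ : Fin s → ℕ}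
    (hτ : ∀ j, τ j ≤ α) (j : Fin s) (hj : τ j < α) {ψ : Fin s → ℝ → ℝ} (hψ : ∀ i, IsTest (ψ i)) :
    pairing (weakDeriv τ f) (Function.update ψ j (deriv (ψ j))) =
      -pairing (weakDeriv (Function.update τ j (τ j + 1)) f) ψ := by
  have hτ' : ∀ i, Function.update τ j (τ j + 1) i ≤ α := by
    intro i
    rcases eq_or_ne i j with rfl | hi
    · rw [Function.update_self]; exact hj
    · rw [Function.update_of_ne hi]; exact hτ i
  have hψ' : ∀ i, IsTest (Function.update ψ j (deriv (ψ j)) i) := by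
    intro i
    rcases eq_or_ne i j with rfl | hi
    · rw [Function.update_self]; exact (hψ i).deriv
    · rw [Function.update_of_ne hi]; exact hψ i
  have h1 := (isWeakDeriv_weakDeriv hf hτ).2 _ (contDiff_tensor hψ') (hasCompactSupport_tensor hψ')
    (tsupport_tensor_subset_openCube hψ')
  have h2 := (isWeakDeriv_weakDeriv hf hτ').2 _ (contDiff_tensor hψ) (hasCompactSupport_tensor hψ)
    (tsupport_tensor_subset_openCube hψ)
  rw [classicalDeriv_tensor hψ'] at h1
  rw [classicalDeriv_tensor hψ] at h2
  have e1 : (fun i => deriv^[τ i] (Function.update ψ j (deriv (ψ j)) i)) =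
      fun i => deriv^[Function.update τ j (τ j + 1) i] (ψ i) := by
    ext i : 1
    rcases eq_or_ne i j with rfl | hi
    · rw [Function.update_self, Function.update_self, Function.iterate_succ_apply]
    · rw [Function.update_of_ne hi, Function.update_of_ne hi]
  have e2 : ∑ i, Function.update τ j (τ j + 1) i = ∑ i, τ i + 1 := by
    rw [← Finset.add_sum_erase _ _ (Finset.mem_univ j), Function.update_self,
      ← Finset.add_sum_erase (a := j) _ τ (Finset.mem_univ j),
      Finset.sum_congr rfl (g := τ) fun i hi => by
        rw [Function.update_of_ne (Finset.ne_of_mem_erase hi)]]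
    ring
  rw [e1, h2, e2, pow_succ] at h1
  have h3 : ((-1 : ℝ) ^ ∑ i, τ i) ≠ 0 := pow_ne_zero _ (by norm_num)
  refine mul_left_cancel₀ h3 (h1.symm.trans ?_)
  unfold pairing
  ring

lemma memLp_sobDual {φ : ℝ → ℝ} (hφ : MemLp φ 2 unitMeas) (α r : ℕ) :
    MemLp (sobDual α r φ) 2 unitMeas := by
  by_cases h : r < α
  · have : sobDual α r φ = fun _ => ∫ t, adjPrim^[r] φ t ∂unitMeas := by
      ext z; simp [sobDual, h]
    rw [this]; exact memLp_const _
  · have : sobDual α r φ = adjPrim^[α] φ := by ext z; simp [sobDual, h]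
    rw [this]; exact memLp_iterate_adjPrim hφ α

lemma pairing_update_const (G : (Fin s → ℝ) → ℝ) (ψ : Fin s → ℝ → ℝ) (j : Fin s) (c : ℝ) :
    pairing G (Function.update ψ j fun _ => c) =
      c * pairing G (Function.update ψ j fun _ => 1) := by
  rw [← pairing_update_smul]; simp

/-- Expanding one factor of a product test function. -/
lemma pairing_eq_sum_sobDual {α : ℕ} {f : (Fin s → ℝ) → ℝ} (hf : IsSmooth α f) {τ : Fin s → ℕ}
    (hτ : ∀ j, τ j ≤ α) (j : Fin s) (hj : τ j = 0) {ψ : Fin s → ℝ → ℝ}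
    (hψ : ∀ i, MemLp (ψ i) 2 unitMeas) :
    pairing (weakDeriv τ f) ψ = ∑ r ∈ Finset.range (α + 1),
      pairing (weakDeriv (Function.update τ j r) f) (Function.update ψ j (sobDual α r (ψ j))) := by
  have hτ' : ∀ r ≤ α, ∀ i, Function.update τ j r i ≤ α := by
    intro r hr i
    rcases eq_or_ne i j with rfl | hi
    · rwa [Function.update_self]
    · rw [Function.update_of_ne hi]; exact hτ i
  -- The expansion of the `j`-th factor after `n ≤ α` integrations by parts.
  have key : ∀ n ≤ α, pairing (weakDeriv τ f) ψ = (∑ r ∈ Finset.range n,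
      pairing (weakDeriv (Function.update τ j r) f)
        (Function.update ψ j fun _ => ∫ t, adjPrim^[r] (ψ j) t ∂unitMeas)) +
      pairing (weakDeriv (Function.update τ j n) f) (Function.update ψ j (adjPrim^[n] (ψ j))) := by
    intro n
    induction n with
    | zero =>
      intro _
      rw [← hj, Function.update_eq_self, hj]
      simp
    | succ n ih =>
      intro hn
      rw [ih (by omega), Finset.sum_range_succ, add_assoc]
      congr 1
      have h1 := pairing_eq_of_weakDeriv (isWeakDeriv_weakDeriv hf (hτ' n (by omega))).1
        (isWeakDeriv_weakDeriv hf (hτ' (n + 1) hn)).1 j (fun φ hφ => by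
          have := pairing_weakDeriv_deriv hf (hτ' n (by omega)) j
            (by rw [Function.update_self]; omega) hφ
          rwa [Function.update_self, Function.update_idem] at this)
        (memLp_update hψ j (memLp_iterate_adjPrim (hψ j) n))
      rw [h1, Function.update_self, Function.update_idem, Function.update_idem,
        pairing_update_const _ _ _ (∫ t, adjPrim^[n] (ψ j) t ∂unitMeas),
        Function.iterate_succ_apply']
  rw [key α le_rfl, Finset.sum_range_succ]
  congr 1
  · refine Finset.sum_congr rfl fun r hr => ?_
    congr 2
    ext z
    simp [sobDual, Finset.mem_range.1 hr]
  · congr 2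
    ext z
    simp [sobDual]

/-- The multi-indices with entries at most `α` that vanish outside `S`. -/
def orders (α : ℕ) (S : Finset (Fin s)) : Finset (Fin s → ℕ) :=
  Fintype.piFinset fun j => if j ∈ S then Finset.range (α + 1) else {0}

lemma mem_orders {α : ℕ} {S : Finset (Fin s)} {ρ : Fin s → ℕ} :
    ρ ∈ orders α S ↔ (∀ j, ρ j ≤ α) ∧ ∀ j, j ∉ S → ρ j = 0 := by
  rw [orders, Fintype.mem_piFinset]
  constructor
  · intro h
    refine ⟨fun j => ?_, fun j hj => ?_⟩
    · have := h j
      split_ifs at this with hj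
      · rw [Finset.mem_range] at this; omega
      · rw [Finset.mem_singleton] at this; omega
    · simpa [hj] using h j
  · intro h j
    split_ifs with hj
    · rw [Finset.mem_range]; have := h.1 j; omega
    · rw [Finset.mem_singleton]; exact h.2 j hj

/-- All factors with index in `S` are expanded, one after the other. -/
lemma pairing_zero_eq_sum {α : ℕ} {f : (Fin s → ℝ) → ℝ} (hf : IsSmooth α f)
    {ψ : Fin s → ℝ → ℝ} (hψ : ∀ i, MemLp (ψ i) 2 unitMeas) (S : Finset (Fin s)) :
    pairing (weakDeriv 0 f) ψ = ∑ ρ ∈ orders α S,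
      pairing (weakDeriv ρ f) fun j => if j ∈ S then sobDual α (ρ j) (ψ j) else ψ j := by
  induction S using Finset.induction_on with
  | empty =>
    have : orders α (∅ : Finset (Fin s)) = {0} := by
      ext ρ
      rw [mem_orders, Finset.mem_singleton]
      constructor
      · intro h; ext j; exact h.2 j (by simp)
      · rintro rfl; simp
    rw [this]; simp
  | insert j S hj ih =>
    rw [ih]
    have h1 : ∀ ρ ∈ orders α S, pairing (weakDeriv ρ f)
        (fun i => if i ∈ S then sobDual α (ρ i) (ψ i) else ψ i) =
        ∑ r ∈ Finset.range (α + 1), pairing (weakDeriv (Function.update ρ j r) f)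
          (Function.update (fun i => if i ∈ S then sobDual α (ρ i) (ψ i) else ψ i) j
            (sobDual α r (ψ j))) := by
      intro ρ hρ
      rw [mem_orders] at hρ
      have := pairing_eq_sum_sobDual hf hρ.1 j (hρ.2 j hj)
        (ψ := fun i => if i ∈ S then sobDual α (ρ i) (ψ i) else ψ i) (fun i => by
          split_ifs
          · exact memLp_sobDual (hψ i) _ _
          · exact hψ i)
      simpa only [if_neg hj] using this
    rw [Finset.sum_congr rfl h1, ← Finset.sum_product']
    refine Finset.sum_bij' (fun p _ => Function.update p.1 j p.2)
      (fun ρ _ => (Function.update ρ j 0, ρ j)) ?_ ?_ ?_ ?_ ?_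
    · rintro ⟨ρ, r⟩ hp
      rw [Finset.mem_product, mem_orders, Finset.mem_range] at hp
      rw [mem_orders]
      constructor
      · intro i
        rcases eq_or_ne i j with rfl | hi
        · rw [Function.update_self]; have := hp.2; simp only at this; omega
        · rw [Function.update_of_ne hi]; exact hp.1.1 i
      · intro i hi
        rw [Finset.mem_insert, not_or] at hi
        rw [Function.update_of_ne hi.1]
        exact hp.1.2 i hi.2
    · intro ρ hρ
      rw [mem_orders] at hρ
      rw [Finset.mem_product, mem_orders, Finset.mem_range]
      refine ⟨⟨fun i => ?_, fun i hi => ?_⟩, Nat.lt_succ_of_le (hρ.1 j)⟩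
      · rcases eq_or_ne i j with rfl | hi
        · simp
        · simp only [Function.update_of_ne hi]; exact hρ.1 i
      · rcases eq_or_ne i j with rfl | hij
        · simp
        · simp only [Function.update_of_ne hij]
          exact hρ.2 i (by simp [hij, hi])
    · rintro ⟨ρ, r⟩ hp
      rw [Finset.mem_product, mem_orders] at hp
      simp only [Function.update_idem, Function.update_self, Prod.mk.injEq, and_true]
      rw [← hp.1.2 j hj, Function.update_eq_self]
    · intro ρ _
      simp
    · rintro ⟨ρ, r⟩ hp
      simp only
      congr 1
      ext i : 1
      rcases eq_or_ne i j with rfl | hij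
      · simp
      · simp [hij]

lemma openCube_subset_unitCube (ι : Type*) : openCube ι ⊆ unitCube ι :=
  Set.pi_mono fun _ _ => Set.Ioo_subset_Ico_self

lemma restrict_openCube (ι : Type*) [Fintype ι] :
    (volume : Measure (ι → ℝ)).restrict (openCube ι) = volume.restrict (unitCube ι) := by
  rw [restrict_unitCube_eq_pi, openCube, volume_pi, Measure.restrict_pi_pi]
  simp only [unitMeas, restrict_Ioo_eq_restrict_Ico]

lemma integrable_mul_of_continuousOn {f g : (Fin s → ℝ) → ℝ}
    (hf : ContinuousOn f (unitCube (Fin s))) (hg : Continuous g) (hc : HasCompactSupport g)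
    (hs : tsupport g ⊆ openCube (Fin s)) : Integrable (fun x => f x * g x) volume := by
  have h1 : IntegrableOn (fun x => f x * g x) (tsupport g) volume :=
    ((hf.mono (hs.trans (openCube_subset_unitCube _))).mul
      hg.continuousOn).integrableOn_compact hc.isCompact
  refine (integrableOn_iff_integrable_of_support_subset ?_).1 h1
  intro x hx
  refine subset_tsupport _ ?_
  rw [Function.mem_support] at hx ⊢
  exact right_ne_zero_of_mul hx

/-- The weak derivative of order `0` agrees with the function almost everywhere. -/
lemma weakDeriv_zero_ae {α : ℕ} {f : (Fin s → ℝ) → ℝ} (hf : IsSmooth α f) :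
    weakDeriv 0 f =ᵐ[volume.restrict (unitCube (Fin s))] f := by
  obtain ⟨hL, hw⟩ := isWeakDeriv_weakDeriv hf (τ := 0) (fun j => Nat.zero_le _)
  have hopen : IsOpen (openCube (Fin s)) := isOpen_set_pi Set.finite_univ fun _ _ => isOpen_Ioo
  have hI : IntegrableOn (weakDeriv 0 f) (unitCube (Fin s)) volume := hL.integrable (by norm_num)
  have hloc : LocallyIntegrableOn (fun x => weakDeriv 0 f x - f x) (openCube (Fin s)) volume :=
    ((hI.mono_set (openCube_subset_unitCube _)).locallyIntegrableOn).sub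
      ((hf.1.mono (openCube_subset_unitCube _)).locallyIntegrableOn hopen.measurableSet)
  have h := hopen.ae_eq_zero_of_integral_contDiff_smul_eq_zero hloc fun g hg hgc hgs => by
    have h1 := hw g hg hgc hgs
    have hc0 : classicalDeriv (0 : Fin s → ℕ) g = g := by
      simp [classicalDeriv]
    simp only [hc0, Pi.zero_apply, Finset.sum_const_zero, pow_zero, one_mul] at h1
    have hz : ∀ x, x ∉ unitCube (Fin s) → g x = 0 := fun x hx =>
      image_eq_zero_of_notMem_tsupport fun hx' => hx (openCube_subset_unitCube _ (hgs hx'))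
    rw [← setIntegral_eq_integral_of_forall_compl_eq_zero (s := unitCube (Fin s))
      fun x hx => by rw [hz x hx, zero_smul]]
    have i1 : Integrable (fun x => weakDeriv 0 f x * g x) (volume.restrict (unitCube (Fin s))) :=
      hL.integrable_mul (hg.continuous.memLp_of_hasCompactSupport hgc (p := 2))
    have i2 : Integrable (fun x => f x * g x) (volume.restrict (unitCube (Fin s))) :=
      (integrable_mul_of_continuousOn hf.1 hg.continuous hgc hgs).restrict
    have e : ∀ x, g x • (weakDeriv 0 f x - f x) = weakDeriv 0 f x * g x - f x * g x := fun x => by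
      rw [smul_eq_mul]; ring
    simp_rw [e]
    rw [integral_sub i1 i2, ← h1, sub_self]
  rw [Filter.EventuallyEq, ← restrict_openCube]
  rw [ae_restrict_iff' hopen.measurableSet]
  filter_upwards [h] with x hx hxU
  linarith [hx hxU]

lemma bump_nonneg (x : ℝ) {ε : ℝ} (hε : 0 < ε) (t : ℝ) : 0 ≤ bump x ε t :=
  Set.indicator_nonneg (fun _ _ => (inv_pos.2 hε).le) t

lemma memLp_bump (x ε : ℝ) : MemLp (bump x ε) 2 unitMeas :=
  (memLp_const _).indicator measurableSet_Ico

lemma eventually_add_le_one {x : Fin s → ℝ} (hx : x ∈ unitCube (Fin s)) :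
    ∀ᶠ ε : ℝ in nhdsWithin 0 (Set.Ioi 0), 0 < ε ∧ ε ≤ 1 ∧ ∀ j, x j + ε ≤ 1 := by
  have h1 : ∀ c : ℝ, 0 < c → ∀ᶠ ε : ℝ in nhdsWithin 0 (Set.Ioi 0), ε ≤ c := fun c hc =>
    (eventually_nhdsWithin_of_eventually_nhds (eventually_le_nhds hc))
  have h2 : ∀ᶠ ε : ℝ in nhdsWithin 0 (Set.Ioi 0), ∀ j, ε ≤ 1 - x j :=
    Filter.eventually_all.2 fun j => h1 _ (sub_pos.2 (hx j (Set.mem_univ j)).2)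
  filter_upwards [self_mem_nhdsWithin, h1 1 one_pos, h2] with ε a1 a2 a3
  exact ⟨a1, a2, fun j => by linarith [a3 j]⟩

/-- The products of normalized indicator functions form an approximate identity at every point of
the half-open cube, where `f` is continuous. -/
lemma tendsto_pairing_bump {f : (Fin s → ℝ) → ℝ} (hf : ContinuousOn f (unitCube (Fin s)))
    (hL : MemLp f 2 (volume.restrict (unitCube (Fin s)))) {x : Fin s → ℝ}
    (hx : x ∈ unitCube (Fin s)) :
    Filter.Tendsto (fun ε => pairing f fun j => bump (x j) ε) (nhdsWithin 0 (Set.Ioi 0))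
      (nhds (f x)) := by
  rw [Metric.tendsto_nhds]
  intro η hη
  obtain ⟨δ, hδ, hδ'⟩ := Metric.continuousOn_iff.1 hf x hx (η / 2) (by positivity)
  have hsmall : ∀ᶠ ε : ℝ in nhdsWithin 0 (Set.Ioi 0), ε < δ :=
    eventually_nhdsWithin_of_eventually_nhds (eventually_lt_nhds hδ)
  filter_upwards [eventually_add_le_one hx, hsmall] with ε ⟨hε, _, hle⟩ hεδ
  have hT : MemLp (tensor fun j => bump (x j) ε) 2 (volume.restrict (unitCube (Fin s))) :=
    memLp_tensor fun j => memLp_bump _ _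
  have hTI : Integrable (tensor fun j => bump (x j) ε) (volume.restrict (unitCube (Fin s))) :=
    hT.integrable (by norm_num)
  have hone : ∫ z in unitCube (Fin s), tensor (fun j => bump (x j) ε) z = 1 := by
    rw [integral_tensor]
    exact Finset.prod_eq_one fun j _ =>
      integral_bump (hx j (Set.mem_univ j)).1 hε (hle j)
  have hfT : Integrable (fun z => f z * tensor (fun j => bump (x j) ε) z)
    (volume.restrict (unitCube (Fin s))) := hL.integrable_mul hT
  have e : pairing f (fun j => bump (x j) ε) - f x =
      ∫ z in unitCube (Fin s), (f z - f x) * tensor (fun j => bump (x j) ε) z := by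
    simp_rw [sub_mul]
    rw [integral_sub hfT (hTI.const_mul _), integral_const_mul, hone, mul_one]
    rfl
  rw [Real.dist_eq, e]
  refine lt_of_le_of_lt (b := η / 2) ?_ (by linarith)
  rw [← Real.norm_eq_abs]
  refine (norm_integral_le_of_norm_le (hTI.const_mul (η / 2)) ?_).trans_eq ?_
  · filter_upwards [ae_restrict_mem (measurableSet_unitCube _)] with z hz
    have h0 : 0 ≤ tensor (fun j => bump (x j) ε) z :=
      Finset.prod_nonneg fun j _ => bump_nonneg _ hε _
    rw [norm_mul, Real.norm_of_nonneg h0]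
    rcases h0.eq_or_lt with h0' | h0'
    · rw [← h0']; simp
    · gcongr
      have hd : dist z x < δ := by
        refine lt_of_le_of_lt ((dist_pi_le_iff hε.le).2 fun j => ?_) hεδ
        have hj : bump (x j) ε (z j) ≠ 0 := fun h => h0'.ne' (Finset.prod_eq_zero
          (Finset.mem_univ j) h)
        have := Set.mem_of_indicator_ne_zero hj
        rw [Real.dist_eq, abs_le]
        constructor <;> linarith [this.1, this.2]
      exact (hδ' z hz hd).le
  · rw [integral_const_mul, hone, mul_one]

/-- Every function of the Sobolev space is recovered pointwise from its weak derivatives. -/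
theorem eq_sum_integral_weakDeriv_mul {α : ℕ} (hα : 2 ≤ α) {f : (Fin s → ℝ) → ℝ}
    (hf : IsSmooth α f) {x : Fin s → ℝ} (hx : x ∈ unitCube (Fin s)) :
    f x = ∑ ρ ∈ orders α (Finset.univ : Finset (Fin s)), ∫ z in unitCube (Fin s),
      weakDeriv ρ f z * ∏ j, sobKer α (ρ j) (x j) (z j) := by
  have hae := weakDeriv_zero_ae hf
  have hL : MemLp f 2 (volume.restrict (unitCube (Fin s))) :=
    (memLp_congr_ae hae).1 (isWeakDeriv_weakDeriv hf (τ := 0) (fun j => Nat.zero_le _)).1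
  have l1 := tendsto_pairing_bump hf.1 hL hx
  refine tendsto_nhds_unique l1 ?_
  have e : ∀ ε, pairing f (fun j => bump (x j) ε) = ∑ ρ ∈ orders α (Finset.univ : Finset (Fin s)),
      pairing (weakDeriv ρ f) fun j => sobDual α (ρ j) (bump (x j) ε) := by
    intro ε
    have h := pairing_zero_eq_sum hf (ψ := fun j => bump (x j) ε) (fun j => memLp_bump _ _)
      Finset.univ
    simp only [Finset.mem_univ, if_true] at h
    rw [← h]
    refine integral_congr_ae ?_
    filter_upwards [hae] with z hz
    rw [hz]
  simp_rw [e]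
  refine tendsto_finsetSum _ fun ρ hρ => ?_
  have hWL := (isWeakDeriv_weakDeriv hf (mem_orders.1 hρ).1).1
  refine tendsto_integral_filter_of_dominated_convergence
    (fun z => |weakDeriv ρ f z| * ∏ _j : Fin s, (2 * (2 : ℝ) ^ α)) ?_ ?_ ?_ ?_
  · exact Filter.Eventually.of_forall fun ε => (hWL.integrable_mul
      (memLp_tensor fun j => memLp_sobDual (memLp_bump (x j) ε) α (ρ j))).aestronglyMeasurable
  · filter_upwards [eventually_add_le_one hx] with ε ⟨hε, hε1, hle⟩
    filter_upwards [ae_restrict_mem (measurableSet_unitCube _)] with z hz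
    rw [norm_mul, tensor, Real.norm_eq_abs, Real.norm_eq_abs, Finset.abs_prod]
    gcongr with j
    have hzj := Set.Ico_subset_Icc_self (hz j (Set.mem_univ j))
    have h1 := abs_sobDual_bump_sub_le hα (ρ j) (hx j (Set.mem_univ j)).1 hε (hle j) hzj
    have h2 := abs_sobKer_le α (ρ j) (x j) hzj
    have h3 := abs_sub_abs_le_abs_sub (sobDual α (ρ j) (bump (x j) ε) (z j))
      (sobKer α (ρ j) (x j) (z j))
    have h4 : (2 : ℝ) ^ α * ε ≤ 2 ^ α := mul_le_of_le_one_right (by positivity) hε1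
    linarith
  · exact (hWL.integrable (by norm_num)).abs.mul_const _
  · filter_upwards [ae_restrict_mem (measurableSet_unitCube _)] with z hz
    refine Filter.Tendsto.const_mul _ (tendsto_finsetProd _ fun j _ => ?_)
    rw [tendsto_iff_norm_sub_tendsto_zero]
    have hzj := Set.Ico_subset_Icc_self (hz j (Set.mem_univ j))
    have h0 : Filter.Tendsto (fun ε : ℝ => (2 : ℝ) ^ α * ε) (nhdsWithin 0 (Set.Ioi 0))
        (nhds 0) := by
      have := (Filter.tendsto_id (α := ℝ) (x := nhds 0)).const_mul ((2 : ℝ) ^ α)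
      simp only [id, mul_zero] at this
      exact this.mono_left nhdsWithin_le_nhds
    refine squeeze_zero' (Filter.Eventually.of_forall fun _ => norm_nonneg _) ?_ h0
    filter_upwards [eventually_add_le_one hx] with ε ⟨hε, _, hle⟩
    exact abs_sobDual_bump_sub_le hα (ρ j) (hx j (Set.mem_univ j)).1 hε (hle j) hzj

variable {s : ℕ}

/-! ### The worst-case error in terms of the reproducing kernel -/

/-- The Cauchy–Schwarz inequality for a factor that depends on the coordinates in `v` only: the
other factor may be replaced by its marginal. -/
lemma integral_mul_sq_le_marginal (v : Finset (Fin s)) {G h : (Fin s → ℝ) → ℝ}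
    (hG : MemLp G 2 (volume.restrict (unitCube (Fin s)))) (hm : Measurable h) {C : ℝ}
    (hC : ∀ x ∈ unitCube (Fin s), |h x| ≤ C)
    (hv : ∀ x x' : Fin s → ℝ, (∀ j ∈ v, x j = x' j) → h x = h x') :
    (∫ x in unitCube (Fin s), G x * h x) ^ 2 ≤
      (∫ y in unitCube {j // j ∈ v}, marginal v G y * marginal v G y) *
        ∫ x in unitCube (Fin s), h x ^ 2 := by
  set P : Measure ({j // j ∈ v} → ℝ) := Measure.pi fun _ => unitMeas with hP
  set Q : Measure ({j // j ∉ v} → ℝ) := Measure.pi fun _ => unitMeas with hQ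
  have hcoe : (fun p : ({j // j ∈ v} → ℝ) × ({j // j ∉ v} → ℝ) => glue v p.1 p.2) =
      (MeasurableEquiv.piEquivPiSubtypeProd (fun _ : Fin s => ℝ) (fun j => j ∈ v)).symm := by
    ext p j
    simp [glue, MeasurableEquiv.piEquivPiSubtypeProd, Equiv.piEquivPiSubtypeProd]
  have hmp : MeasurePreserving (fun p : ({j // j ∈ v} → ℝ) × ({j // j ∉ v} → ℝ) =>
      glue v p.1 p.2) (P.prod Q) (volume.restrict (unitCube (Fin s))) := by
    rw [restrict_unitCube_eq_pi, hcoe]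
    convert (measurePreserving_piEquivPiSubtypeProd (fun _ : Fin s => unitMeas)
      (fun j => j ∈ v)).symm
    rfl
  have hemb : MeasurableEmbedding (fun p : ({j // j ∈ v} → ℝ) × ({j // j ∉ v} → ℝ) =>
      glue v p.1 p.2) := by
    rw [hcoe]; exact MeasurableEquiv.measurableEmbedding _
  have hGL : MemLp (fun p : ({j // j ∈ v} → ℝ) × ({j // j ∉ v} → ℝ) => G (glue v p.1 p.2)) 2
      (P.prod Q) := hG.comp_measurePreserving hmp
  have hGI := hGL.integrable (by norm_num)
  have hGsq := hGL.integrable_sq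
  have hhL : MemLp h 2 (volume.restrict (unitCube (Fin s))) :=
    MemLp.of_bound hm.aestronglyMeasurable C
      (by filter_upwards [ae_restrict_mem (measurableSet_unitCube _)] with x hx using hC x hx)
  have hhL' : MemLp (fun p : ({j // j ∈ v} → ℝ) × ({j // j ∉ v} → ℝ) => h (glue v p.1 p.2)) 2
      (P.prod Q) := hhL.comp_measurePreserving hmp
  -- `h` as a function of the coordinates in `v`; the values at the others do not matter.
  set h0 : ({j // j ∈ v} → ℝ) → ℝ := fun y => h (glue v y 0) with hh0
  have hglue : ∀ y z, h (glue v y z) = h0 y := fun y z => hv _ _ fun j hj => by simp [glue, hj]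
  simp_rw [hglue] at hhL'
  have hmarg : ∀ y, marginal v G y = ∫ z, G (glue v y z) ∂Q := by
    intro y; rw [marginal, restrict_unitCube_eq_pi]
  have hh0L : MemLp h0 2 P := by
    have hmeas : Measurable h0 := hm.comp (hemb.measurable.comp (by fun_prop :
      Measurable fun y : {j // j ∈ v} → ℝ => (y, (0 : {j // j ∉ v} → ℝ))))
    rw [memLp_two_iff_integrable_sq hmeas.aestronglyMeasurable]
    have := hhL'.integrable_sq.integral_prod_left
    simpa using this
  have hmargL : MemLp (marginal v G) 2 P := by
    have hmeas : AEStronglyMeasurable (marginal v G) P := by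
      refine (hGI.aestronglyMeasurable.integral_prod_right').congr ?_
      exact Filter.Eventually.of_forall fun y => (hmarg y).symm
    rw [memLp_two_iff_integrable_sq hmeas]
    refine Integrable.mono' hGsq.integral_prod_left (hmeas.pow 2) ?_
    filter_upwards [hGsq.prod_right_ae, hGI.prod_right_ae] with y hy1 hy2
    rw [Real.norm_of_nonneg (sq_nonneg _), hmarg]
    have hyL : MemLp (fun z => G (glue v y z)) 2 Q :=
      (memLp_two_iff_integrable_sq hy2.aestronglyMeasurable).2 hy1
    have := integral_mul_sq_le hyL (memLp_const (μ := Q) (1 : ℝ))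
    simpa using this
  have e1 : ∫ x in unitCube (Fin s), G x * h x = ∫ y, marginal v G y * h0 y ∂P := by
    have hI : Integrable (fun p : ({j // j ∈ v} → ℝ) × ({j // j ∉ v} → ℝ) =>
      G (glue v p.1 p.2) * h0 p.1) (P.prod Q) := hGL.integrable_mul hhL'
    rw [← hmp.integral_comp hemb]
    simp_rw [hglue]
    rw [integral_prod _ hI]
    refine integral_congr_ae (Filter.Eventually.of_forall fun y => ?_)
    simp only
    rw [integral_mul_const, hmarg]
  have e2 : ∫ x in unitCube (Fin s), h x ^ 2 = ∫ y, h0 y ^ 2 ∂P := by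
    rw [← hmp.integral_comp hemb]
    simp_rw [hglue]
    rw [integral_prod _ hhL'.integrable_sq]
    simp
  rw [e1, e2, restrict_unitCube_eq_pi]
  refine (integral_mul_sq_le hmargL hh0L).trans_eq ?_
  simp only [sq, hP]

/-- The multi-indices with support `u` and entries at most `α`. -/
def ordersOn (α : ℕ) (u : Finset (Fin s)) : Finset (Fin s → ℕ) :=
  Fintype.piFinset fun j => if j ∈ u then Finset.Icc 1 α else {0}

lemma mem_ordersOn {α : ℕ} {u : Finset (Fin s)} {ρ : Fin s → ℕ} :
    ρ ∈ ordersOn α u ↔ (∀ j, ρ j ≤ α) ∧ u = Finset.univ.filter fun j => ρ j ≠ 0 := by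
  rw [ordersOn, Fintype.mem_piFinset, Finset.ext_iff]
  constructor
  · intro h
    refine ⟨fun j => ?_, fun j => ?_⟩ <;>
    · have := h j
      split_ifs at this with hj <;> simp at this <;> simp [hj] <;> omega
  · rintro ⟨h1, h2⟩ j
    have := h1 j
    have := h2 j
    split_ifs with hj <;> simp [hj] at this ⊢ <;> omega

lemma sum_orders_univ (α : ℕ) (F : (Fin s → ℕ) → ℝ) :
    ∑ ρ ∈ orders α (Finset.univ : Finset (Fin s)), F ρ = ∑ u, ∑ ρ ∈ ordersOn α u, F ρ := by
  rw [← Finset.sum_fiberwise (orders α Finset.univ)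
    (fun ρ : Fin s → ℕ => Finset.univ.filter fun j => ρ j ≠ 0)]
  refine Finset.sum_congr rfl fun u _ => Finset.sum_congr ?_ fun _ _ => rfl
  ext ρ
  rw [Finset.mem_filter, mem_orders, mem_ordersOn]
  simp [eq_comm]

/-- The coordinates with full order `α`. -/
def fullSet (α : ℕ) (ρ : Fin s → ℕ) : Finset (Fin s) := Finset.univ.filter fun j => ρ j = α

/-- The squared norm of the marginal of the weak derivative of order `ρ`. -/
def derivEnergy (α : ℕ) (f : (Fin s → ℝ) → ℝ) (ρ : Fin s → ℕ) : ℝ :=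
  ∫ y in unitCube {j // j ∈ fullSet α ρ},
    marginal (fullSet α ρ) (weakDeriv ρ f) y * marginal (fullSet α ρ) (weakDeriv ρ f) y

lemma derivEnergy_nonneg (α : ℕ) (f : (Fin s → ℝ) → ℝ) (ρ : Fin s → ℕ) :
    0 ≤ derivEnergy α f ρ :=
  integral_nonneg fun _ => mul_self_nonneg _

lemma fullSet_orderVec {α : ℕ} (hα : 2 ≤ α) {u v : Finset (Fin s)}
    {r : {j // j ∈ u \ v} → ℕ} (hr : ∀ j, r j ∈ Finset.Icc 1 (α - 1)) :
    fullSet α (orderVec α u v r) = v := by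
  ext j
  rw [fullSet, Finset.mem_filter]
  simp only [Finset.mem_univ, true_and, orderVec]
  split_ifs with h1 h2
  · have := Finset.mem_Icc.1 (hr ⟨j, h1⟩)
    simp only [(Finset.mem_sdiff.1 h1).2, iff_false]
    omega
  · simp [h2]
  · simp only [h2, iff_false]; omega

/-- The multi-indices `(r_{u∖v}, α_v, 0)` are exactly those with support `u` and entries at most
`α`, and `v` is recovered as the set of coordinates of full order. -/
lemma innerPart_eq_sum {α : ℕ} (hα : 2 ≤ α) (u : Finset (Fin s)) (f : (Fin s → ℝ) → ℝ) :
    innerPart α u f f = ∑ ρ ∈ ordersOn α u, derivEnergy α f ρ := by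
  rw [innerPart, Finset.sum_sigma']
  refine Finset.sum_bij (fun p _ => orderVec α u p.1 p.2) ?_ ?_ ?_ ?_
  · rintro ⟨v, r⟩ hp
    rw [Finset.mem_sigma, Finset.mem_powerset, Fintype.mem_piFinset] at hp
    simp only [ordersOn, Fintype.mem_piFinset, orderVec]
    intro j
    by_cases h1 : j ∈ u \ v
    · have h2 : 1 ≤ r ⟨j, h1⟩ ∧ r ⟨j, h1⟩ ≤ α - 1 := Finset.mem_Icc.1 (hp.2 ⟨j, h1⟩)
      rw [dif_pos h1, if_pos (Finset.mem_sdiff.1 h1).1, Finset.mem_Icc]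
      exact ⟨h2.1, h2.2.trans (Nat.sub_le _ _)⟩
    · rw [dif_neg h1]
      by_cases h2 : j ∈ v
      · rw [if_pos h2, if_pos (hp.1 h2), Finset.mem_Icc]; omega
      · rw [if_neg h2, if_neg fun h => h1 (Finset.mem_sdiff.2 ⟨h, h2⟩), Finset.mem_singleton]
  · rintro ⟨v, r⟩ hp ⟨v', r'⟩ hp' he
    rw [Finset.mem_sigma, Fintype.mem_piFinset] at hp hp'
    simp only at he hp hp'
    have hv : v = v' := by
      rw [← fullSet_orderVec hα hp.2, he, fullSet_orderVec hα hp'.2]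
    subst hv
    congr 1
    ext j
    have := congrFun he j.1
    simp only [orderVec, j.2, dif_pos] at this
    exact this
  · intro ρ hρ
    have hu := (mem_ordersOn.1 hρ).2
    have hle := (mem_ordersOn.1 hρ).1
    have hmem : ∀ j, j ∈ u ↔ ρ j ≠ 0 := fun j => by rw [hu]; simp
    refine ⟨⟨fullSet α ρ, fun j => ρ j⟩, ?_, ?_⟩
    · rw [Finset.mem_sigma, Finset.mem_powerset, Fintype.mem_piFinset]
      refine ⟨fun j hj => ?_, fun j => ?_⟩
      · rw [hmem]; simp [fullSet] at hj; omega
      · have h1 := (Finset.mem_sdiff.1 j.2).1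
        have h2 := (Finset.mem_sdiff.1 j.2).2
        rw [hmem] at h1
        simp only [fullSet, Finset.mem_filter, Finset.mem_univ, true_and] at h2
        have h3 := hle j
        rw [Finset.mem_Icc]
        change 1 ≤ ρ j ∧ ρ j ≤ α - 1
        omega
    · ext j
      simp only [orderVec, Finset.mem_sdiff, hmem, fullSet, Finset.mem_filter, Finset.mem_univ,
        true_and]
      split_ifs with h1 h2
      · rfl
      · exact h2.symm
      · by_contra h3
        exact h1 ⟨fun h => h3 h.symm, h2⟩
  · rintro ⟨v, r⟩ hp
    rw [Finset.mem_sigma, Fintype.mem_piFinset] at hp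
    simp only [derivEnergy]
    rw [fullSet_orderVec hα hp.2]

/-- The one-dimensional reproducing kernel without its constant part. -/
def sobRK (α : ℕ) (x x' : ℝ) : ℝ :=
  ∑ r ∈ Finset.Icc 1 α, ∫ z, sobKer α r x z * sobKer α r x' z ∂unitMeas

/-- The square of the representer of the quadrature error in the component belonging to `u`. -/
def errorPart {N : ℕ} (α : ℕ) (P : Fin N → Fin s → ℝ) (u : Finset (Fin s)) : ℝ :=
  (1 / (N : ℝ)) ^ 2 * ∑ n, ∑ n', ∏ j ∈ u, sobRK α (P n j) (P n' j)

/-- The representer of the quadrature error for the weak derivative of order `ρ`. -/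
def errorRep {N : ℕ} (α : ℕ) (P : Fin N → Fin s → ℝ) (ρ : Fin s → ℕ) (z : Fin s → ℝ) : ℝ :=
  (1 / (N : ℝ)) * ∑ n, ∏ j, sobKer α (ρ j) (P n j) (z j)

lemma measurable_prod_sobKer (α : ℕ) (x : Fin s → ℝ) (ρ : Fin s → ℕ) :
    Measurable fun z : Fin s → ℝ => ∏ j, sobKer α (ρ j) (x j) (z j) :=
  Finset.measurable_prod _ fun j _ => (measurable_sobKer α (ρ j) (x j)).comp (measurable_pi_apply j)

lemma abs_prod_sobKer_le (α : ℕ) (x : Fin s → ℝ) (ρ : Fin s → ℕ) {z : Fin s → ℝ}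
    (hz : z ∈ unitCube (Fin s)) : |∏ j, sobKer α (ρ j) (x j) (z j)| ≤ (2 ^ α) ^ s := by
  rw [Finset.abs_prod]
  refine (Finset.prod_le_prod (fun _ _ => abs_nonneg _) fun j _ => abs_sobKer_le α (ρ j) (x j)
    (Set.Ico_subset_Icc_self (hz j (Set.mem_univ j)))).trans_eq ?_
  simp

lemma sum_integral_errorRep_sq {N : ℕ} (α : ℕ) (P : Fin N → Fin s → ℝ) (u : Finset (Fin s)) :
    ∑ ρ ∈ ordersOn α u, ∫ z in unitCube (Fin s), errorRep α P ρ z ^ 2 = errorPart α P u := by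
  have h1 : ∀ ρ, ∫ z in unitCube (Fin s), errorRep α P ρ z ^ 2 =
      (1 / (N : ℝ)) ^ 2 * ∑ n, ∑ n', ∏ j,
        ∫ z, sobKer α (ρ j) (P n j) z * sobKer α (ρ j) (P n' j) z ∂unitMeas := by
    intro ρ
    have e : ∀ z, errorRep α P ρ z ^ 2 = (1 / (N : ℝ)) ^ 2 * ∑ n, ∑ n',
        tensor (fun j t => sobKer α (ρ j) (P n j) t * sobKer α (ρ j) (P n' j) t) z := by
      intro z
      rw [errorRep, mul_pow, sq (∑ n, _), Finset.sum_mul_sum]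
      simp only [tensor, Finset.prod_mul_distrib]
    have hI : ∀ n n', Integrable (tensor fun j t =>
        sobKer α (ρ j) (P n j) t * sobKer α (ρ j) (P n' j) t)
        (volume.restrict (unitCube (Fin s))) := by
      intro n n'
      have hm : Measurable (tensor fun j t =>
          sobKer α (ρ j) (P n j) t * sobKer α (ρ j) (P n' j) t) := by
        have e' : (tensor fun j t => sobKer α (ρ j) (P n j) t * sobKer α (ρ j) (P n' j) t) =
            fun z => (∏ j, sobKer α (ρ j) (P n j) (z j)) * ∏ j, sobKer α (ρ j) (P n' j) (z j) := by
          ext z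
          simp only [tensor, Finset.prod_mul_distrib]
        rw [e']
        exact (measurable_prod_sobKer α (P n) ρ).mul (measurable_prod_sobKer α (P n') ρ)
      refine Integrable.of_bound hm.aestronglyMeasurable ((2 ^ α) ^ s * (2 ^ α) ^ s) ?_
      filter_upwards [ae_restrict_mem (measurableSet_unitCube _)] with z hz
      simp only [tensor, Finset.prod_mul_distrib, norm_mul, Real.norm_eq_abs]
      gcongr
      · exact abs_prod_sobKer_le α (P n) ρ hz
      · exact abs_prod_sobKer_le α (P n') ρ hz
    simp_rw [e]
    rw [integral_const_mul, integral_finsetSum _ fun n _ => integrable_finsetSum _ fun n' _ =>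
      hI n n']
    congr 1
    refine Finset.sum_congr rfl fun n _ => ?_
    rw [integral_finsetSum _ fun n' _ => hI n n']
    exact Finset.sum_congr rfl fun n' _ => integral_tensor _
  simp_rw [h1]
  rw [← Finset.mul_sum, errorPart, Finset.sum_comm]
  congr 1
  refine Finset.sum_congr rfl fun n _ => ?_
  rw [Finset.sum_comm]
  refine Finset.sum_congr rfl fun n' _ => ?_
  rw [ordersOn, ← Finset.prod_univ_sum (fun j => if j ∈ u then Finset.Icc 1 α else {0})
    fun j r => ∫ z, sobKer α r (P n j) z * sobKer α r (P n' j) z ∂unitMeas]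
  have e2 : ∀ j, (∑ r ∈ if j ∈ u then Finset.Icc 1 α else {0},
      ∫ z, sobKer α r (P n j) z * sobKer α r (P n' j) z ∂unitMeas) =
      if j ∈ u then sobRK α (P n j) (P n' j) else 1 := by
    intro j
    split_ifs
    · rfl
    · simp [sobKer]
  simp_rw [e2]
  rw [Finset.prod_ite_mem, Finset.univ_inter]

/-- The error of the quadrature rule; the summand of order `0` is the exact integral and drops
out. -/
lemma exactIntegral_sub_qmc {N : ℕ} (hN : N ≠ 0) {α : ℕ} (hα : 2 ≤ α) {f : (Fin s → ℝ) → ℝ}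
    (hf : IsSmooth α f) {P : Fin N → Fin s → ℝ} (hP : ∀ n, P n ∈ unitCube (Fin s)) :
    exactIntegral f - qmc P f = ∑ u ∈ Finset.univ.filter (fun u : Finset (Fin s) => u.Nonempty),
      ∑ ρ ∈ ordersOn α u, -∫ z in unitCube (Fin s), weakDeriv ρ f z * errorRep α P ρ z := by
  have h1 : qmc P f = ∑ u, ∑ ρ ∈ ordersOn α u,
      ∫ z in unitCube (Fin s), weakDeriv ρ f z * errorRep α P ρ z := by
    rw [← sum_orders_univ, qmc]
    simp_rw [fun n => eq_sum_integral_weakDeriv_mul hα hf (hP n)]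
    rw [Finset.sum_comm, Finset.mul_sum]
    refine Finset.sum_congr rfl fun ρ hρ => ?_
    have hWL := (isWeakDeriv_weakDeriv hf (mem_orders.1 hρ).1).1
    have hI : ∀ n, Integrable (fun z => weakDeriv ρ f z * ∏ j, sobKer α (ρ j) (P n j) (z j))
        (volume.restrict (unitCube (Fin s))) := fun n => by
      refine hWL.integrable_mul (MemLp.of_bound (p := 2)
        (measurable_prod_sobKer α (P n) ρ).aestronglyMeasurable ((2 ^ α) ^ s) ?_)
      filter_upwards [ae_restrict_mem (measurableSet_unitCube _)] with z hz
      exact abs_prod_sobKer_le α (P n) ρ hz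
    rw [← integral_finsetSum _ fun n _ => hI n, ← integral_const_mul]
    refine integral_congr_ae (Filter.Eventually.of_forall fun z => ?_)
    simp only [errorRep, ← Finset.mul_sum]
    ring
  have h2 : ∑ ρ ∈ ordersOn α (∅ : Finset (Fin s)),
      ∫ z in unitCube (Fin s), weakDeriv ρ f z * errorRep α P ρ z = exactIntegral f := by
    have : ordersOn α (∅ : Finset (Fin s)) = {0} := by
      ext ρ
      simp [ordersOn, funext_iff]
    rw [this, Finset.sum_singleton]
    refine integral_congr_ae ?_
    filter_upwards [weakDeriv_zero_ae hf] with z hz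
    rw [hz]
    simp [errorRep, sobKer, hN]
  have h3 : (Finset.univ.filter fun u : Finset (Fin s) => ¬u.Nonempty) = {∅} := by
    ext u; simp
  rw [h1, ← Finset.sum_filter_add_sum_filter_not Finset.univ
    (fun u : Finset (Fin s) => u.Nonempty), h3, Finset.sum_singleton, h2]
  simp only [Finset.sum_neg_distrib]
  ring

/-- The Cauchy–Schwarz inequality for the sum over all `ρ`, with the weights `γ` inserted. If `γ_u`
vanishes, so does the energy of every derivative with support `u`. -/
theorem worstCaseError_sq_le {N : ℕ} (hN : N ≠ 0) {α : ℕ} (hα : 2 ≤ α)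
    (γ : Finset (Fin s) → ℝ≥0) {P : Fin N → Fin s → ℝ} (hP : ∀ n, P n ∈ unitCube (Fin s)) :
    worstCaseError α γ P ^ 2 ≤ ENNReal.ofReal
      (∑ u ∈ Finset.univ.filter (fun u : Finset (Fin s) => u.Nonempty), γ u * errorPart α P u) := by
  set B := ∑ u ∈ Finset.univ.filter (fun u : Finset (Fin s) => u.Nonempty), γ u * errorPart α P u
    with hB
  have hE : ∀ u, 0 ≤ errorPart α P u := fun u => by
    rw [← sum_integral_errorRep_sq]
    exact Finset.sum_nonneg fun ρ _ => integral_nonneg fun z => sq_nonneg _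
  have hB0 : 0 ≤ B := Finset.sum_nonneg fun u _ => mul_nonneg (γ u).2 (hE u)
  have key : worstCaseError α γ P ≤ ENNReal.ofReal (Real.sqrt B) := by
    refine iSup₂_le fun f hf => ENNReal.ofReal_le_ofReal (Real.le_sqrt_of_sq_le ?_)
    obtain ⟨⟨hfs, hf0⟩, hf1⟩ := hf
    rw [sq_abs, exactIntegral_sub_qmc hN hα hfs hP, Finset.sum_sigma']
    have hin : ∀ u, 0 ≤ innerPart α u f f := fun u => by
      rw [innerPart_eq_sum hα]
      exact Finset.sum_nonneg fun ρ _ => derivEnergy_nonneg α f ρ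
    refine (Finset.sum_sq_le_sum_mul_sum_of_sq_le_mul _
      (f := fun p : (_ : Finset (Fin s)) × (Fin s → ℕ) => (γ p.1 : ℝ)⁻¹ * derivEnergy α f p.2)
      (g := fun p => γ p.1 * ∫ z in unitCube (Fin s), errorRep α P p.2 z ^ 2) ?_ ?_ ?_).trans ?_
    · exact fun p _ => mul_nonneg (inv_nonneg.2 (γ p.1).2) (derivEnergy_nonneg _ _ _)
    · exact fun p _ => mul_nonneg (γ p.1).2 (integral_nonneg fun z => sq_nonneg _)
    · rintro ⟨u, ρ⟩ hp
      rw [Finset.mem_sigma] at hp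
      have hρ := hp.2
      simp only at hρ ⊢
      have hWL := (isWeakDeriv_weakDeriv hfs (mem_ordersOn.1 hρ).1).1
      have h1 := integral_mul_sq_le_marginal (fullSet α ρ) hWL (h := errorRep α P ρ)
        (C := |1 / (N : ℝ)| * ∑ _n : Fin N, (2 ^ α) ^ s)
        (measurable_const.mul (Finset.measurable_sum _ fun n _ => measurable_prod_sobKer α (P n) ρ))
        (fun z hz => by
          rw [errorRep, abs_mul]
          gcongr
          refine (Finset.abs_sum_le_sum_abs _ _).trans ?_
          gcongr with n
          exact abs_prod_sobKer_le α (P n) ρ hz)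
        (fun z z' hz => by
          simp only [errorRep]
          congr 1
          refine Finset.sum_congr rfl fun n _ => Finset.prod_congr rfl fun j _ => ?_
          by_cases hj : ρ j = α
          · rw [hz j (by simp [fullSet, hj])]
          · have : ρ j < α := lt_of_le_of_ne ((mem_ordersOn.1 hρ).1 j) hj
            simp only [sobKer, this, if_true])
      rw [neg_sq]
      rcases eq_or_ne (γ u) 0 with h0 | h0
      · have hz : derivEnergy α f ρ = 0 := by
          have := hf0 u h0
          rw [innerPart_eq_sum hα, Finset.sum_eq_zero_iff_of_nonneg
            fun ρ _ => derivEnergy_nonneg α f ρ] at this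
          exact this ρ hρ
        refine h1.trans ?_
        change derivEnergy α f ρ * _ ≤ _
        rw [hz, h0]; simp
      · refine h1.trans_eq ?_
        have h0' : (γ u : ℝ) ≠ 0 := by exact_mod_cast h0
        change derivEnergy α f ρ * _ = _
        field_simp
    · have e1 : ∑ p ∈ (Finset.univ.filter fun u : Finset (Fin s) => u.Nonempty).sigma
          (fun u => ordersOn α u), (γ p.1 : ℝ)⁻¹ * derivEnergy α f p.2 ≤ 1 := by
        rw [Finset.sum_sigma]
        simp_rw [← Finset.mul_sum, ← innerPart_eq_sum hα]
        have hle : sobolevInner α γ f f ≤ 1 := by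
          by_contra hcon
          rw [not_le] at hcon
          have := Real.lt_sqrt_of_sq_lt (x := 1) (y := sobolevInner α γ f f) (by simpa using hcon)
          exact absurd hf1 (not_le.2 this)
        refine le_trans ?_ hle
        exact Finset.sum_le_sum_of_subset_of_nonneg (Finset.filter_subset _ _) fun u _ _ =>
          mul_nonneg (inv_nonneg.2 (γ u).2) (hin u)
      have e2 : ∑ p ∈ (Finset.univ.filter fun u : Finset (Fin s) => u.Nonempty).sigma
          (fun u => ordersOn α u),
          (γ p.1 : ℝ) * ∫ z in unitCube (Fin s), errorRep α P p.2 z ^ 2 = B := by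
        rw [Finset.sum_sigma]
        simp_rw [← Finset.mul_sum, sum_integral_errorRep_sq]
        rfl
      rw [e2]
      exact mul_le_of_le_one_left hB0 e1
  calc worstCaseError α γ P ^ 2 ≤ ENNReal.ofReal (Real.sqrt B) ^ 2 := by gcongr
    _ = ENNReal.ofReal B := by
      rw [← ENNReal.ofReal_pow (Real.sqrt_nonneg _), Real.sq_sqrt hB0]

/-! ### Walsh functions -/

section Walsh

variable (b : ℕ) [Fact b.Prime]

/-- The primitive `b`-th root of unity `exp(2πi/b)`. -/
def rootU : ℂ := Complex.exp (2 * Real.pi * Complex.I / b)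

lemma one_lt_base : 1 < b := (Fact.out : b.Prime).one_lt

lemma base_pos : 0 < b := (Fact.out : b.Prime).pos

lemma base_pos_real : (0 : ℝ) < b := by exact_mod_cast base_pos b

lemma isPrimitiveRoot_rootU : IsPrimitiveRoot (rootU b) b :=
  Complex.isPrimitiveRoot_exp b (base_pos b).ne'

lemma norm_rootU : ‖rootU b‖ = 1 :=
  (isPrimitiveRoot_rootU b).norm'_eq_one (base_pos b).ne'

lemma norm_rootU_pow (n : ℕ) : ‖rootU b ^ n‖ = 1 := by rw [norm_pow, norm_rootU, one_pow]

lemma rootU_pow_mod (n : ℕ) : rootU b ^ (n % b) = rootU b ^ n :=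
  (pow_eq_pow_mod n (isPrimitiveRoot_rootU b).pow_eq_one).symm

lemma rootU_pow_ne_one {l : ℕ} (h0 : 0 < l) (hl : l < b) : rootU b ^ l ≠ 1 :=
  (isPrimitiveRoot_rootU b).pow_ne_one_of_pos_of_lt h0.ne' hl

/-- Chords of the unit circle between distinct `b`-th roots of unity have length at least
`2 sin(π/b)`. -/
lemma two_sin_le_norm_rootU_pow_sub_one {l : ℕ} (h0 : 0 < l) (hl : l < b) :
    2 * Real.sin (Real.pi / b) ≤ ‖rootU b ^ l - 1‖ := by
  have hb := base_pos_real b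
  have e : rootU b ^ l = Complex.exp (Complex.I * ((2 * Real.pi * l / b : ℝ) : ℂ)) := by
    rw [rootU, ← Complex.exp_nat_mul]
    congr 1
    push_cast
    ring
  rw [e, Complex.norm_exp_I_mul_ofReal_sub_one, Real.norm_eq_abs, abs_mul]
  rw [show |(2 : ℝ)| = 2 by norm_num]
  gcongr
  refine le_trans ?_ (le_abs_self _)
  have e2 : 2 * Real.pi * l / b / 2 = Real.pi * l / b := by ring
  rw [e2]
  have h1 : Real.pi / b ≤ Real.pi * l / b := by
    gcongr
    exact le_mul_of_one_le_right Real.pi_pos.le (by exact_mod_cast h0)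
  have h2 : Real.pi * l / b ≤ Real.pi - Real.pi / b := by
    rw [div_le_iff₀ hb, sub_mul, div_mul_cancel₀ _ hb.ne']
    have : (l : ℝ) + 1 ≤ b := by exact_mod_cast hl
    nlinarith [Real.pi_pos]
  have h3 : 0 < Real.pi / b := by positivity
  -- `sin` is at least its value at the ends of an interval symmetric about `π/2`.
  rcases le_total (Real.pi * l / b) (Real.pi / 2) with h | h
  · exact Real.sin_le_sin_of_le_of_le_pi_div_two (by linarith) h h1
  · rw [← Real.sin_pi_sub (Real.pi * l / b)]
    exact Real.sin_le_sin_of_le_of_le_pi_div_two (by linarith) (by linarith) (by linarith)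

lemma two_sin_pos : 0 < 2 * Real.sin (Real.pi / b) := by
  have hb := base_pos_real b
  have h1 : (1 : ℝ) < b := by exact_mod_cast one_lt_base b
  have : 0 < Real.sin (Real.pi / b) := Real.sin_pos_of_pos_of_lt_pi (by positivity)
    (by rw [div_lt_iff₀ hb]; nlinarith [Real.pi_pos])
  positivity

/-- The base `b` digit of `x` at position `i`, counted from `0`, as a natural number. -/
def dig (x : ℝ) (i : ℕ) : ℕ := (Real.digits x b i : ℕ)

lemma dig_eq (x : ℝ) (i : ℕ) : dig b x i = ⌊x * b ^ (i + 1)⌋₊ % b := by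
  simp [dig, Real.digits]

lemma dig_lt (x : ℝ) (i : ℕ) : dig b x i < b := (Real.digits x b i).2

lemma dig_eq_of_floor {x : ℝ} {M n : ℕ} (hn : ⌊x * b ^ M⌋₊ = n) {i : ℕ} (hi : i < M) :
    dig b x i = n / b ^ (M - 1 - i) % b := by
  have hb := base_pos_real b
  rw [dig_eq, ← hn]
  congr 1
  have h := Nat.floor_div_natCast (x * (b : ℝ) ^ M) (b ^ (M - 1 - i))
  rw [← h]
  congr 1
  push_cast
  rw [eq_div_iff (by positivity), mul_assoc, ← pow_add]
  congr 2
  omega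

/-- The `k`-th Walsh function. The digits of `k` at positions `≥ k` vanish, so that the product
runs over all nonzero digits of `k`. -/
def wal (k : ℕ) (x : ℝ) : ℂ := ∏ i ∈ Finset.range k, rootU b ^ (k / b ^ i % b * dig b x i)

lemma wal_eq_prod {k M : ℕ} (hk : k < b ^ M) (x : ℝ) :
    wal b k x = ∏ i ∈ Finset.range M, rootU b ^ (k / b ^ i % b * dig b x i) := by
  have key : ∀ {M N : ℕ}, k < b ^ M → M ≤ N →
      ∏ i ∈ Finset.range M, rootU b ^ (k / b ^ i % b * dig b x i) =
        ∏ i ∈ Finset.range N, rootU b ^ (k / b ^ i % b * dig b x i) := by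
    intro M N hM hMN
    refine Finset.prod_subset (Finset.range_mono hMN) fun i _ hi => ?_
    have hi' : M ≤ i := by simpa using hi
    rw [Nat.div_eq_of_lt (hM.trans_le (Nat.pow_le_pow_right (base_pos b) hi'))]
    simp
  have hkk : k < b ^ k := Nat.lt_pow_self (one_lt_base b)
  rw [wal, key hkk (le_max_left k M), key hk (le_max_right k M)]

lemma norm_wal (k : ℕ) (x : ℝ) : ‖wal b k x‖ = 1 := by
  rw [wal, norm_prod]
  exact Finset.prod_eq_one fun i _ => norm_rootU_pow b _

@[simp] lemma wal_zero (x : ℝ) : wal b 0 x = 1 := by simp [wal]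

lemma measurable_dig (i : ℕ) : Measurable fun x => dig b x i := by
  simp_rw [dig_eq]
  have h1 : Measurable fun x : ℝ => ⌊x * (b : ℝ) ^ (i + 1)⌋₊ :=
    Nat.measurable_floor.comp (measurable_id.mul_const _)
  exact (measurable_from_top (f := fun n : ℕ => n % b)).comp h1

lemma measurable_wal (k : ℕ) : Measurable (wal b k) := by
  unfold wal
  refine Finset.measurable_prod _ fun i _ => ?_
  exact (measurable_from_top (f := fun n : ℕ => rootU b ^ (k / b ^ i % b * n))).comp
    (measurable_dig b i)

lemma integrable_wal (k : ℕ) : Integrable (wal b k) unitMeas :=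
  Integrable.of_bound (measurable_wal b k).aestronglyMeasurable 1
    (Filter.Eventually.of_forall fun x => (norm_wal b k x).le)

/-- Splitting off a leading digit. -/
lemma wal_add_mul_pow {k M κ : ℕ} (hk : k < b ^ M) (hκ : κ < b) (x : ℝ) :
    wal b (k + κ * b ^ M) x = wal b k x * rootU b ^ (κ * dig b x M) := by
  have hb := base_pos b
  have hlt : k + κ * b ^ M < b ^ (M + 1) := by
    rw [pow_succ]
    nlinarith [Nat.mul_le_mul_right (b ^ M) (Nat.succ_le_of_lt hκ)]
  rw [wal_eq_prod b hlt, Finset.prod_range_succ, wal_eq_prod b hk]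
  congr 1
  · refine Finset.prod_congr rfl fun i hi => ?_
    rw [Finset.mem_range] at hi
    have e : κ * b ^ M = (κ * b ^ (M - i)) * b ^ i := by
      rw [mul_assoc, ← pow_add]; congr 2; omega
    rw [e, Nat.add_mul_div_right _ _ (by positivity)]
    have e2 : κ * b ^ (M - i) = (κ * b ^ (M - i - 1)) * b := by
      rw [mul_assoc, ← pow_succ]; congr 2; omega
    rw [e2, Nat.add_mul_mod_self_right]
  · rw [Nat.add_mul_div_right _ _ (by positivity), Nat.div_eq_of_lt hk, zero_add,
      Nat.mod_eq_of_lt hκ]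

/-! ### The primitive of a Walsh function -/

/-- The value of the `k`-th Walsh function on `[n b^{-M}, (n+1) b^{-M})`, if `k < b^M`. -/
def walCell (M k n : ℕ) : ℂ := ∏ i ∈ Finset.range M, rootU b ^ (k / b ^ i % b *
  (n / b ^ (M - 1 - i) % b))

lemma wal_eq_walCell {k M n : ℕ} (hk : k < b ^ M) {x : ℝ} (hx : ⌊x * b ^ M⌋₊ = n) :
    wal b k x = walCell b M k n := by
  rw [wal_eq_prod b hk, walCell]
  refine Finset.prod_congr rfl fun i hi => ?_
  rw [dig_eq_of_floor b hx (Finset.mem_range.1 hi)]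

lemma floor_eq_of_mem_cell {M n : ℕ} {x : ℝ}
    (hx : x ∈ Set.Ico ((n : ℝ) / b ^ M) ((n + 1) / b ^ M)) : ⌊x * b ^ M⌋₊ = n := by
  have hb := base_pos_real b
  have hM : (0 : ℝ) < b ^ M := by positivity
  obtain ⟨h1, h2⟩ := hx
  rw [div_le_iff₀ hM] at h1
  rw [lt_div_iff₀ hM] at h2
  rw [Nat.floor_eq_iff (le_trans (by positivity) h1)]
  exact ⟨h1, h2⟩

lemma intervalIntegral_cell {E : Type*} [NormedAddCommGroup E] [NormedSpace ℝ E]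
    [CompleteSpace E] {F : ℝ → E} {c : E} {M n : ℕ}
    (hF : ∀ x : ℝ, ⌊x * b ^ M⌋₊ = n → F x = c) {y : ℝ}
    (hy : y ∈ Set.Icc ((n : ℝ) / b ^ M) ((n + 1) / b ^ M)) :
    ∫ x in ((n : ℝ) / b ^ M)..y, F x = (y - n / b ^ M) • c := by
  rw [intervalIntegral.integral_of_le hy.1, ← integral_Ico_eq_integral_Ioc,
    setIntegral_congr_fun (g := fun _ => c) measurableSet_Ico fun x hx =>
      hF x (floor_eq_of_mem_cell b ⟨hx.1, hx.2.trans_le hy.2⟩)]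
  rw [setIntegral_const, Measure.real, Real.volume_Ico,
    ENNReal.toReal_ofReal (sub_nonneg.2 hy.1)]

lemma walCell_succ {k M κ : ℕ} (hk : k < b ^ M) (hκ : κ < b) (n : ℕ) :
    walCell b (M + 1) (k + κ * b ^ M) n =
      walCell b M k (n / b) * rootU b ^ (κ * (n % b)) := by
  have hb := base_pos b
  rw [walCell, Finset.prod_range_succ, walCell]
  congr 1
  · refine Finset.prod_congr rfl fun i hi => ?_
    rw [Finset.mem_range] at hi
    have e : κ * b ^ M = (κ * b ^ (M - i)) * b ^ i := by
      rw [mul_assoc, ← pow_add]; congr 2; omega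
    have e2 : κ * b ^ (M - i) = (κ * b ^ (M - i - 1)) * b := by
      rw [mul_assoc, ← pow_succ]; congr 2; omega
    rw [e, Nat.add_mul_div_right _ _ (by positivity), e2, Nat.add_mul_mod_self_right,
      Nat.div_div_eq_div_mul, ← pow_succ']
    congr 5
    omega
  · rw [Nat.add_mul_div_right _ _ (by positivity), Nat.div_eq_of_lt hk, zero_add,
      Nat.mod_eq_of_lt hκ]
    simp

/-- The primitive of a Walsh function at the points of the grid of its resolution. -/
lemma intervalIntegral_wal_grid {k M κ : ℕ} (hk : k < b ^ M) (h0 : 0 < κ) (hκ : κ < b) (n : ℕ)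
    (hn : n ≤ b ^ (M + 1)) :
    ∫ x in (0 : ℝ)..(n / b ^ (M + 1)), wal b (k + κ * b ^ M) x =
      ((b : ℂ) ^ (M + 1))⁻¹ * (walCell b M k (n / b) *
        ((rootU b ^ (κ * (n % b)) - 1) / (rootU b ^ κ - 1))) := by
  have hb := base_pos b
  have hbr := base_pos_real b
  have hne : rootU b ^ κ - 1 ≠ 0 := sub_ne_zero.2 (rootU_pow_ne_one b h0 hκ)
  have hlt : k + κ * b ^ M < b ^ (M + 1) := by
    rw [pow_succ]
    nlinarith [Nat.mul_le_mul_right (b ^ M) (Nat.succ_le_of_lt hκ)]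
  induction n with
  | zero => simp
  | succ n ih =>
    have hle : (n : ℝ) / b ^ (M + 1) ≤ (n + 1) / b ^ (M + 1) := by gcongr; linarith
    have hcell : ∫ x in ((n : ℝ) / b ^ (M + 1))..((n + 1) / b ^ (M + 1)),
        wal b (k + κ * b ^ M) x =
        ((b : ℂ) ^ (M + 1))⁻¹ * (walCell b M k (n / b) * rootU b ^ (κ * (n % b))) := by
      rw [intervalIntegral_cell b (c := walCell b M k (n / b) * rootU b ^ (κ * (n % b)))
        (fun x hx => by rw [wal_eq_walCell b hlt hx, walCell_succ b hk hκ]) ⟨hle, le_rfl⟩]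
      rw [Complex.real_smul]
      congr 1
      push_cast
      ring
    have hint : ∀ y z : ℝ, 0 ≤ y → y ≤ 1 → 0 ≤ z → z ≤ 1 →
        IntervalIntegrable (wal b (k + κ * b ^ M)) volume y z := fun y z h1 h2 h3 h4 =>
      intervalIntegrable_of_unitMeas (integrable_wal b _) ⟨h1, h2⟩ ⟨h3, h4⟩
    have hn1 : ((n : ℝ) + 1) / b ^ (M + 1) ≤ 1 := by
      rw [div_le_one (by positivity)]; exact_mod_cast hn
    push_cast
    rw [← intervalIntegral.integral_add_adjacent_intervals
      (hint 0 (n / b ^ (M + 1)) le_rfl zero_le_one (by positivity) (hle.trans hn1))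
      (hint _ _ (by positivity) (hle.trans hn1) (by positivity) hn1), hcell, ih (by omega),
      ← mul_add, ← mul_add]
    congr 1
    by_cases hz : (n + 1) % b = 0
    · rw [hz]
      have hmod : n % b = b - 1 := by
        have h1 := Nat.add_mod n 1 b
        have h2 := Nat.mod_lt n hb
        rw [hz, Nat.mod_eq_of_lt (one_lt_base b)] at h1
        by_contra h3
        rw [Nat.mod_eq_of_lt (by omega)] at h1
        omega
      rw [hmod]
      have e : rootU b ^ (κ * (b - 1)) * rootU b ^ κ = 1 := by
        rw [← pow_add, show κ * (b - 1) + κ = b * κ by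
          obtain ⟨c, hc⟩ : ∃ c, b = c + 1 := ⟨b - 1, by omega⟩
          rw [hc, Nat.add_sub_cancel]; ring, pow_mul, (isPrimitiveRoot_rootU b).pow_eq_one, one_pow]
      have : (rootU b ^ (κ * (b - 1)) - 1) / (rootU b ^ κ - 1) + rootU b ^ (κ * (b - 1)) = 0 := by
        field_simp
        linear_combination e
      rw [this]
      simp
    · have hmod : (n + 1) % b = n % b + 1 := by
        have h2 := Nat.mod_lt n hb
        have h1 := Nat.add_mod n 1 b
        rw [Nat.mod_eq_of_lt (one_lt_base b)] at h1
        rcases Nat.lt_or_ge (n % b + 1) b with h3 | h3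
        · rw [h1, Nat.mod_eq_of_lt h3]
        · rw [show n % b + 1 = b by omega, Nat.mod_self] at h1
          exact absurd h1 hz
      have hdiv : (n + 1) / b = n / b := by
        have h1 := Nat.div_add_mod (n + 1) b
        have h2 := Nat.div_add_mod n b
        rw [hmod] at h1
        have : b * ((n + 1) / b) = b * (n / b) := by omega
        exact Nat.eq_of_mul_eq_mul_left hb this
      rw [hdiv, hmod]
      congr 1
      field_simp
      ring

lemma integral_wal {k M κ : ℕ} (hk : k < b ^ M) (h0 : 0 < κ) (hκ : κ < b) :
    ∫ x in (0 : ℝ)..1, wal b (k + κ * b ^ M) x = 0 := by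
  have hbr := base_pos_real b
  have h := intervalIntegral_wal_grid b hk h0 hκ (b ^ (M + 1)) le_rfl
  push_cast at h
  rw [div_self (by positivity)] at h
  rw [h, show b ^ (M + 1) % b = 0 by rw [pow_succ, Nat.mul_mod_left]]
  simp

/-- The primitive of a Walsh function with leading digit `κ` at position `M`; the fractional part
of `b^{M+1} x` enters linearly. -/
lemma intervalIntegral_wal {k M κ : ℕ} (hk : k < b ^ M) (h0 : 0 < κ) (hκ : κ < b) {y : ℝ}
    (hy : y ∈ Set.Ico (0 : ℝ) 1) :
    ∫ x in (0 : ℝ)..y, wal b (k + κ * b ^ M) x =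
      ((b : ℂ) ^ (M + 1))⁻¹ * (wal b k y *
        ((rootU b ^ (κ * dig b y M) - 1) / (rootU b ^ κ - 1) +
          rootU b ^ (κ * dig b y M) * ((y * b ^ (M + 1) - ⌊y * b ^ (M + 1)⌋₊ : ℝ) : ℂ))) := by
  have hb := base_pos b
  have hbr := base_pos_real b
  have hM : (0 : ℝ) < b ^ (M + 1) := by positivity
  have hlt : k + κ * b ^ M < b ^ (M + 1) := by
    rw [pow_succ]
    nlinarith [Nat.mul_le_mul_right (b ^ M) (Nat.succ_le_of_lt hκ)]
  set n := ⌊y * b ^ (M + 1)⌋₊ with hn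
  have hy0 : 0 ≤ y * b ^ (M + 1) := mul_nonneg hy.1 hM.le
  have h1 : (n : ℝ) ≤ y * b ^ (M + 1) := Nat.floor_le hy0
  have h2 : y * b ^ (M + 1) < n + 1 := Nat.lt_floor_add_one _
  have h1' : (n : ℝ) / b ^ (M + 1) ≤ y := (div_le_iff₀ hM).2 h1
  have h2' : y ≤ ((n : ℝ) + 1) / b ^ (M + 1) := (le_div_iff₀ hM).2 h2.le
  have hnle : n ≤ b ^ (M + 1) := by
    have : (n : ℝ) ≤ (b : ℝ) ^ (M + 1) := h1.trans (mul_le_of_le_one_left hM.le hy.2.le)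
    exact_mod_cast this
  have hdig : dig b y M = n % b := by rw [dig_eq]
  have hw : wal b k y = walCell b M k (n / b) := by
    refine wal_eq_walCell b hk ?_
    have h := Nat.floor_div_natCast (y * (b : ℝ) ^ (M + 1)) b
    rw [hn, ← h]
    congr 1
    rw [pow_succ]; field_simp
  rw [← intervalIntegral.integral_add_adjacent_intervals
    (intervalIntegrable_of_unitMeas (integrable_wal b _) (by simp)
      ⟨by positivity, h1'.trans hy.2.le⟩)
    (intervalIntegrable_of_unitMeas (integrable_wal b _) ⟨by positivity, h1'.trans hy.2.le⟩
      (Set.Ico_subset_Icc_self hy)), intervalIntegral_wal_grid b hk h0 hκ n hnle,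
    intervalIntegral_cell b (c := walCell b M k (n / b) * rootU b ^ (κ * (n % b)))
        (fun x hx => by rw [wal_eq_walCell b hlt hx, walCell_succ b hk hκ]) ⟨h1', h2'⟩,
    hdig, hw, Complex.real_smul]
  have hbc : (b : ℂ) ≠ 0 := by exact_mod_cast hb.ne'
  push_cast
  field_simp

end Walsh

section WalshBound

variable (b : ℕ) [Fact b.Prime]

/-! ### The Walsh expansion of the primitive of a Walsh function -/

lemma sum_rootU_pow {m : ℕ} (h0 : 0 < m) (hm : m < b) :
    ∑ l ∈ Finset.Icc 1 (b - 1), rootU b ^ (l * m) = -1 := by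
  have h1 := (isPrimitiveRoot_rootU b)
  have h2 : ∑ l ∈ Finset.range b, rootU b ^ (l * m) = 0 := by
    have hne := rootU_pow_ne_one b h0 hm
    have h3 := mul_neg_geom_sum (rootU b ^ m) b
    rw [← pow_mul, mul_comm m b, pow_mul, h1.pow_eq_one, one_pow, sub_self] at h3
    rcases mul_eq_zero.1 h3 with h | h
    · exact absurd (sub_eq_zero.1 h).symm hne
    · rw [← h]
      exact Finset.sum_congr rfl fun l _ => by rw [← pow_mul, mul_comm]
  obtain ⟨c, hc⟩ : ∃ c, b = c + 1 := ⟨b - 1, by have := base_pos b; omega⟩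
  have h4 : Finset.Icc 1 (b - 1) = (Finset.range b).erase 0 := by
    ext l; rw [Finset.mem_Icc, Finset.mem_erase, Finset.mem_range]; omega
  rw [h4]
  have h5 := Finset.add_sum_erase (Finset.range b) (fun l => rootU b ^ (l * m))
    (Finset.mem_range.2 (base_pos b))
  rw [h2] at h5
  simp only [zero_mul, pow_zero] at h5
  linear_combination h5

/-- The Fourier coefficients of the digit function `ξ ↦ ξ` on `ℤ/b`. -/
def digCoef (l : ℕ) : ℂ := rootU b ^ l / (1 - rootU b ^ l)

lemma norm_digCoef_le {l : ℕ} (h0 : 0 < l) (hl : l < b) :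
    ‖digCoef b l‖ ≤ (2 * Real.sin (Real.pi / b))⁻¹ := by
  rw [digCoef, norm_div, norm_rootU_pow, one_div, norm_sub_rev]
  exact inv_anti₀ (two_sin_pos b) (two_sin_le_norm_rootU_pow_sub_one b h0 hl)

/-- The finite Fourier expansion of the digit function, up to its mean `(b-1)/2`. -/
lemma digit_eq_sum {ξ : ℕ} (hξ : ξ < b) :
    (ξ : ℂ) - (b - 1) / 2 = ∑ l ∈ Finset.Icc 1 (b - 1), digCoef b l * rootU b ^ (l * ξ) := by
  have hone : ∀ l ∈ Finset.Icc 1 (b - 1), (1 : ℂ) - rootU b ^ l ≠ 0 := fun l hl => by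
    rw [Finset.mem_Icc] at hl
    have := base_pos b
    exact sub_ne_zero.2 (rootU_pow_ne_one b (by omega) (by omega)).symm
  induction ξ with
  | zero =>
    have e1 : ∑ l ∈ Finset.Icc 1 (b - 1), digCoef b l =
        ∑ l ∈ Finset.Icc 1 (b - 1), digCoef b (b - l) := by
      refine Finset.sum_nbij' (fun l => b - l) (fun l => b - l) ?_ ?_ ?_ ?_ ?_ <;>
        intro l hl <;> rw [Finset.mem_Icc] at hl
      · rw [Finset.mem_Icc]; omega
      · rw [Finset.mem_Icc]; omega
      · omega
      · omega
      · rw [Nat.sub_sub_self (by omega)]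
    have e2 : ∑ l ∈ Finset.Icc 1 (b - 1), (digCoef b l + digCoef b (b - l)) =
        ∑ l ∈ Finset.Icc 1 (b - 1), (-1 : ℂ) := by
      refine Finset.sum_congr rfl fun l hl => ?_
      have h1 := hone l hl
      have h2 := hone (b - l) (by rw [Finset.mem_Icc] at hl ⊢; omega)
      rw [Finset.mem_Icc] at hl
      have h3 : rootU b ^ l * rootU b ^ (b - l) = 1 := by
        rw [← pow_add, Nat.add_sub_cancel' (by omega), (isPrimitiveRoot_rootU b).pow_eq_one]
      rw [digCoef, digCoef]
      field_simp
      linear_combination (-1 : ℂ) * h3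
    rw [Finset.sum_add_distrib, ← e1, Finset.sum_const, Nat.card_Icc] at e2
    have hb1 : ((b - 1 + 1 - 1 : ℕ) : ℂ) = b - 1 := by
      rw [Nat.add_sub_cancel, Nat.cast_sub (base_pos b)]; simp
    rw [nsmul_eq_mul, hb1] at e2
    simp only [Nat.cast_zero, mul_zero, pow_zero, mul_one]
    linear_combination (-1 / 2 : ℂ) * e2
  | succ ξ ih =>
    have e1 : ∑ l ∈ Finset.Icc 1 (b - 1), digCoef b l * rootU b ^ (l * (ξ + 1)) =
        ∑ l ∈ Finset.Icc 1 (b - 1), digCoef b l * rootU b ^ (l * ξ) -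
          ∑ l ∈ Finset.Icc 1 (b - 1), rootU b ^ (l * (ξ + 1)) := by
      rw [← Finset.sum_sub_distrib]
      refine Finset.sum_congr rfl fun l hl => ?_
      have h1 := hone l hl
      rw [digCoef, mul_add, mul_one, pow_add]
      field_simp
      ring
    rw [e1, ← ih (by omega), sum_rootU_pow b (Nat.succ_pos ξ) hξ]
    push_cast
    ring

lemma fract_eq_sum_digits (y : ℝ) (M C : ℕ) :
    y * b ^ M - ⌊y * b ^ M⌋₊ - 1 / 2 =
      ∑ c ∈ Finset.range C, ((b : ℝ) ^ (c + 1))⁻¹ * (dig b y (M + c) - (b - 1) / 2) +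
        ((b : ℝ) ^ C)⁻¹ * (y * b ^ (M + C) - ⌊y * b ^ (M + C)⌋₊ - 1 / 2) := by
  have hb := base_pos_real b
  induction C with
  | zero => simp
  | succ C ih =>
    rw [ih, Finset.sum_range_succ, add_assoc]
    congr 1
    have h1 : ⌊y * (b : ℝ) ^ (M + C)⌋₊ = ⌊y * (b : ℝ) ^ (M + C + 1)⌋₊ / b := by
      rw [← Nat.floor_div_natCast]
      congr 1
      rw [pow_succ]; field_simp
    have h2 : (⌊y * (b : ℝ) ^ (M + C + 1)⌋₊ : ℝ) =
        b * ⌊y * (b : ℝ) ^ (M + C)⌋₊ + dig b y (M + C) := by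
      rw [dig_eq, h1]
      exact_mod_cast (Nat.div_add_mod _ _).symm
    rw [← add_assoc M C 1, h2, pow_succ, pow_succ]
    field_simp
    ring

/-- The remainder after `C` digits in the expansion of the primitive of a Walsh function. -/
def walRem (k M C : ℕ) (y : ℝ) : ℂ :=
  ((y * b ^ (M + 1 + C) - ⌊y * b ^ (M + 1 + C)⌋₊ - 1 / 2 : ℝ) : ℂ) * wal b k y

lemma norm_walRem_le (k M C : ℕ) {y : ℝ} (hy : 0 ≤ y) : ‖walRem b k M C y‖ ≤ 1 := by
  have hb := base_pos_real b
  rw [walRem, norm_mul, norm_wal, mul_one, Complex.norm_real, Real.norm_eq_abs, abs_le]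
  have h1 := Nat.floor_le (a := y * (b : ℝ) ^ (M + 1 + C)) (by positivity)
  have h2 := Nat.lt_floor_add_one (y * (b : ℝ) ^ (M + 1 + C))
  constructor <;> linarith

lemma measurable_walRem (k M C : ℕ) : Measurable (walRem b k M C) := by
  unfold walRem
  refine Measurable.mul (Complex.measurable_ofReal.comp ?_) (measurable_wal b k)
  have h : Measurable fun y : ℝ => (⌊y * (b : ℝ) ^ (M + 1 + C)⌋₊ : ℝ) :=
    (measurable_from_top (f := fun n : ℕ => (n : ℝ))).comp
      (Nat.measurable_floor.comp (measurable_id.mul_const _))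
  fun_prop

lemma integrable_walRem (k M C : ℕ) : Integrable (walRem b k M C) unitMeas :=
  Integrable.of_bound (measurable_walRem b k M C).aestronglyMeasurable 1
    (ae_unitMeas_of_forall fun _ ht => norm_walRem_le b k M C ht.1)

/-- The Walsh expansion of the image of a Walsh function: the frequencies that occur arise from `k`
either by deleting the leading digit, or not at all, or by adding one higher digit. -/
lemma adjPrim_wal {k M κ : ℕ} (hk : k < b ^ M) (h0 : 0 < κ) (hκ : κ < b) (C : ℕ) {y : ℝ}
    (hy : y ∈ Set.Ico (0 : ℝ) 1) :
    adjPrim (wal b (k + κ * b ^ M)) y = -((b : ℂ) ^ (M + 1))⁻¹ * (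
      -(rootU b ^ κ - 1)⁻¹ * wal b k y +
      ((rootU b ^ κ - 1)⁻¹ + 1 / 2) * wal b (k + κ * b ^ M) y +
      (∑ c ∈ Finset.range C, ((b : ℂ) ^ (c + 1))⁻¹ * ∑ l ∈ Finset.Icc 1 (b - 1),
        digCoef b l * wal b (k + κ * b ^ M + l * b ^ (M + 1 + c)) y) +
      ((b : ℂ) ^ C)⁻¹ * walRem b (k + κ * b ^ M) M C y) := by
  have hb := base_pos b
  have hlt : k + κ * b ^ M < b ^ (M + 1) := by
    rw [pow_succ]
    nlinarith [Nat.mul_le_mul_right (b ^ M) (Nat.succ_le_of_lt hκ)]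
  have hf := congrArg (fun r : ℝ => (r : ℂ)) (fract_eq_sum_digits b y (M + 1) C)
  have hsum : ∀ c ∈ Finset.range C, ((b : ℂ) ^ (c + 1))⁻¹ * ∑ l ∈ Finset.Icc 1 (b - 1),
        digCoef b l * wal b (k + κ * b ^ M + l * b ^ (M + 1 + c)) y =
      wal b (k + κ * b ^ M) y *
        (((b : ℂ) ^ (c + 1))⁻¹ * ((dig b y (M + 1 + c) : ℂ) - (b - 1) / 2)) := by
    intro c _
    rw [digit_eq_sum b (dig_lt b y _), Finset.mul_sum, Finset.mul_sum, Finset.mul_sum]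
    refine Finset.sum_congr rfl fun l hl => ?_
    rw [Finset.mem_Icc] at hl
    rw [wal_add_mul_pow b (hlt.trans_le (Nat.pow_le_pow_right hb (Nat.le_add_right _ c)))
      (by omega : l < b)]
    ring
  rw [Finset.sum_congr rfl hsum, ← Finset.mul_sum, adjPrim, integral_wal b hk h0 hκ,
    intervalIntegral_wal b hk h0 hκ hy, walRem]
  simp only [Complex.ofReal_sub, Complex.ofReal_add, Complex.ofReal_sum, Complex.ofReal_mul,
    Complex.ofReal_inv, Complex.ofReal_pow, Complex.ofReal_natCast, Complex.ofReal_div,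
    Complex.ofReal_one, Complex.ofReal_ofNat] at hf ⊢
  rw [smul_zero, zero_sub, wal_add_mul_pow b hk hκ]
  linear_combination -((b : ℂ) ^ (M + 1))⁻¹ * wal b k y * rootU b ^ (κ * dig b y M) * hf

/-! ### Linear functionals of iterated primitives of Walsh functions -/

/-- The pairing of the `r`-fold iterate of `adjPrim` on `F` with `g`. -/
def iterPairing (g : ℝ → ℂ) (r : ℕ) (F : ℝ → ℂ) : ℂ := ∫ y, adjPrim^[r] F y * g y ∂unitMeas

section iterPairing

variable {g : ℝ → ℂ} {G : ℝ} (hgm : AEStronglyMeasurable g unitMeas)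
  (hgG : ∀ x ∈ Set.Ico (0 : ℝ) 1, ‖g x‖ ≤ G)

include hgm hgG in
lemma integrable_iterPairing {F : ℝ → ℂ} (hF : Integrable F unitMeas) (r : ℕ) :
    Integrable (fun y => adjPrim^[r] F y * g y) unitMeas :=
  (integrable_iterate_adjPrim hF r).mul_bdd (c := G) hgm (ae_unitMeas_of_forall hgG)

include hgm hgG in
lemma iterPairing_add {F H : ℝ → ℂ} (hF : Integrable F unitMeas) (hH : Integrable H unitMeas)
    (r : ℕ) : iterPairing g r (fun t => F t + H t) = iterPairing g r F + iterPairing g r H := by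
  rw [iterPairing, iterPairing, iterPairing, ← integral_add (integrable_iterPairing hgm hgG hF r)
    (integrable_iterPairing hgm hgG hH r)]
  refine integral_congr_ae (ae_unitMeas_of_forall fun t ht => ?_)
  simp only
  rw [iterate_adjPrim_add hF hH r t (Set.Ico_subset_Icc_self ht), add_mul]

lemma iterPairing_smul (c : ℂ) (F : ℝ → ℂ) (r : ℕ) :
    iterPairing g r (fun t => c * F t) = c * iterPairing g r F := by
  rw [iterPairing, iterPairing, ← integral_const_mul]
  refine integral_congr_ae (Filter.Eventually.of_forall fun t => ?_)
  have := iterate_adjPrim_smul c F r t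
  simp only [smul_eq_mul] at this ⊢
  rw [this, mul_assoc]

lemma iterPairing_congr {F H : ℝ → ℂ} (h : ∀ t ∈ Set.Ico (0 : ℝ) 1, F t = H t) (r : ℕ) :
    iterPairing g r F = iterPairing g r H := by
  refine integral_congr_ae (ae_unitMeas_of_forall fun t ht => ?_)
  simp only
  cases r with
  | zero => simp [h t ht]
  | succ r =>
    rw [Function.iterate_succ_apply, Function.iterate_succ_apply]
    rw [iterate_adjPrim_congr (fun y hy => adjPrim_congr_ae (ae_unitMeas_of_forall h) hy) r t
      (Set.Ico_subset_Icc_self ht)]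

include hgm hgG in
lemma iterPairing_sum {ι : Type*} (S : Finset ι) {F : ι → ℝ → ℂ}
    (hF : ∀ i, Integrable (F i) unitMeas) (r : ℕ) :
    iterPairing g r (fun t => ∑ i ∈ S, F i t) = ∑ i ∈ S, iterPairing g r (F i) := by
  induction S using Finset.cons_induction with
  | empty =>
    have := iterPairing_smul (g := g) 0 (fun _ => 0) r
    simpa using this
  | cons i S hi ih =>
    simp only [Finset.sum_cons]
    rw [iterPairing_add hgm hgG (hF i) (integrable_finsetSum _ fun i _ => hF i), ih]

include hgG in
lemma norm_iterPairing_le {F : ℝ → ℂ} (hF : Integrable F unitMeas)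
    (h1 : ∀ t ∈ Set.Ico (0 : ℝ) 1, ‖F t‖ ≤ 1) (r : ℕ) : ‖iterPairing g r F‖ ≤ 2 ^ r * G := by
  have hG : 0 ≤ G := (norm_nonneg _).trans (hgG 0 (by simp))
  rw [iterPairing]
  refine (norm_integral_le_integral_norm _).trans
    (integral_unitMeas_le_of_forall (fun _ _ => norm_nonneg _) fun t ht => ?_)
  rw [norm_mul]
  gcongr
  · cases r with
    | zero => simpa using h1 t ht
    | succ r =>
      refine (norm_iterate_adjPrim_le hF r (Set.Ico_subset_Icc_self ht)).trans ?_
      exact mul_le_of_le_one_right (by positivity)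
        (integral_unitMeas_le_of_forall (fun _ _ => norm_nonneg _) h1)
  · exact hgG t ht

include hgm hgG in
/-- The expansion of one image under `adjPrim`, paired with `g` after `r` further steps; all its
coefficients are bounded by the inverse of the shortest chord `2 sin(π/b)`. -/
lemma norm_iterPairing_succ_wal_le {k M κ : ℕ} (hk : k < b ^ M) (h0 : 0 < κ) (hκ : κ < b)
    (r C : ℕ) :
    ‖iterPairing g (r + 1) (wal b (k + κ * b ^ M))‖ ≤
      ((b : ℝ) ^ (M + 1))⁻¹ * ((2 * Real.sin (Real.pi / b))⁻¹ * (‖iterPairing g r (wal b k)‖ +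
        ‖iterPairing g r (wal b (k + κ * b ^ M))‖ +
        ∑ c ∈ Finset.range C, ((b : ℝ) ^ (c + 1))⁻¹ * ∑ l ∈ Finset.Icc 1 (b - 1),
          ‖iterPairing g r (wal b (k + κ * b ^ M + l * b ^ (M + 1 + c)))‖) +
        ((b : ℝ) ^ C)⁻¹ * (2 ^ r * G)) := by
  have e1 : iterPairing g (r + 1) (wal b (k + κ * b ^ M)) =
      iterPairing g r (adjPrim (wal b (k + κ * b ^ M))) := rfl
  have iS : ∀ c, Integrable (fun y => ((b : ℂ) ^ (c + 1))⁻¹ * ∑ l ∈ Finset.Icc 1 (b - 1),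
      digCoef b l * wal b (k + κ * b ^ M + l * b ^ (M + 1 + c)) y) unitMeas := fun c =>
    (integrable_finsetSum _ fun l _ => (integrable_wal b _).const_mul _).const_mul _
  have i1 := (integrable_wal b k).const_mul (-(rootU b ^ κ - 1)⁻¹)
  have i2 := (integrable_wal b (k + κ * b ^ M)).const_mul ((rootU b ^ κ - 1)⁻¹ + 1 / 2)
  have i3 : Integrable (fun y => ∑ c ∈ Finset.range C, ((b : ℂ) ^ (c + 1))⁻¹ *
      ∑ l ∈ Finset.Icc 1 (b - 1),
        digCoef b l * wal b (k + κ * b ^ M + l * b ^ (M + 1 + c)) y) unitMeas :=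
    integrable_finsetSum _ fun c _ => iS c
  have i4 := (integrable_walRem b (k + κ * b ^ M) M C).const_mul ((b : ℂ) ^ C)⁻¹
  have i12 : Integrable (fun y => -(rootU b ^ κ - 1)⁻¹ * wal b k y +
      ((rootU b ^ κ - 1)⁻¹ + 1 / 2) * wal b (k + κ * b ^ M) y) unitMeas := i1.add i2
  have i123 : Integrable (fun y => -(rootU b ^ κ - 1)⁻¹ * wal b k y +
      ((rootU b ^ κ - 1)⁻¹ + 1 / 2) * wal b (k + κ * b ^ M) y +
      ∑ c ∈ Finset.range C, ((b : ℂ) ^ (c + 1))⁻¹ * ∑ l ∈ Finset.Icc 1 (b - 1),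
        digCoef b l * wal b (k + κ * b ^ M + l * b ^ (M + 1 + c)) y) unitMeas := i12.add i3
  have hne := rootU_pow_ne_one b h0 hκ
  have hD : ‖(rootU b ^ κ - 1)⁻¹‖ ≤ (2 * Real.sin (Real.pi / b))⁻¹ := by
    rw [norm_inv]
    exact inv_anti₀ (two_sin_pos b) (two_sin_le_norm_rootU_pow_sub_one b h0 hκ)
  have hB : ‖(rootU b ^ κ - 1)⁻¹ + 1 / 2‖ ≤ (2 * Real.sin (Real.pi / b))⁻¹ := by
    have hne' := sub_ne_zero.2 hne
    have e : (rootU b ^ κ - 1)⁻¹ + 1 / 2 = (rootU b ^ κ - 1)⁻¹ * ((rootU b ^ κ + 1) / 2) := by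
      field_simp; ring
    rw [e, norm_mul]
    refine (mul_le_of_le_one_right (norm_nonneg _) ?_).trans hD
    rw [norm_div, Complex.norm_ofNat, div_le_one (by norm_num)]
    refine (norm_add_le _ _).trans ?_
    rw [norm_rootU_pow, norm_one]; norm_num
  rw [e1, iterPairing_congr (fun t ht => adjPrim_wal b hk h0 hκ C ht), iterPairing_smul,
    iterPairing_add hgm hgG i123 i4, iterPairing_add hgm hgG i12 i3,
    iterPairing_add hgm hgG i1 i2, iterPairing_smul, iterPairing_smul, iterPairing_smul,
    iterPairing_sum hgm hgG _ iS]
  simp_rw [iterPairing_smul]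
  simp_rw [iterPairing_sum hgm hgG _ fun l => (integrable_wal b _).const_mul (digCoef b l)]
  simp_rw [iterPairing_smul]
  rw [norm_mul, norm_neg, norm_inv, norm_pow, Complex.norm_natCast]
  gcongr
  have hsum : ‖∑ c ∈ Finset.range C, ((b : ℂ) ^ (c + 1))⁻¹ * ∑ l ∈ Finset.Icc 1 (b - 1),
      digCoef b l * iterPairing g r (wal b (k + κ * b ^ M + l * b ^ (M + 1 + c)))‖ ≤
      (2 * Real.sin (Real.pi / b))⁻¹ * ∑ c ∈ Finset.range C, ((b : ℝ) ^ (c + 1))⁻¹ *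
        ∑ l ∈ Finset.Icc 1 (b - 1),
          ‖iterPairing g r (wal b (k + κ * b ^ M + l * b ^ (M + 1 + c)))‖ := by
    rw [Finset.mul_sum]
    refine (norm_sum_le _ _).trans (Finset.sum_le_sum fun c _ => ?_)
    rw [norm_mul, norm_inv, norm_pow, Complex.norm_natCast, mul_left_comm]
    gcongr
    rw [Finset.mul_sum]
    refine (norm_sum_le _ _).trans (Finset.sum_le_sum fun l hl => ?_)
    rw [Finset.mem_Icc] at hl
    rw [norm_mul]
    gcongr
    exact norm_digCoef_le b (by omega) (by omega)
  calc _ ≤ _ := norm_add_le _ _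
    _ ≤ _ := by
      refine add_le_add ?_ ?_
      · refine (norm_add₃_le).trans ?_
        rw [mul_add, mul_add, norm_mul, norm_mul, norm_neg]
        gcongr
      · rw [norm_mul, norm_inv, norm_pow, Complex.norm_natCast]
        gcongr
        exact norm_iterPairing_le hgG (integrable_walRem b _ M C)
          (fun t ht => norm_walRem_le b _ M C ht.1) r

include hgm hgG in
/-- The recursion in the limit of all digits, where the remainder disappears. -/
lemma norm_iterPairing_succ_wal_le_of_sum_le {k M κ : ℕ} (hk : k < b ^ M) (h0 : 0 < κ)
    (hκ : κ < b) (r : ℕ) {S : ℝ}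
    (hS : ∀ C, ∑ c ∈ Finset.range C, ((b : ℝ) ^ (c + 1))⁻¹ * ∑ l ∈ Finset.Icc 1 (b - 1),
          ‖iterPairing g r (wal b (k + κ * b ^ M + l * b ^ (M + 1 + c)))‖ ≤ S) :
    ‖iterPairing g (r + 1) (wal b (k + κ * b ^ M))‖ ≤
      ((b : ℝ) ^ (M + 1))⁻¹ * ((2 * Real.sin (Real.pi / b))⁻¹ * (‖iterPairing g r (wal b k)‖ +
        ‖iterPairing g r (wal b (k + κ * b ^ M))‖ + S)) := by
  have hb1 : (1 : ℝ) < b := by exact_mod_cast one_lt_base b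
  have hlim : Filter.Tendsto (fun C : ℕ => ((b : ℝ) ^ (M + 1))⁻¹ *
      ((2 * Real.sin (Real.pi / b))⁻¹ * (‖iterPairing g r (wal b k)‖ +
        ‖iterPairing g r (wal b (k + κ * b ^ M))‖ + S) + ((b : ℝ) ^ C)⁻¹ * (2 ^ r * G)))
      Filter.atTop (nhds (((b : ℝ) ^ (M + 1))⁻¹ *
      ((2 * Real.sin (Real.pi / b))⁻¹ * (‖iterPairing g r (wal b k)‖ +
        ‖iterPairing g r (wal b (k + κ * b ^ M))‖ + S) + 0 * (2 ^ r * G)))) := by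
    refine Filter.Tendsto.const_mul _ (Filter.Tendsto.const_add _ (Filter.Tendsto.mul_const _ ?_))
    exact (tendsto_inv_atTop_zero).comp (tendsto_pow_atTop_atTop_of_one_lt hb1)
  rw [zero_mul, add_zero] at hlim
  refine ge_of_tendsto' hlim fun C => (norm_iterPairing_succ_wal_le b hgm hgG hk h0 hκ r C).trans ?_
  have := two_sin_pos b
  gcongr
  exact hS C

end iterPairing

end WalshBound

section Weights

variable (b : ℕ)

/-! ### Digit weights -/

/-- The position, counted from `1`, of the leading base `b` digit of `k ≠ 0`. -/
def topPos (k : ℕ) : ℕ := Nat.log b k + 1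

/-- `k` without its leading base `b` digit. -/
def lowPart (k : ℕ) : ℕ := k % b ^ Nat.log b k

lemma lowPart_lt_pow (k : ℕ) : lowPart b k < b ^ Nat.log b k :=
  Nat.mod_lt _ (by
    rcases Nat.eq_zero_or_pos b with rfl | hb
    · simp
    · exact pow_pos hb _)

lemma lt_pow_succ_of_digit {k M κ : ℕ} (hk : k < b ^ M) (hκ : κ < b) :
    k + κ * b ^ M < b ^ (M + 1) := by
  rw [pow_succ]
  nlinarith [Nat.mul_le_mul_right (b ^ M) (Nat.succ_le_of_lt hκ)]

@[simp] lemma lowPart_zero : lowPart b 0 = 0 := by simp [lowPart]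

lemma lowPart_lt {k : ℕ} (hk : k ≠ 0) : lowPart b k < k :=
  (lowPart_lt_pow b k).trans_le (Nat.pow_log_le_self b hk)

/-- The exponent that governs the decay of the `τ`-fold primitive of the `k`-th Walsh function:
the leading positions of the nonzero digits of `k` are summed, and the last one is repeated
until `τ` summands are reached. -/
def primWeight : ℕ → ℕ → ℕ
  | 0, _ => 0
  | τ + 1, k => if lowPart b k = 0 then (τ + 1) * topPos b k
      else topPos b k + primWeight τ (lowPart b k)

lemma primWeight_of_lowPart_eq_zero {k : ℕ} (h : lowPart b k = 0) (τ : ℕ) :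
    primWeight b τ k = τ * topPos b k := by
  cases τ with
  | zero => simp [primWeight]
  | succ τ => rw [primWeight, if_pos h]

lemma primWeight_succ_of_lowPart_ne_zero {k : ℕ} (h : lowPart b k ≠ 0) (τ : ℕ) :
    primWeight b (τ + 1) k = topPos b k + primWeight b τ (lowPart b k) := by
  rw [primWeight, if_neg h]

/-- The number of nonzero base `b` digits. -/
def digitCount (k : ℕ) : ℕ :=
  if h : k = 0 then 0 else digitCount (lowPart b k) + 1
termination_by k
decreasing_by exact lowPart_lt b h

@[simp] lemma digitCount_zero : digitCount b 0 = 0 := by rw [digitCount]; simp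

lemma digitCount_of_ne_zero {k : ℕ} (hk : k ≠ 0) :
    digitCount b k = digitCount b (lowPart b k) + 1 := by
  rw [digitCount, dif_neg hk]

/-- The sum of the `α` largest positions (counted from `1`) of nonzero base `b` digits. -/
def topWeight : ℕ → ℕ → ℕ
  | 0, _ => 0
  | α + 1, k => if k = 0 then 0 else topPos b k + topWeight α (lowPart b k)

@[simp] lemma topWeight_zero_right (α : ℕ) : topWeight b α 0 = 0 := by cases α <;> simp [topWeight]

lemma topWeight_succ {k : ℕ} (hk : k ≠ 0) (α : ℕ) :
    topWeight b (α + 1) k = topPos b k + topWeight b α (lowPart b k) := by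
  rw [topWeight, if_neg hk]

lemma log_add_mul_pow {k M κ : ℕ} (hk : k < b ^ M) (h0 : 0 < κ) (hκ : κ < b) :
    Nat.log b (k + κ * b ^ M) = M := by
  refine Nat.log_eq_of_pow_le_of_lt_pow ?_ (lt_pow_succ_of_digit b hk hκ)
  nlinarith [Nat.mul_le_mul_right (b ^ M) h0]

lemma lowPart_add_mul_pow {k M κ : ℕ} (hk : k < b ^ M) (h0 : 0 < κ) (hκ : κ < b) :
    lowPart b (k + κ * b ^ M) = k := by
  rw [lowPart, log_add_mul_pow b hk h0 hκ, Nat.add_mul_mod_self_right, Nat.mod_eq_of_lt hk]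

lemma topPos_add_mul_pow {k M κ : ℕ} (hk : k < b ^ M) (h0 : 0 < κ) (hκ : κ < b) :
    topPos b (k + κ * b ^ M) = M + 1 := by rw [topPos, log_add_mul_pow b hk h0 hκ]

lemma topPos_lowPart_lt {k : ℕ} (h : lowPart b k ≠ 0) : topPos b (lowPart b k) < topPos b k := by
  rw [topPos, topPos]
  have := Nat.log_lt_of_lt_pow h (lowPart_lt_pow b k)
  omega

lemma primWeight_one (k : ℕ) : primWeight b 1 k = topPos b k := by
  by_cases h : lowPart b k = 0
  · rw [primWeight_of_lowPart_eq_zero b h, one_mul]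
  · rw [primWeight_succ_of_lowPart_ne_zero b h, primWeight, add_zero]

lemma primWeight_succ_le (τ k : ℕ) : primWeight b (τ + 1) k ≤ topPos b k + primWeight b τ k := by
  induction τ generalizing k with
  | zero => rw [zero_add, primWeight_one]; exact Nat.le_add_right _ _
  | succ τ ih =>
    by_cases h : lowPart b k = 0
    · rw [primWeight_of_lowPart_eq_zero b h, primWeight_of_lowPart_eq_zero b h]
      exact le_of_eq (by ring)
    · rw [primWeight_succ_of_lowPart_ne_zero b h, primWeight_succ_of_lowPart_ne_zero b h]
      have := ih (lowPart b k)
      have := topPos_lowPart_lt b h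
      omega

lemma primWeight_lowPart_lt {k : ℕ} (h : lowPart b k ≠ 0) (τ : ℕ) :
    primWeight b (τ + 1) (lowPart b k) < primWeight b (τ + 1) k := by
  rw [primWeight_succ_of_lowPart_ne_zero b h]
  have := primWeight_succ_le b τ (lowPart b k)
  have := topPos_lowPart_lt b h
  omega

lemma digitCount_pos {k : ℕ} (hk : k ≠ 0) : 0 < digitCount b k := by
  rw [digitCount_of_ne_zero b hk]; exact Nat.succ_pos _

lemma topWeight_le_primWeight (α k : ℕ) : topWeight b α k ≤ primWeight b α k := by
  induction α generalizing k with
  | zero => simp [topWeight]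
  | succ α ih =>
    rcases eq_or_ne k 0 with rfl | hk
    · simp
    rw [topWeight_succ b hk]
    by_cases h : lowPart b k = 0
    · rw [primWeight_of_lowPart_eq_zero b h, h, topWeight_zero_right, add_zero]
      exact Nat.le_mul_of_pos_left _ (Nat.succ_pos _)
    · rw [primWeight_succ_of_lowPart_ne_zero b h]
      exact Nat.add_le_add_left (ih _) _

/-- If `k` has at most `r` nonzero digits, then each further summand of `primWeight` adds at least
one. -/
lemma topWeight_add_le_primWeight {α r k : ℕ} (h1 : digitCount b k ≤ r) (h2 : r ≤ α) :
    topWeight b α k + (r - digitCount b k) ≤ primWeight b r k := by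
  induction r generalizing α k with
  | zero =>
    have : k = 0 := by
      by_contra h; have := digitCount_pos b h; omega
    subst this; simp
  | succ r ih =>
    rcases eq_or_ne k 0 with rfl | hk
    · rw [primWeight_of_lowPart_eq_zero b (lowPart_zero b)]
      simp [topPos]
    obtain ⟨α, rfl⟩ : ∃ a, α = a + 1 := ⟨α - 1, by omega⟩
    rw [topWeight_succ b hk]
    rw [digitCount_of_ne_zero b hk] at h1 ⊢
    by_cases h : lowPart b k = 0
    · rw [primWeight_of_lowPart_eq_zero b h, h, topWeight_zero_right, digitCount_zero]
      have : r ≤ r * topPos b k := Nat.le_mul_of_pos_right _ (Nat.succ_pos _)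
      rw [add_mul]; omega
    · rw [primWeight_succ_of_lowPart_ne_zero b h]
      have := ih (α := α) (k := lowPart b k) (by omega) (by omega)
      omega

variable [Fact b.Prime]

lemma lt_pow_topPos (k : ℕ) : k < b ^ topPos b k := Nat.lt_pow_succ_log_self (one_lt_base b) k

lemma exists_eq_lowPart_add {k : ℕ} (hk : k ≠ 0) :
    ∃ κ, 0 < κ ∧ κ < b ∧ k = lowPart b k + κ * b ^ Nat.log b k := by
  refine ⟨k / b ^ Nat.log b k, Nat.div_pos (Nat.pow_log_le_self b hk) (pow_pos (base_pos b) _), ?_,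
    ?_⟩
  · rw [Nat.div_lt_iff_lt_mul (pow_pos (base_pos b) _), mul_comm, ← pow_succ]
    exact lt_pow_topPos b k
  · rw [lowPart, mul_comm]
    exact (Nat.mod_add_div _ _).symm

/-- A new leading digit `c + 1` places above the old one raises the weight by at least `c + 1`. -/
lemma le_primWeight_add_mul_pow {k l c : ℕ} (hk : k ≠ 0) (h0 : 0 < l) (hl : l < b) (τ : ℕ) :
    c + 1 + primWeight b (τ + 1) k ≤ primWeight b (τ + 1) (k + l * b ^ (topPos b k + c)) := by
  have h1 : k < b ^ (topPos b k + c) :=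
    (lt_pow_topPos b k).trans_le (Nat.pow_le_pow_right (base_pos b) (Nat.le_add_right _ _))
  have h2 := lowPart_add_mul_pow b h1 h0 hl
  rw [primWeight_succ_of_lowPart_ne_zero b (k := k + l * b ^ (topPos b k + c)) (by rwa [h2]), h2,
    topPos_add_mul_pow b h1 h0 hl]
  have := primWeight_succ_le b τ k
  omega

end Weights

section Decay

variable (b : ℕ) [Fact b.Prime]

/-! ### Decay of the iterated primitives of Walsh functions -/

/-- The factor `θ_b / (2 sin(π/b))` picked up with each further primitive. -/
def stepConst : ℝ :=
  (1 + 1 / (b : ℝ) + 1 / ((b : ℝ) * (b + 1))) / (2 * Real.sin (Real.pi / b))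

lemma sum_inv_pow_le (C : ℕ) :
    ∑ c ∈ Finset.range C, ((b : ℝ) ^ (c + 1))⁻¹ * ((b - 1) * ((b : ℝ) ^ (c + 1))⁻¹) ≤
      1 / ((b : ℝ) + 1) := by
  have hb : (1 : ℝ) < b := by exact_mod_cast one_lt_base b
  have hb0 := base_pos_real b
  have h : ∑ c ∈ Finset.range C, ((b : ℝ) ^ (c + 1))⁻¹ * ((b - 1) * ((b : ℝ) ^ (c + 1))⁻¹) =
      1 / ((b : ℝ) + 1) * (1 - ((b : ℝ) ^ C)⁻¹ ^ 2) := by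
    induction C with
    | zero => simp
    | succ C ih =>
      rw [Finset.sum_range_succ, ih, pow_succ]
      field_simp
      ring
  rw [h]
  exact mul_le_of_le_one_right (by positivity) (by nlinarith [sq_nonneg ((b : ℝ) ^ C)⁻¹])

section

variable {g : ℝ → ℂ} {G : ℝ}

lemma iterPairing_succ_wal_zero (r : ℕ) : iterPairing g (r + 1) (wal b 0) = 0 := by
  have h1 : iterPairing g (r + 1) (wal b 0) = iterPairing g r (adjPrim (wal b 0)) := rfl
  rw [h1, iterPairing_congr (H := fun t => (0 : ℂ) * wal b 0 t) (fun t ht => ?_),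
    iterPairing_smul, zero_mul]
  rw [zero_mul, show wal b 0 = fun _ => (1 : ℂ) from funext (wal_zero b), adjPrim_const]

/-- One more integration multiplies the bound by `stepConst b` and raises the weight. -/
lemma norm_iterPairing_step (hgm : AEStronglyMeasurable g unitMeas)
    (hgG : ∀ x ∈ Set.Ico (0 : ℝ) 1, ‖g x‖ ≤ G) {B : ℝ} {r : ℕ}
    (hB : ∀ k, k ≠ 0 → ‖iterPairing g (r + 1) (wal b k)‖ ≤ B * ((b : ℝ) ^ primWeight b (r + 1) k)⁻¹)
    {k : ℕ} (hk : k ≠ 0) :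
    ‖iterPairing g (r + 2) (wal b k)‖ ≤
      B * stepConst b * ((b : ℝ) ^ primWeight b (r + 2) k)⁻¹ := by
  have hb := base_pos_real b
  have hb1 : (1 : ℝ) ≤ b := by exact_mod_cast (one_lt_base b).le
  have hc := two_sin_pos b
  obtain ⟨κ, h0, hκ, hkκ⟩ := exists_eq_lowPart_add b hk
  -- The terms with an additional higher digit gain a factor `b^{-(c+1)}` from their weight.
  have hB0 : 0 ≤ B := by
    have h1 := (norm_nonneg _).trans (hB k hk)
    exact nonneg_of_mul_nonneg_left h1 (by positivity)
  have hS : ∀ C, ∑ c ∈ Finset.range C, ((b : ℝ) ^ (c + 1))⁻¹ * ∑ l ∈ Finset.Icc 1 (b - 1),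
      ‖iterPairing g (r + 1) (wal b (lowPart b k + κ * b ^ Nat.log b k +
        l * b ^ (Nat.log b k + 1 + c)))‖ ≤
      B * ((b : ℝ) ^ primWeight b (r + 1) k)⁻¹ * (1 / ((b : ℝ) + 1)) := by
    intro C
    refine le_trans ?_ (mul_le_mul_of_nonneg_left (sum_inv_pow_le b C) (by positivity))
    rw [Finset.mul_sum]
    refine Finset.sum_le_sum fun c _ => ?_
    rw [mul_left_comm]
    gcongr
    have hterm : ∀ l ∈ Finset.Icc 1 (b - 1), ‖iterPairing g (r + 1) (wal b (lowPart b k +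
        κ * b ^ Nat.log b k + l * b ^ (Nat.log b k + 1 + c)))‖ ≤
        B * ((b : ℝ) ^ primWeight b (r + 1) k)⁻¹ * ((b : ℝ) ^ (c + 1))⁻¹ := by
      intro l hl
      rw [Finset.mem_Icc] at hl
      rw [← hkκ]
      refine (hB _ (by omega)).trans ?_
      rw [mul_assoc, ← mul_inv, ← pow_add]
      gcongr B * (?_)⁻¹
      refine pow_le_pow_right₀ hb1 ?_
      rw [add_comm]
      exact le_primWeight_add_mul_pow b hk (by omega) (by omega) r
    refine (Finset.sum_le_sum hterm).trans (le_of_eq ?_)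
    rw [Finset.sum_const, Nat.card_Icc, nsmul_eq_mul, Nat.add_sub_cancel,
      Nat.cast_sub (base_pos b)]
    push_cast
    ring
  have hmain := norm_iterPairing_succ_wal_le_of_sum_le b hgm hgG (lowPart_lt_pow b k) h0 hκ (r + 1)
    hS
  rw [← hkκ] at hmain
  refine hmain.trans ?_
  rw [stepConst]
  by_cases h : lowPart b k = 0
  · rw [h, iterPairing_succ_wal_zero, norm_zero, zero_add]
    have h1 := hB k hk
    rw [primWeight_of_lowPart_eq_zero b h] at h1 ⊢
    rw [primWeight_of_lowPart_eq_zero b h, add_mul (r + 1) 1, one_mul, pow_add _ _ (topPos b k)]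
    have h2 : ‖iterPairing g (r + 1) (wal b k)‖ +
        B * ((b : ℝ) ^ ((r + 1) * topPos b k))⁻¹ * (1 / ((b : ℝ) + 1)) ≤
        B * ((b : ℝ) ^ ((r + 1) * topPos b k))⁻¹ *
          (1 + 1 / (b : ℝ) + 1 / ((b : ℝ) * (b + 1))) := by
      have h3 : 1 / ((b : ℝ) + 1) ≤ 1 / (b : ℝ) := one_div_le_one_div_of_le hb (by linarith)
      have h4 : 0 ≤ 1 / ((b : ℝ) * (b + 1)) := by positivity
      have h5 : 0 ≤ B * ((b : ℝ) ^ ((r + 1) * topPos b k))⁻¹ := by positivity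
      nlinarith [mul_le_mul_of_nonneg_left h3 h5, mul_nonneg h5 h4]
    calc _ ≤ ((b : ℝ) ^ topPos b k)⁻¹ * ((2 * Real.sin (Real.pi / b))⁻¹ *
          (B * ((b : ℝ) ^ ((r + 1) * topPos b k))⁻¹ *
          (1 + 1 / (b : ℝ) + 1 / ((b : ℝ) * (b + 1))))) := by
          rw [topPos] at h2 ⊢
          gcongr
      _ = _ := by rw [mul_inv]; ring
  · rw [primWeight_succ_of_lowPart_ne_zero b h (r + 1), pow_add _ (topPos b k)]
    have h1 := hB _ h
    -- The term without the leading digit dominates; the others are smaller by a factor `1/b`.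
    have h2 : ((b : ℝ) ^ primWeight b (r + 1) k)⁻¹ ≤
        ((b : ℝ) ^ primWeight b (r + 1) (lowPart b k))⁻¹ * (1 / b) := by
      rw [one_div, ← mul_inv, ← pow_succ]
      exact inv_anti₀ (by positivity) (pow_le_pow_right₀ hb1 (primWeight_lowPart_lt b h r))
    have h3 : ‖iterPairing g (r + 1) (wal b (lowPart b k))‖ + ‖iterPairing g (r + 1) (wal b k)‖ +
        B * ((b : ℝ) ^ primWeight b (r + 1) k)⁻¹ * (1 / ((b : ℝ) + 1)) ≤
        B * ((b : ℝ) ^ primWeight b (r + 1) (lowPart b k))⁻¹ *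
          (1 + 1 / (b : ℝ) + 1 / ((b : ℝ) * (b + 1))) := by
      have h4 := hB k hk
      have h5 : 0 ≤ 1 / ((b : ℝ) + 1) := by positivity
      have h6 := mul_le_mul_of_nonneg_left h2 hB0
      have h7 := mul_le_mul_of_nonneg_right h6 h5
      have h8 : B * ((b : ℝ) ^ primWeight b (r + 1) (lowPart b k))⁻¹ *
          (1 + 1 / (b : ℝ) + 1 / ((b : ℝ) * (b + 1))) =
          B * ((b : ℝ) ^ primWeight b (r + 1) (lowPart b k))⁻¹ +
          B * (((b : ℝ) ^ primWeight b (r + 1) (lowPart b k))⁻¹ * (1 / b)) +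
          B * (((b : ℝ) ^ primWeight b (r + 1) (lowPart b k))⁻¹ * (1 / b)) *
            (1 / ((b : ℝ) + 1)) := by
        rw [← one_div_mul_one_div]; ring
      linarith
    calc _ ≤ ((b : ℝ) ^ topPos b k)⁻¹ * ((2 * Real.sin (Real.pi / b))⁻¹ *
          (B * ((b : ℝ) ^ primWeight b (r + 1) (lowPart b k))⁻¹ *
          (1 + 1 / (b : ℝ) + 1 / ((b : ℝ) * (b + 1))))) := by
          rw [topPos]
          gcongr
      _ = _ := by rw [mul_inv]; ring

lemma norm_iterPairing_iterate_step (hgm : AEStronglyMeasurable g unitMeas)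
    (hgG : ∀ x ∈ Set.Ico (0 : ℝ) 1, ‖g x‖ ≤ G) {B : ℝ} {r : ℕ}
    (hB : ∀ k, k ≠ 0 → ‖iterPairing g (r + 1) (wal b k)‖ ≤ B * ((b : ℝ) ^ primWeight b (r + 1) k)⁻¹)
    (n : ℕ) {k : ℕ} (hk : k ≠ 0) :
    ‖iterPairing g (r + n + 1) (wal b k)‖ ≤
      B * stepConst b ^ n * ((b : ℝ) ^ primWeight b (r + n + 1) k)⁻¹ := by
  induction n generalizing k with
  | zero => simpa using hB k hk
  | succ n ih =>
    have := norm_iterPairing_step b hgm hgG (r := r + n) (fun k hk => ih hk) hk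
    rw [pow_succ, ← mul_assoc]
    exact this

end

/-! ### Mean values of the iterated primitives -/

/-- The mean value of the `τ`-fold primitive of the `k`-th Walsh function. -/
def primMean (τ k : ℕ) : ℂ := iterPairing (fun _ => 1) τ (wal b k)

lemma primMean_eq (τ k : ℕ) : primMean b τ k = ∫ y, adjPrim^[τ] (wal b k) y ∂unitMeas := by
  simp [primMean, iterPairing]

lemma primMean_zero {k : ℕ} (hk : k ≠ 0) : primMean b 0 k = 0 := by
  obtain ⟨κ, h0, hκ, hkκ⟩ := exists_eq_lowPart_add b hk
  rw [primMean_eq, hkκ]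
  rw [Function.iterate_zero, id, integral_unitMeas]
  exact integral_wal b (lowPart_lt_pow b k) h0 hκ

lemma norm_primMean_succ_le {k : ℕ} (hk : k ≠ 0) (τ : ℕ)
    (h : ∀ l ∈ Finset.Icc 1 (b - 1), ∀ c, primMean b τ (k + l * b ^ (topPos b k + c)) = 0) :
    ‖primMean b (τ + 1) k‖ ≤ ((b : ℝ) ^ topPos b k)⁻¹ * ((2 * Real.sin (Real.pi / b))⁻¹ *
      (‖primMean b τ (lowPart b k)‖ + ‖primMean b τ k‖)) := by
  obtain ⟨κ, h0, hκ, hkκ⟩ := exists_eq_lowPart_add b hk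
  have hmain := norm_iterPairing_succ_wal_le_of_sum_le b (g := fun _ => 1) (G := 1) (S := 0)
    aestronglyMeasurable_const (fun _ _ => by simp) (lowPart_lt_pow b k) h0 hκ τ
    (fun C => by
      refine le_of_eq (Finset.sum_eq_zero fun c _ => ?_)
      rw [Finset.sum_eq_zero, mul_zero]
      intro l hl
      rw [← hkκ]
      exact norm_eq_zero.2 (h l hl c))
  rw [← hkκ, add_zero] at hmain
  exact hmain

lemma lowPart_add_higher_digit {k l : ℕ} (hl : l ∈ Finset.Icc 1 (b - 1)) (c : ℕ) :
    k + l * b ^ (topPos b k + c) ≠ 0 ∧ lowPart b (k + l * b ^ (topPos b k + c)) = k := by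
  rw [Finset.mem_Icc] at hl
  have h1 : k < b ^ (topPos b k + c) :=
    (lt_pow_topPos b k).trans_le (Nat.pow_le_pow_right (base_pos b) (Nat.le_add_right _ _))
  have h2 : 0 < l * b ^ (topPos b k + c) := Nat.mul_pos hl.1 (pow_pos (base_pos b) _)
  exact ⟨by omega, lowPart_add_mul_pow b h1 hl.1 (by omega)⟩

/-- Fewer primitives than nonzero digits cannot remove all digits, which is needed for a nonzero
mean. -/
lemma primMean_eq_zero {τ k : ℕ} (h : τ < digitCount b k) : primMean b τ k = 0 := by
  induction τ generalizing k with
  | zero =>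
    refine primMean_zero b ?_
    rintro rfl
    simp at h
  | succ τ ih =>
    have hk : k ≠ 0 := by rintro rfl; simp at h
    have h1 := norm_primMean_succ_le b hk τ (fun l hl c => ih (by
      obtain ⟨h2, h3⟩ := lowPart_add_higher_digit b (k := k) hl c
      rw [digitCount_of_ne_zero b h2, h3]; omega))
    rw [ih (k := k) (by omega), ih (k := lowPart b k) (by
      rw [digitCount_of_ne_zero b hk] at h; omega)] at h1
    simpa using h1

lemma norm_primMean_one_le (k : ℕ) (hk : k ≠ 0) :
    ‖primMean b 1 k‖ ≤ (2 * Real.sin (Real.pi / b))⁻¹ * ((b : ℝ) ^ primWeight b 1 k)⁻¹ := by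
  have hc := two_sin_pos b
  have hb := base_pos_real b
  have h1 := norm_primMean_succ_le b hk 0 (fun l hl c =>
    primMean_zero b (lowPart_add_higher_digit b hl c).1)
  rw [zero_add, primMean_zero b hk, norm_zero, add_zero] at h1
  have h2 : ‖primMean b 0 (lowPart b k)‖ ≤ 1 := by
    by_cases h : lowPart b k = 0
    · rw [primMean_eq, h]; simp
    · rw [primMean_zero b h]; simp
  rw [primWeight_one]
  calc _ ≤ _ := h1
    _ ≤ ((b : ℝ) ^ topPos b k)⁻¹ * ((2 * Real.sin (Real.pi / b))⁻¹ * 1) := by gcongr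
    _ = _ := by ring

/-- For two primitives only one of the two terms of the recursion survives, whence no factor
`θ_b`. -/
lemma norm_primMean_two_le (k : ℕ) (hk : k ≠ 0) :
    ‖primMean b 2 k‖ ≤ constC b 2 * ((b : ℝ) ^ primWeight b 2 k)⁻¹ := by
  have hc := two_sin_pos b
  have hb := base_pos_real b
  have h1 := norm_primMean_succ_le b hk 1 (fun l hl c => by
    obtain ⟨h2, h3⟩ := lowPart_add_higher_digit b (k := k) hl c
    refine primMean_eq_zero b ?_
    rw [digitCount_of_ne_zero b h2, h3]
    have := digitCount_pos b hk
    omega)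
  have hC : constC b 2 = (2 * Real.sin (Real.pi / b))⁻¹ * (2 * Real.sin (Real.pi / b))⁻¹ := by
    rw [constC, if_neg (by norm_num), Nat.sub_self, pow_zero, one_div, sq, mul_inv]
  have hone := norm_primMean_one_le b
  rw [hC]
  refine h1.trans ?_
  have he : 0 ≤ (2 * Real.sin (Real.pi / b))⁻¹ := inv_nonneg.2 hc.le
  generalize (2 * Real.sin (Real.pi / b))⁻¹ = e at *
  by_cases h : lowPart b k = 0
  · have h2 := hone k hk
    have h3 : primMean b 1 0 = 0 := iterPairing_succ_wal_zero b 0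
    rw [primWeight_of_lowPart_eq_zero b h] at h2 ⊢
    rw [h, h3, norm_zero, zero_add, two_mul, pow_add, mul_inv]
    rw [one_mul] at h2
    calc _ ≤ ((b : ℝ) ^ topPos b k)⁻¹ * (e * (e * ((b : ℝ) ^ topPos b k)⁻¹)) := by gcongr
      _ = _ := by ring
  · have h2 := hone _ h
    have h3 : primMean b 1 k = 0 := primMean_eq_zero b (by
      rw [digitCount_of_ne_zero b hk]
      have := digitCount_pos b h
      omega)
    rw [primWeight_succ_of_lowPart_ne_zero b h, h3, norm_zero, add_zero, pow_add, mul_inv]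
    calc _ ≤ ((b : ℝ) ^ topPos b k)⁻¹ * (e * (e *
          ((b : ℝ) ^ primWeight b 1 (lowPart b k))⁻¹)) := by gcongr
      _ = _ := by ring

lemma norm_primMean_le {τ k : ℕ} (hτ : 1 ≤ τ) (hk : k ≠ 0) :
    ‖primMean b τ k‖ ≤ constC b τ * ((b : ℝ) ^ primWeight b τ k)⁻¹ := by
  rcases hτ.eq_or_lt with rfl | hτ
  · rw [constC, if_pos rfl]; exact norm_primMean_one_le b k hk
  · obtain ⟨n, rfl⟩ : ∃ n, τ = 1 + n + 1 := ⟨τ - 2, by omega⟩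
    have h := norm_iterPairing_iterate_step b (g := fun _ => 1) (G := 1)
      aestronglyMeasurable_const (fun _ _ => by simp) (r := 1)
      (fun k hk => norm_primMean_two_le b k hk) n hk
    refine h.trans (le_of_eq ?_)
    congr 1
    rw [constC, constC, if_neg (by norm_num), if_neg (by omega), stepConst, div_pow, Nat.sub_self,
      show 1 + n + 1 - 2 = n by omega, show 1 + n + 1 = n + 2 by ring, pow_zero, pow_add]
    have := (two_sin_pos b).ne'
    field_simp

/-! ### The square integral of the iterated primitives -/

lemma integral_walRem_eq_zero {k M κ : ℕ} (hk : k < b ^ M) (h0 : 0 < κ) (hκ : κ < b) :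
    ∫ y, walRem b (k + κ * b ^ M) M 0 y ∂unitMeas = 0 := by
  have hb := base_pos b
  have hbC : (b : ℂ) ≠ 0 := Nat.cast_ne_zero.2 hb.ne'
  have hlt := lt_pow_succ_of_digit b hk hκ
  have h1 : ∀ C, ∫ y, walRem b (k + κ * b ^ M) M 0 y ∂unitMeas =
      ((b : ℂ) ^ C)⁻¹ * ∫ y, walRem b (k + κ * b ^ M) M C y ∂unitMeas := by
    intro C
    have e : ∀ y ∈ Set.Ico (0 : ℝ) 1, walRem b (k + κ * b ^ M) M 0 y =
        (∑ c ∈ Finset.range C, ((b : ℂ) ^ (c + 1))⁻¹ * ∑ l ∈ Finset.Icc 1 (b - 1),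
          digCoef b l * wal b (k + κ * b ^ M + l * b ^ (M + 1 + c)) y) +
          ((b : ℂ) ^ C)⁻¹ * walRem b (k + κ * b ^ M) M C y := by
      intro y hy
      have h2 := adjPrim_wal b hk h0 hκ C hy
      rw [adjPrim_wal b hk h0 hκ 0 hy] at h2
      have h3 := mul_left_cancel₀ (neg_ne_zero.2 (inv_ne_zero (pow_ne_zero (M + 1) hbC))) h2
      simp only [Finset.range_zero, Finset.sum_empty, pow_zero, inv_one, one_mul, add_zero] at h3
      linear_combination h3
    have iS : ∀ c, Integrable (fun y => ((b : ℂ) ^ (c + 1))⁻¹ * ∑ l ∈ Finset.Icc 1 (b - 1),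
        digCoef b l * wal b (k + κ * b ^ M + l * b ^ (M + 1 + c)) y) unitMeas := fun c =>
      (integrable_finsetSum _ fun l _ => (integrable_wal b _).const_mul _).const_mul _
    rw [integral_congr_ae (ae_unitMeas_of_forall e), integral_add
      (integrable_finsetSum _ fun c _ => iS c) ((integrable_walRem b _ M C).const_mul _),
      integral_finsetSum _ fun c _ => iS c, integral_const_mul, Finset.sum_eq_zero, zero_add]
    intro c _
    rw [integral_const_mul, integral_finsetSum _ fun l _ => (integrable_wal b _).const_mul _,
      Finset.sum_eq_zero, mul_zero]
    intro l hl
    rw [Finset.mem_Icc] at hl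
    rw [integral_const_mul, integral_unitMeas, integral_wal b (hlt.trans_le
      (Nat.pow_le_pow_right hb (Nat.le_add_right _ c))) hl.1 (by omega), mul_zero]
  have hb1 : (1 : ℝ) < b := by exact_mod_cast one_lt_base b
  have hlim : Filter.Tendsto (fun C : ℕ => ((b : ℝ) ^ C)⁻¹) Filter.atTop (nhds 0) :=
    (tendsto_inv_atTop_zero).comp (tendsto_pow_atTop_atTop_of_one_lt hb1)
  refine norm_le_zero_iff.1 (ge_of_tendsto' hlim fun C => ?_)
  rw [h1 C, norm_mul, norm_inv, norm_pow, Complex.norm_natCast]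
  refine mul_le_of_le_one_right (by positivity) ((norm_integral_le_integral_norm _).trans
    (integral_unitMeas_le_of_forall (fun _ _ => norm_nonneg _) fun t ht =>
      norm_walRem_le b _ M C ht.1))

end Decay

section SquareIntegral

variable (b : ℕ) [Fact b.Prime]

/-- The image of a Walsh function is, up to a factor of modulus `b^{-topPos k}`, the difference of a
function `Q` of mean zero and a constant `D` with `|Q| ≤ |D|`, so that its square integral is at
most `2 |D|²`. -/
lemma integral_norm_sq_adjPrim_wal_le {k : ℕ} (hk : k ≠ 0) :
    ∫ y, ‖adjPrim (wal b k) y‖ ^ 2 ∂unitMeas ≤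
      2 * (2 * Real.sin (Real.pi / b))⁻¹ ^ 2 * ((b : ℝ) ^ topPos b k)⁻¹ ^ 2 := by
  have hb := base_pos_real b
  obtain ⟨κ, h0, hκ, hkκ⟩ := exists_eq_lowPart_add b hk
  have hk' := lowPart_lt_pow b k
  set M := Nat.log b k with hM
  set D : ℂ := (rootU b ^ κ - 1)⁻¹ with hDdef
  have hne' : rootU b ^ κ - 1 ≠ 0 := sub_ne_zero.2 (rootU_pow_ne_one b h0 hκ)
  have hD : ‖D‖ ≤ (2 * Real.sin (Real.pi / b))⁻¹ := by
    rw [norm_inv]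
    exact inv_anti₀ (two_sin_pos b) (two_sin_le_norm_rootU_pow_sub_one b h0 hκ)
  have hD1 : ‖D + 1‖ = ‖D‖ := by
    have e : D + 1 = rootU b ^ κ * D := by rw [hDdef]; field_simp; ring
    rw [e, norm_mul, norm_rootU_pow, one_mul]
  have hpos : (0 : ℕ) < b ^ M := pow_pos (base_pos b) M
  -- The part of the image that is orthogonal to the Walsh function of `lowPart k`, divided by it.
  set Q : ℝ → ℂ := fun y => (D + 1 / 2) * wal b (0 + κ * b ^ M) y +
    walRem b (0 + κ * b ^ M) M 0 y with hQ
  have iQ : Integrable Q unitMeas :=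
    ((integrable_wal b _).const_mul _).add (integrable_walRem b _ M 0)
  have hQ0 : ∫ y, Q y ∂unitMeas = 0 := by
    rw [hQ, integral_add ((integrable_wal b _).const_mul _) (integrable_walRem b _ M 0),
      integral_const_mul, integral_walRem_eq_zero b hpos h0 hκ, integral_unitMeas,
      integral_wal b hpos h0 hκ, mul_zero, add_zero]
  have hQn : ∀ y ∈ Set.Ico (0 : ℝ) 1, ‖Q y‖ ≤ ‖D‖ := by
    intro y hy
    set t : ℝ := y * b ^ (M + 1 + 0) - ⌊y * b ^ (M + 1 + 0)⌋₊ with ht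
    have ht0 : 0 ≤ t := sub_nonneg.2 (Nat.floor_le (mul_nonneg hy.1 (by positivity)))
    have ht1 : t ≤ 1 := by
      have := Nat.lt_floor_add_one (y * (b : ℝ) ^ (M + 1 + 0))
      rw [ht]; linarith
    -- `Q y` lies on the chord between `D` and `D + 1`, which have the same modulus.
    have e : Q y = (((1 - t : ℝ) : ℂ) * D + (t : ℂ) * (D + 1)) * wal b (0 + κ * b ^ M) y := by
      rw [hQ]
      simp only [walRem]
      rw [← ht]
      push_cast
      ring
    rw [e, norm_mul, norm_wal, mul_one]
    refine (norm_add_le _ _).trans (le_of_eq ?_)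
    rw [norm_mul, norm_mul, hD1, Complex.norm_real, Complex.norm_real, Real.norm_of_nonneg ht0,
      Real.norm_of_nonneg (by linarith)]
    ring
  have hpt : ∀ y ∈ Set.Ico (0 : ℝ) 1, ‖adjPrim (wal b k) y‖ ^ 2 ≤
      ((b : ℝ) ^ (M + 1))⁻¹ ^ 2 *
        (2 * ‖D‖ ^ 2 - 2 * ((starRingEnd ℂ) D * Q y).re) := by
    intro y hy
    have e : adjPrim (wal b k) y = -((b : ℂ) ^ (M + 1))⁻¹ *
        (wal b (lowPart b k) y * (Q y - D)) := by
      have h1 := adjPrim_wal b hk' h0 hκ 0 hy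
      rw [← hkκ] at h1
      rw [h1, hQ]
      simp only [walRem]
      have h2 : wal b k y = wal b (lowPart b k) y * wal b (0 + κ * b ^ M) y := by
        rw [hkκ, wal_add_mul_pow b hk' hκ, wal_add_mul_pow b hpos hκ, ← hkκ, wal_zero, one_mul]
      rw [h2]
      simp only [Finset.range_zero, Finset.sum_empty, pow_zero, inv_one]
      ring
    rw [e, norm_mul, norm_mul, norm_wal, one_mul, norm_neg, norm_inv, norm_pow,
      Complex.norm_natCast, mul_pow]
    refine mul_le_mul_of_nonneg_left ?_ (by positivity)
    have h3 := hQn y hy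
    have h4 : ‖Q y - D‖ ^ 2 = ‖Q y‖ ^ 2 + ‖D‖ ^ 2 - 2 * ((starRingEnd ℂ) D * Q y).re := by
      rw [← Complex.normSq_eq_norm_sq, ← Complex.normSq_eq_norm_sq, ← Complex.normSq_eq_norm_sq,
        Complex.normSq_sub, mul_comm ((starRingEnd ℂ) D)]
    rw [h4]
    have h5 : ‖Q y‖ ^ 2 ≤ ‖D‖ ^ 2 := pow_le_pow_left₀ (norm_nonneg _) h3 2
    linarith
  have iR : Integrable (fun y => ((starRingEnd ℂ) D * Q y).re) unitMeas := (iQ.const_mul _).re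
  have hR : ∫ y, ((starRingEnd ℂ) D * Q y).re ∂unitMeas = 0 := by
    have := integral_re (iQ.const_mul ((starRingEnd ℂ) D))
    simp only [RCLike.re_to_complex] at this
    rw [this, integral_const_mul, hQ0, mul_zero, Complex.zero_re]
  calc ∫ y, ‖adjPrim (wal b k) y‖ ^ 2 ∂unitMeas
      ≤ ∫ y, ((b : ℝ) ^ (M + 1))⁻¹ ^ 2 *
        (2 * ‖D‖ ^ 2 - 2 * ((starRingEnd ℂ) D * Q y).re) ∂unitMeas :=
        integral_mono_of_nonneg (Filter.Eventually.of_forall fun y => by positivity)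
          (((integrable_const _).sub (iR.const_mul 2)).const_mul _) (ae_unitMeas_of_forall hpt)
    _ = ((b : ℝ) ^ (M + 1))⁻¹ ^ 2 * (2 * ‖D‖ ^ 2) := by
        rw [integral_const_mul, integral_sub (integrable_const _) (iR.const_mul 2),
          integral_const_mul, integral_const_mul, hR]
        simp
    _ ≤ ((b : ℝ) ^ (M + 1))⁻¹ ^ 2 * (2 * (2 * Real.sin (Real.pi / b))⁻¹ ^ 2) := by gcongr
    _ = _ := by rw [topPos]; ring

lemma constCtilde_eq {α : ℕ} (hα : 1 ≤ α) :
    constCtilde b α = 2 * (2 * Real.sin (Real.pi / b))⁻¹ ^ 2 * (stepConst b ^ (α - 1)) ^ 2 := by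
  obtain ⟨n, rfl⟩ : ∃ n, α = n + 1 := ⟨α - 1, by omega⟩
  have := (two_sin_pos b).ne'
  rw [constCtilde, stepConst, div_pow, Nat.add_sub_cancel, show 2 * (n + 1) - 2 = 2 * n by omega,
    show 2 * (n + 1) = 2 * n + 2 by ring, pow_add, pow_mul', pow_mul']
  field_simp

lemma constCtilde_pos (α : ℕ) : 0 < constCtilde b α := by
  have := two_sin_pos b
  have := base_pos_real b
  unfold constCtilde
  positivity

/-- The square integral of the `α`-fold primitive, by duality: it is the pairing of the primitive
with its own conjugate, to which the decay of the pairings applies. -/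
lemma integral_norm_sq_iterate_adjPrim_wal_le {α k : ℕ} (hα : 1 ≤ α) (hk : k ≠ 0) :
    ∫ y, ‖adjPrim^[α] (wal b k) y‖ ^ 2 ∂unitMeas ≤
      constCtilde b α * ((b : ℝ) ^ primWeight b α k)⁻¹ ^ 2 := by
  have hb := base_pos_real b
  have hc := two_sin_pos b
  have iw := integrable_wal b
  set h : ℝ → ℂ := adjPrim^[α] (wal b k) with hh
  have ih : Integrable h unitMeas := integrable_iterate_adjPrim (iw k) α
  have bdd : ∀ (r : ℕ) (l : ℕ), ∀ y ∈ Set.Ico (0 : ℝ) 1, ‖adjPrim^[r + 1] (wal b l) y‖ ≤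
      2 ^ (r + 1) := fun r l y hy =>
    (norm_iterate_adjPrim_le (iw l) r (Set.Ico_subset_Icc_self hy)).trans
      (mul_le_of_le_one_right (by positivity)
        (integral_unitMeas_le_of_forall (fun _ _ => norm_nonneg _) fun t _ => (norm_wal b l t).le))
  have hbd : ∀ y ∈ Set.Ico (0 : ℝ) 1, ‖h y‖ ≤ 2 ^ α := fun y hy => by
    obtain ⟨n, rfl⟩ : ∃ n, α = n + 1 := ⟨α - 1, by omega⟩
    exact bdd n k y hy
  set g : ℝ → ℂ := fun y => (starRingEnd ℂ) (h y) with hg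
  have hgm : AEStronglyMeasurable g unitMeas :=
    Complex.continuous_conj.comp_aestronglyMeasurable ih.aestronglyMeasurable
  have hgn : ∀ y, ‖g y‖ = ‖h y‖ := fun y => by rw [hg]; exact RCLike.norm_conj _
  have hgG : ∀ y ∈ Set.Ico (0 : ℝ) 1, ‖g y‖ ≤ 2 ^ α := fun y hy => by
    rw [hgn]; exact hbd y hy
  set V : ℝ := ∫ y, ‖h y‖ ^ 2 ∂unitMeas with hV
  have hV0 : 0 ≤ V := integral_nonneg fun y => by positivity
  have memL : ∀ {u : ℝ → ℂ} {U : ℝ}, AEStronglyMeasurable u unitMeas →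
      (∀ y ∈ Set.Ico (0 : ℝ) 1, ‖u y‖ ≤ U) → MemLp (fun y => ‖u y‖) 2 unitMeas := by
    intro u U hu hU
    exact MemLp.of_bound hu.norm U (ae_unitMeas_of_forall fun y hy => by
      rw [norm_norm]; exact hU y hy)
  have hbase : ∀ l, l ≠ 0 → ‖iterPairing g (0 + 1) (wal b l)‖ ≤
      Real.sqrt (2 * V) * (2 * Real.sin (Real.pi / b))⁻¹ *
        ((b : ℝ) ^ primWeight b (0 + 1) l)⁻¹ := by
    intro l hl
    rw [zero_add, primWeight_one]
    rw [← pow_le_pow_iff_left₀ (norm_nonneg _) (by positivity) two_ne_zero]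
    have h1 : ‖iterPairing g 1 (wal b l)‖ ≤ ∫ y, ‖adjPrim (wal b l) y‖ * ‖g y‖ ∂unitMeas := by
      refine (norm_integral_le_integral_norm _).trans (le_of_eq ?_)
      exact integral_congr_ae (Filter.Eventually.of_forall fun y => norm_mul _ _)
    have h2 := integral_mul_sq_le
      (memL (integrable_adjPrim (iw l)).aestronglyMeasurable (bdd 0 l)) (memL hgm hgG)
    calc ‖iterPairing g 1 (wal b l)‖ ^ 2
        ≤ (∫ y, ‖adjPrim (wal b l) y‖ * ‖g y‖ ∂unitMeas) ^ 2 :=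
          pow_le_pow_left₀ (norm_nonneg _) h1 2
      _ ≤ (∫ y, ‖adjPrim (wal b l) y‖ ^ 2 ∂unitMeas) * ∫ y, ‖g y‖ ^ 2 ∂unitMeas := h2
      _ = (∫ y, ‖adjPrim (wal b l) y‖ ^ 2 ∂unitMeas) * V := by simp_rw [hgn]; rfl
      _ ≤ (2 * (2 * Real.sin (Real.pi / b))⁻¹ ^ 2 * ((b : ℝ) ^ topPos b l)⁻¹ ^ 2) * V :=
          mul_le_mul_of_nonneg_right (integral_norm_sq_adjPrim_wal_le b hl) hV0
      _ = _ := by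
          rw [mul_pow, mul_pow, Real.sq_sqrt (by positivity)]
          ring
  have hstep := norm_iterPairing_iterate_step b hgm hgG hbase (α - 1) hk
  rw [show 0 + (α - 1) + 1 = α by omega] at hstep
  have hpair : iterPairing g α (wal b k) = (V : ℂ) := by
    rw [iterPairing, hV, ← integral_complex_ofReal]
    refine integral_congr_ae (Filter.Eventually.of_forall fun y => ?_)
    simp only [hg]
    rw [Complex.mul_conj, Complex.normSq_eq_norm_sq]
  rw [hpair, Complex.norm_real, Real.norm_of_nonneg hV0] at hstep
  rcases hV0.eq_or_lt with h0 | hVpos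
  · rw [← h0]
    have := constCtilde_pos b α
    positivity
  · have hsq := pow_le_pow_left₀ hV0 hstep 2
    rw [mul_pow, mul_pow, mul_pow, Real.sq_sqrt (by positivity)] at hsq
    rw [constCtilde_eq b hα]
    refine le_of_mul_le_mul_left ?_ hVpos
    calc V * V = V ^ 2 := (sq V).symm
      _ ≤ _ := hsq
      _ = _ := by ring

/-! ### The Walsh coefficients of the kernel -/

/-- The Walsh coefficients of the digital shift invariant kernel of order `α`. -/
def walCoef (α k : ℕ) : ℝ :=
  ∑ r ∈ Finset.Icc 1 (α - 1), ‖primMean b r k‖ ^ 2 + ∫ y, ‖adjPrim^[α] (wal b k) y‖ ^ 2 ∂unitMeas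

lemma walCoef_nonneg (α k : ℕ) : 0 ≤ walCoef b α k :=
  add_nonneg (Finset.sum_nonneg fun _ _ => by positivity) (integral_nonneg fun _ => by positivity)

omit [Fact b.Prime] in
lemma le_constD {α ν : ℕ} (h : ν ∈ Finset.Icc 1 α) :
    constCprime b α ν + constCtilde b α / (b : ℝ) ^ (2 * (α - ν)) ≤ constD b α :=
  le_ciSup (f := fun ν : Finset.Icc 1 α =>
    constCprime b α ν + constCtilde b α / (b : ℝ) ^ (2 * (α - (ν : ℕ)))) (Finite.bddAbove_range _)
    ⟨ν, h⟩

lemma constCprime_nonneg (α ν : ℕ) : 0 ≤ constCprime b α ν :=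
  Finset.sum_nonneg fun _ _ => by have := base_pos_real b; positivity

lemma constD_pos {α : ℕ} (hα : 1 ≤ α) : 0 < constD b α := by
  refine lt_of_lt_of_le ?_ (le_constD b (α := α) (ν := α) (by simp [hα]))
  have h1 := constCprime_nonneg b α α
  have h2 := constCtilde_pos b α
  have h3 := base_pos_real b
  positivity

lemma iterate_adjPrim_wal_zero {n : ℕ} (hn : 1 ≤ n) {y : ℝ} (hy : y ∈ Set.Ico (0 : ℝ) 1) :
    adjPrim^[n] (wal b 0) y = 0 := by
  have h0 : ∀ n, ∀ y ∈ Set.Icc (0 : ℝ) 1, adjPrim^[n] (fun _ => (0 : ℂ)) y = 0 := by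
    intro n
    induction n with
    | zero => intro y _; rfl
    | succ n ih =>
      intro y hy
      rw [Function.iterate_succ_apply, iterate_adjPrim_congr (G := fun _ => (0 : ℂ)) ?_ n y hy]
      · exact ih y hy
      · intro t _; simp [adjPrim]
  obtain ⟨m, rfl⟩ : ∃ m, n = m + 1 := ⟨n - 1, by omega⟩
  rw [Function.iterate_succ_apply, iterate_adjPrim_congr (G := fun _ => (0 : ℂ)) ?_ m y
    (Set.Ico_subset_Icc_self hy)]
  · exact h0 m y (Set.Ico_subset_Icc_self hy)
  · intro t _
    rw [show wal b 0 = fun _ => (1 : ℂ) from funext (wal_zero b), adjPrim_const]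

lemma walCoef_zero {α : ℕ} (hα : 1 ≤ α) : walCoef b α 0 = 0 := by
  rw [walCoef, Finset.sum_eq_zero, zero_add]
  · rw [integral_congr_ae (g := fun _ => (0 : ℝ)) (ae_unitMeas_of_forall fun y hy => ?_)]
    · simp
    · simp [iterate_adjPrim_wal_zero b hα hy]
  · intro r hr
    obtain ⟨n, rfl⟩ : ∃ n, r = n + 1 := ⟨r - 1, by rw [Finset.mem_Icc] at hr; omega⟩
    rw [primMean, iterPairing_succ_wal_zero, norm_zero]
    norm_num

lemma inv_pow_sq_le {n m e : ℕ} (h : n + e ≤ m) :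
    ((b : ℝ) ^ m)⁻¹ ^ 2 ≤ ((b : ℝ) ^ n)⁻¹ ^ 2 * ((b : ℝ) ^ (2 * e))⁻¹ := by
  have hb := base_pos_real b
  have hb1 : (1 : ℝ) ≤ b := by exact_mod_cast (one_lt_base b).le
  rw [pow_mul', ← inv_pow _ 2, ← mul_pow, ← mul_inv, ← pow_add]
  exact pow_le_pow_left₀ (by positivity)
    (inv_anti₀ (by positivity) (pow_le_pow_right₀ hb1 h)) 2

/-- With `ν` nonzero digits, the means of the first `ν - 1` images vanish; this is the reason for
the maximum over `ν` in `constD`. -/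
lemma walCoef_le {α k : ℕ} (hα : 1 ≤ α) (hk : k ≠ 0) :
    walCoef b α k ≤ constD b α * ((b : ℝ) ^ topWeight b α k)⁻¹ ^ 2 := by
  have hb := base_pos_real b
  have hb1 : (1 : ℝ) ≤ b := by exact_mod_cast (one_lt_base b).le
  have hCt := constCtilde_pos b α
  have hint := integral_norm_sq_iterate_adjPrim_wal_le b hα hk
  have hν := digitCount_pos b hk
  rcases le_or_gt (digitCount b k) α with hle | hgt
  · have hD := le_constD b (α := α) (ν := digitCount b k) (by rw [Finset.mem_Icc]; omega)
    refine le_trans ?_ (mul_le_mul_of_nonneg_right hD (by positivity))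
    rw [walCoef, add_mul]
    refine add_le_add ?_ ?_
    · rw [constCprime, Finset.sum_mul]
      have hsub : ∑ r ∈ Finset.Icc 1 (α - 1), ‖primMean b r k‖ ^ 2 =
          ∑ r ∈ Finset.Icc (digitCount b k) (α - 1), ‖primMean b r k‖ ^ 2 := by
        symm
        refine Finset.sum_subset (fun r hr => ?_) fun r hr hr' => ?_
        · rw [Finset.mem_Icc] at hr ⊢; omega
        · rw [Finset.mem_Icc] at hr hr'
          rw [primMean_eq_zero b (by omega), norm_zero]; norm_num
      rw [hsub]
      refine (Finset.sum_le_sum (g := fun r => constC b r ^ 2 / (b : ℝ) ^ (2 * (r -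
        digitCount b k)) * ((b : ℝ) ^ topWeight b α k)⁻¹ ^ 2) fun r hr => ?_).trans
        (Finset.sum_le_sum_of_subset_of_nonneg (fun r hr => ?_) fun r _ _ => by positivity)
      · rw [Finset.mem_Icc] at hr
        have h1 := pow_le_pow_left₀ (norm_nonneg _)
          (norm_primMean_le b (τ := r) (by omega) hk) 2
        rw [mul_pow] at h1
        refine h1.trans ?_
        have h2 := inv_pow_sq_le b (topWeight_add_le_primWeight b (α := α) hr.1 (by omega))
        calc _ ≤ constC b r ^ 2 * _ := mul_le_mul_of_nonneg_left h2 (by positivity)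
          _ = _ := by rw [div_eq_mul_inv]; ring
      · rw [Finset.mem_Icc] at hr ⊢; omega
    · refine hint.trans ?_
      have h2 := inv_pow_sq_le b (topWeight_add_le_primWeight b (α := α) hle le_rfl)
      calc _ ≤ constCtilde b α * _ := mul_le_mul_of_nonneg_left h2 hCt.le
        _ = _ := by rw [div_eq_mul_inv]; ring
  · have hD := le_constD b (α := α) (ν := α) (by rw [Finset.mem_Icc]; omega)
    rw [Nat.sub_self, mul_zero, pow_zero, div_one] at hD
    have h1 : constCtilde b α ≤ constD b α := by
      have := constCprime_nonneg b α α
      linarith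
    rw [walCoef, Finset.sum_eq_zero, zero_add]
    · refine hint.trans (mul_le_mul h1 ?_ (by positivity) (constD_pos b hα).le)
      exact pow_le_pow_left₀ (by positivity) (inv_anti₀ (by positivity)
        (pow_le_pow_right₀ hb1 (topWeight_le_primWeight b α k))) 2
    · intro r hr
      rw [Finset.mem_Icc] at hr
      rw [primMean_eq_zero b (by omega), norm_zero]; norm_num

end SquareIntegral

section DigitShift

variable (b : ℕ) [Fact b.Prime]

/-! ### Digitwise addition -/

/-- The natural number with the leading `M` digits of the digit sequence `a`. -/
def digPrefix (a : ℕ → Fin b) : ℕ → ℕ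
  | 0 => 0
  | M + 1 => b * digPrefix a M + a M

lemma ofDigits_mul_pow (a : ℕ → Fin b) (M : ℕ) :
    Real.ofDigits a * b ^ M = digPrefix b a M + Real.ofDigits fun i => a (i + M) := by
  have hb := base_pos_real b
  induction M with
  | zero => simp [digPrefix]
  | succ M ih =>
    have h1 := Real.ofDigits_eq_sum_add_ofDigits (fun i => a (i + M)) 1
    simp only [Finset.range_one, Finset.sum_singleton, Real.ofDigitsTerm, zero_add, pow_one] at h1
    have h2 : (fun i => a (i + 1 + M)) = fun i => a (i + (M + 1)) := by
      funext i; congr 1; ring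
    rw [h2] at h1
    rw [pow_succ, ← mul_assoc, ih, h1, digPrefix]
    push_cast
    field_simp
    ring

lemma floor_ofDigits_mul_pow {a : ℕ → Fin b} {M : ℕ}
    (h : Real.ofDigits (fun i => a (i + M)) < 1) :
    ⌊Real.ofDigits a * b ^ M⌋₊ = digPrefix b a M := by
  rw [ofDigits_mul_pow, Nat.floor_eq_iff
    (by have := Real.ofDigits_nonneg fun i => a (i + M); positivity)]
  have := Real.ofDigits_nonneg fun i => a (i + M)
  constructor <;> linarith

lemma dig_ofDigits {a : ℕ → Fin b} (h : ∀ M, Real.ofDigits (fun i => a (i + M)) < 1) (i : ℕ) :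
    dig b (Real.ofDigits a) i = a i := by
  rw [dig_eq, floor_ofDigits_mul_pow b (h _), digPrefix, Nat.mul_add_mod,
    Nat.mod_eq_of_lt (a i).2]

/-- If all late tails of a digit sequence are less than one, then all tails are. -/
lemma ofDigits_tail_lt_one {a : ℕ → Fin b} {M₀ : ℕ}
    (h : ∀ M, M₀ ≤ M → Real.ofDigits (fun i => a (i + M)) < 1) (M : ℕ) :
    Real.ofDigits (fun i => a (i + M)) < 1 := by
  have hb := base_pos_real b
  have hstep : ∀ n, ∀ M, M₀ ≤ M + n → Real.ofDigits (fun i => a (i + M)) < 1 := by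
    intro n
    induction n with
    | zero => intro M hM; exact h M hM
    | succ n ih =>
      intro M hM
      have h1 := Real.ofDigits_eq_sum_add_ofDigits (fun i => a (i + M)) 1
      simp only [Finset.range_one, Finset.sum_singleton, Real.ofDigitsTerm, zero_add, pow_one] at h1
      have h2 : (fun i => a (i + 1 + M)) = fun i => a (i + (M + 1)) := by
        funext i; rw [show i + 1 + M = i + (M + 1) by ring]
      rw [h2] at h1
      have h3 := ih (M + 1) (by omega)
      have h4 : ((a M : ℕ) : ℝ) ≤ b - 1 := by
        rw [le_sub_iff_add_le]
        exact_mod_cast (a M).2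
      rw [h1]
      calc _ < (b - 1) * (b : ℝ)⁻¹ + (b : ℝ)⁻¹ * 1 := by
            refine add_lt_add_of_le_of_lt ?_ ?_
            · gcongr
            · gcongr
        _ = 1 := by field_simp; ring
  exact hstep M₀ M (by omega)

lemma ofDigits_tail_lt_one_of_eventually_zero {a : ℕ → Fin b} {M₀ : ℕ}
    (h : ∀ i, M₀ ≤ i → a i = 0) (M : ℕ) : Real.ofDigits (fun i => a (i + M)) < 1 := by
  refine ofDigits_tail_lt_one b (M₀ := M₀) (fun M hM => ?_) M
  have : Real.ofDigits (fun i => a (i + M)) = 0 := by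
    rw [Real.ofDigits]
    convert tsum_zero with i
    rw [Real.ofDigitsTerm, h (i + M) (by omega)]
    simp
  rw [this]
  exact one_pos

lemma ofDigits_digits_add_lt_one {σ : ℝ} (hσ : σ ∈ Set.Ico (0 : ℝ) 1) (M : ℕ) :
    Real.ofDigits (fun i => Real.digits σ b (i + M)) < 1 := by
  have hb := base_pos_real b
  have h1 := Real.ofDigits_eq_sum_add_ofDigits (Real.digits σ b) M
  have h2 := Real.ofDigits_digits_sum_eq (b := b) hσ M
  rw [Real.ofDigits_digits (one_lt_base b) hσ] at h1
  have h3 := Nat.lt_floor_add_one ((b : ℝ) ^ M * σ)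
  have h4 : (b : ℝ) ^ M * σ = ⌊(b : ℝ) ^ M * σ⌋₊ +
      Real.ofDigits (fun i => Real.digits σ b (i + M)) := by
    rw [← h2]
    nth_rewrite 1 [h1]
    field_simp
  linarith

lemma floor_eq_digPrefix {σ : ℝ} (hσ : σ ∈ Set.Ico (0 : ℝ) 1) (M : ℕ) :
    ⌊σ * b ^ M⌋₊ = digPrefix b (Real.digits σ b) M := by
  have h := floor_ofDigits_mul_pow b (ofDigits_digits_add_lt_one b hσ M)
  rwa [Real.ofDigits_digits (one_lt_base b) hσ] at h

omit [Fact b.Prime] in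
lemma digPrefix_congr {a a' : ℕ → Fin b} {M : ℕ} (h : ∀ i < M, a i = a' i) :
    digPrefix b a M = digPrefix b a' M := by
  induction M with
  | zero => rfl
  | succ M ih => rw [digPrefix, digPrefix, ih fun i hi => h i (by omega), h M (by omega)]

/-- Two numbers with the same leading `M` digits lie in the same elementary interval. -/
lemma floor_eq_iff_dig_eq {σ τ : ℝ} (hσ : σ ∈ Set.Ico (0 : ℝ) 1) (hτ : τ ∈ Set.Ico (0 : ℝ) 1)
    (M : ℕ) : ⌊σ * b ^ M⌋₊ = ⌊τ * b ^ M⌋₊ ↔ ∀ i < M, dig b σ i = dig b τ i := by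
  constructor
  · intro h i hi
    rw [dig_eq_of_floor b h hi, dig_eq_of_floor b rfl hi]
  · intro h
    rw [floor_eq_digPrefix b hσ, floor_eq_digPrefix b hτ]
    exact digPrefix_congr b fun i hi => Fin.ext (h i hi)

/-- The digits of the digitwise sum of `x` and `σ`. -/
def shiftDigits (x σ : ℝ) (i : ℕ) : Fin b := Real.digits x b i + Real.digits σ b i

lemma digitAdd_eq_ofDigits (x σ : ℝ) : digitAdd b x σ = Real.ofDigits (shiftDigits b x σ) := rfl

lemma val_shiftDigits (x σ : ℝ) (i : ℕ) :
    (shiftDigits b x σ i : ℕ) = (dig b x i + dig b σ i) % b := by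
  rw [shiftDigits, Fin.val_add]; rfl

section

variable {b} {x : ℝ} {M₀ : ℕ}

lemma shiftDigits_eq (hx : ∀ i, M₀ ≤ i → dig b x i = 0) (σ : ℝ) {i : ℕ} (hi : M₀ ≤ i) :
    shiftDigits b x σ i = Real.digits σ b i := by
  refine Fin.ext ?_
  rw [val_shiftDigits, hx i hi, zero_add, Nat.mod_eq_of_lt (dig_lt b σ i)]
  rfl

lemma ofDigits_digitAdd_tail_lt_one (hx : ∀ i, M₀ ≤ i → dig b x i = 0) {σ : ℝ}
    (hσ : σ ∈ Set.Ico (0 : ℝ) 1) (M : ℕ) :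
    Real.ofDigits (fun i => shiftDigits b x σ (i + M)) < 1 := by
  refine ofDigits_tail_lt_one b (M₀ := M₀) (fun M hM => ?_) M
  have e : (fun i => shiftDigits b x σ (i + M)) = fun i => Real.digits σ b (i + M) :=
    funext fun i => shiftDigits_eq hx σ (by omega)
  rw [e]
  exact ofDigits_digits_add_lt_one b hσ M

lemma digitAdd_mem (hx : ∀ i, M₀ ≤ i → dig b x i = 0) {σ : ℝ} (hσ : σ ∈ Set.Ico (0 : ℝ) 1) :
    digitAdd b x σ ∈ Set.Ico (0 : ℝ) 1 :=
  ⟨Real.ofDigits_nonneg _, ofDigits_digitAdd_tail_lt_one hx hσ 0⟩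

lemma floor_digitAdd_mul_pow (hx : ∀ i, M₀ ≤ i → dig b x i = 0) {σ : ℝ}
    (hσ : σ ∈ Set.Ico (0 : ℝ) 1) (M : ℕ) :
    ⌊digitAdd b x σ * b ^ M⌋₊ = digPrefix b (shiftDigits b x σ) M := by
  rw [digitAdd_eq_ofDigits, floor_ofDigits_mul_pow b (ofDigits_digitAdd_tail_lt_one hx hσ M)]

lemma dig_digitAdd (hx : ∀ i, M₀ ≤ i → dig b x i = 0) {σ : ℝ} (hσ : σ ∈ Set.Ico (0 : ℝ) 1)
    (i : ℕ) : dig b (digitAdd b x σ) i = (dig b x i + dig b σ i) % b := by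
  rw [digitAdd_eq_ofDigits, dig_ofDigits b (ofDigits_digitAdd_tail_lt_one hx hσ), val_shiftDigits]

variable (b x) in
lemma measurable_digitAdd : Measurable (digitAdd b x) := by
  refine measurable_of_tendsto_metrizable (f := fun (n : ℕ) (σ : ℝ) => ∑ i ∈ Finset.range n,
    Real.ofDigitsTerm (shiftDigits b x σ) i) (fun n => ?_)
    (tendsto_pi_nhds.2 fun σ => Real.summable_ofDigitsTerm.hasSum.tendsto_sum_nat)
  refine Finset.measurable_sum _ fun i _ => ?_
  have h : (fun σ : ℝ => Real.ofDigitsTerm (shiftDigits b x σ) i) =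
      fun σ => (fun n : ℕ => (((dig b x i + n) % b : ℕ) : ℝ) * ((b : ℝ) ^ (i + 1))⁻¹)
        (dig b σ i) := by
    funext σ
    simp only [Real.ofDigitsTerm, val_shiftDigits]
  rw [h]
  exact (measurable_from_top (f := fun n : ℕ =>
    (((dig b x i + n) % b : ℕ) : ℝ) * ((b : ℝ) ^ (i + 1))⁻¹)).comp (measurable_dig b i)

/-- The digital shift acts as a translation on every elementary interval. -/
lemma exists_digitAdd_eq_add (hx : ∀ i, M₀ ≤ i → dig b x i = 0) {n : ℕ} (hn : n < b ^ M₀) :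
    ∃ n', n' < b ^ M₀ ∧ (∀ σ ∈ Set.Ico ((n : ℝ) / b ^ M₀) ((n + 1) / b ^ M₀),
      digitAdd b x σ = σ + ((n' : ℝ) / b ^ M₀ - n / b ^ M₀)) ∧
      ∀ i < M₀, n' / b ^ (M₀ - 1 - i) % b = (dig b x i + n / b ^ (M₀ - 1 - i) % b) % b := by
  have hb := base_pos_real b
  have hB : (0 : ℝ) < b ^ M₀ := by positivity
  have hcell : ∀ σ ∈ Set.Ico ((n : ℝ) / b ^ M₀) ((n + 1) / b ^ M₀), σ ∈ Set.Ico (0 : ℝ) 1 := by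
    intro σ hσ
    refine ⟨le_trans (by positivity) hσ.1, hσ.2.trans_le ?_⟩
    rw [div_le_one hB]
    exact_mod_cast hn
  have hσ₀ : (n : ℝ) / b ^ M₀ ∈ Set.Ico ((n : ℝ) / b ^ M₀) ((n + 1) / b ^ M₀) :=
    ⟨le_rfl, by gcongr; linarith⟩
  have hpre : ∀ σ ∈ Set.Ico ((n : ℝ) / b ^ M₀) ((n + 1) / b ^ M₀),
      digPrefix b (shiftDigits b x σ) M₀ = digPrefix b (shiftDigits b x (n / b ^ M₀)) M₀ := by
    intro σ hσ
    refine digPrefix_congr b fun i hi => Fin.ext ?_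
    rw [val_shiftDigits, val_shiftDigits, dig_eq_of_floor b (floor_eq_of_mem_cell b hσ) hi,
      dig_eq_of_floor b (floor_eq_of_mem_cell b hσ₀) hi]
  have hfl := floor_digitAdd_mul_pow hx (hcell _ hσ₀) M₀
  refine ⟨digPrefix b (shiftDigits b x (n / b ^ M₀)) M₀, ?_, ?_, ?_⟩
  · rw [← hfl, Nat.floor_lt (mul_nonneg (digitAdd_mem hx (hcell _ hσ₀)).1 hB.le)]
    push_cast
    exact mul_lt_of_lt_one_left hB (digitAdd_mem hx (hcell _ hσ₀)).2
  · intro σ hσ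
    have h1 := ofDigits_mul_pow b (shiftDigits b x σ) M₀
    have h2 := ofDigits_mul_pow b (Real.digits σ b) M₀
    rw [Real.ofDigits_digits (one_lt_base b) (hcell σ hσ), ← floor_eq_digPrefix b (hcell σ hσ),
      floor_eq_of_mem_cell b hσ] at h2
    have h3 : (fun i => shiftDigits b x σ (i + M₀)) = fun i => Real.digits σ b (i + M₀) :=
      funext fun i => shiftDigits_eq hx σ (by omega)
    rw [h3, hpre σ hσ, ← digitAdd_eq_ofDigits] at h1
    rw [← sub_div, ← sub_eq_iff_eq_add', eq_div_iff hB.ne']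
    linarith
  · intro i hi
    rw [← dig_eq_of_floor b hfl hi, dig_digitAdd hx (hcell _ hσ₀),
      dig_eq_of_floor b (floor_eq_of_mem_cell b hσ₀) hi]

omit [Fact b.Prime] in
/-- A natural number is determined by its base `b` digits. -/
lemma eq_of_digit_eq {n n' N : ℕ} (hn : n < b ^ N) (hn' : n' < b ^ N)
    (h : ∀ j < N, n / b ^ j % b = n' / b ^ j % b) : n = n' := by
  induction N generalizing n n' with
  | zero => rw [pow_zero] at hn hn'; omega
  | succ N ih =>
    have e0 := h 0 (by omega)
    rw [pow_zero, Nat.div_one, Nat.div_one] at e0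
    have e1 : n / b = n' / b := by
      refine ih (Nat.div_lt_of_lt_mul (by rwa [← pow_succ']))
        (Nat.div_lt_of_lt_mul (by rwa [← pow_succ'])) fun j hj => ?_
      have := h (j + 1) (by omega)
      rwa [pow_succ', ← Nat.div_div_eq_div_mul, ← Nat.div_div_eq_div_mul] at this
    rw [← Nat.div_add_mod n b, ← Nat.div_add_mod n' b, e0, e1]

lemma integral_unitMeas_eq_sum_cells {F : ℝ → ℝ} (hF : Integrable F unitMeas) (M : ℕ) :
    ∫ t, F t ∂unitMeas = ∑ n ∈ Finset.range (b ^ M),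
      ∫ t in Set.Ico ((n : ℝ) / b ^ M) ((n + 1) / b ^ M), F t := by
  have hb := base_pos_real b
  have hB : (0 : ℝ) < b ^ M := by positivity
  have hmem : ∀ n : ℕ, n ≤ b ^ M → ((n : ℝ) / b ^ M) ∈ Set.Icc (0 : ℝ) 1 := fun n hn =>
    ⟨by positivity, by rw [div_le_one hB]; exact_mod_cast hn⟩
  have h := intervalIntegral.sum_integral_adjacent_intervals (μ := volume) (f := F)
    (a := fun n : ℕ => (n : ℝ) / b ^ M) (n := b ^ M) (fun k hk =>
      intervalIntegrable_of_unitMeas hF (hmem k hk.le) (hmem (k + 1) hk))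
  rw [integral_unitMeas]
  have e1 : ((b ^ M : ℕ) : ℝ) / b ^ M = 1 := by push_cast; exact div_self hB.ne'
  simp only [e1, Nat.cast_zero, zero_div] at h
  rw [← h]
  refine Finset.sum_congr rfl fun n _ => ?_
  push_cast
  rw [intervalIntegral.integral_of_le (by gcongr; linarith), integral_Ico_eq_integral_Ioc]

/-- A digital shift by a number with finitely many nonzero digits preserves Lebesgue measure. -/
lemma integral_digitAdd (hx : ∀ i, M₀ ≤ i → dig b x i = 0) {F : ℝ → ℝ} (hFm : Measurable F)
    {G : ℝ} (hG : ∀ t ∈ Set.Ico (0 : ℝ) 1, |F t| ≤ G) :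
    ∫ σ, F (digitAdd b x σ) ∂unitMeas = ∫ σ, F σ ∂unitMeas := by
  have hF : Integrable F unitMeas :=
    Integrable.of_bound hFm.aestronglyMeasurable G (ae_unitMeas_of_forall hG)
  have hF' : Integrable (fun σ => F (digitAdd b x σ)) unitMeas :=
    Integrable.of_bound (hFm.comp (measurable_digitAdd b x)).aestronglyMeasurable G
      (ae_unitMeas_of_forall fun t ht => hG _ (digitAdd_mem hx ht))
  rw [integral_unitMeas_eq_sum_cells (b := b) hF M₀, integral_unitMeas_eq_sum_cells (b := b) hF' M₀]
  choose! π hπ1 hπ2 hπ3 using fun (n : ℕ) (hn : n < b ^ M₀) => exists_digitAdd_eq_add hx hn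
  have hinj : Set.InjOn π (Finset.range (b ^ M₀)) := by
    intro n hn n' hn' h
    simp only [Finset.coe_range, Set.mem_Iio] at hn hn'
    refine eq_of_digit_eq hn hn' fun j hj => ?_
    obtain ⟨i, hi, rfl⟩ : ∃ i, i < M₀ ∧ j = M₀ - 1 - i := ⟨M₀ - 1 - j, by omega, by omega⟩
    have h1 := hπ3 n hn i hi
    rw [h, hπ3 n' hn' i hi] at h1
    have h2 : n' / b ^ (M₀ - 1 - i) % b ≡ n / b ^ (M₀ - 1 - i) % b [MOD b] :=
      Nat.ModEq.add_left_cancel' (dig b x i) h1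
    have h3 : n' / b ^ (M₀ - 1 - i) % b % b = n / b ^ (M₀ - 1 - i) % b % b := h2
    rw [Nat.mod_mod, Nat.mod_mod] at h3
    exact h3.symm
  have himg : (Finset.range (b ^ M₀)).image π = Finset.range (b ^ M₀) := by
    refine Finset.eq_of_subset_of_card_le (fun m hm => ?_) ?_
    · rw [Finset.mem_image] at hm
      obtain ⟨n, hn, rfl⟩ := hm
      exact Finset.mem_range.2 (hπ1 n (Finset.mem_range.1 hn))
    · rw [Finset.card_image_of_injOn hinj]
  have hsum : ∀ f : ℕ → ℝ, ∑ n ∈ Finset.range (b ^ M₀), f (π n) =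
      ∑ n ∈ Finset.range (b ^ M₀), f n := fun f => by
    conv_rhs => rw [← himg, Finset.sum_image hinj]
  refine Eq.trans ?_ (hsum fun n => ∫ t in Set.Ico ((n : ℝ) / b ^ M₀) ((n + 1) / b ^ M₀), F t)
  refine Finset.sum_congr rfl fun n hn => ?_
  rw [Finset.mem_range] at hn
  have hb := base_pos_real b
  have e1 : ∫ σ in Set.Ico ((n : ℝ) / b ^ M₀) ((n + 1) / b ^ M₀), F (digitAdd b x σ) =
      ∫ σ in Set.Ico ((n : ℝ) / b ^ M₀) ((n + 1) / b ^ M₀),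
        F (σ + ((π n : ℝ) / b ^ M₀ - n / b ^ M₀)) :=
    setIntegral_congr_fun measurableSet_Ico fun σ hσ => by simp only [hπ2 n hn σ hσ]
  rw [e1, integral_Ico_eq_integral_Ioc, integral_Ico_eq_integral_Ioc,
    ← intervalIntegral.integral_of_le (by gcongr; linarith),
    ← intervalIntegral.integral_of_le (by gcongr; linarith),
    intervalIntegral.integral_comp_add_right]
  congr 1 <;> ring

end

/-! ### The Dirichlet kernel of the Walsh system -/

lemma sum_range_mul_eq {E : Type*} [AddCommMonoid E] (f : ℕ → E) (B c : ℕ) :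
    ∑ k ∈ Finset.range (B * c), f k =
      ∑ κ ∈ Finset.range c, ∑ k ∈ Finset.range B, f (k + κ * B) := by
  induction c with
  | zero => simp
  | succ c ih =>
    rw [Nat.mul_succ, Finset.sum_range_add, Finset.sum_range_succ, ih]
    congr 1
    exact Finset.sum_congr rfl fun k _ => by rw [add_comm, mul_comm]

lemma sum_rootU_pow_mul_conj (A B : ℕ) :
    ∑ κ ∈ Finset.range b, rootU b ^ (κ * A) * (starRingEnd ℂ) (rootU b ^ (κ * B)) =
      if A % b = B % b then (b : ℂ) else 0 := by
  have hone : ∀ n, rootU b ^ n * (starRingEnd ℂ) (rootU b ^ n) = 1 := fun n => by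
    rw [Complex.mul_conj, Complex.normSq_eq_norm_sq, norm_rootU_pow]; simp
  have hconj : ∀ n, (starRingEnd ℂ) (rootU b ^ n) ^ b = 1 := fun n => by
    rw [← map_pow, ← pow_mul, mul_comm, pow_mul, (isPrimitiveRoot_rootU b).pow_eq_one, one_pow,
      map_one]
  set z : ℂ := rootU b ^ A * (starRingEnd ℂ) (rootU b ^ B) with hz
  have e : ∀ κ, rootU b ^ (κ * A) * (starRingEnd ℂ) (rootU b ^ (κ * B)) = z ^ κ := fun κ => by
    rw [hz, mul_pow, ← map_pow, ← pow_mul, ← pow_mul, mul_comm A, mul_comm B]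
  simp_rw [e]
  split_ifs with h
  · have : z = 1 := by
      rw [hz, ← rootU_pow_mod b A, h, rootU_pow_mod b B, hone]
    simp [this]
  · have hne : z ≠ 1 := by
      intro h1
      apply h
      have h2 : rootU b ^ A = rootU b ^ B := by
        have h3 := congrArg (· * rootU b ^ B) h1
        simp only [hz, one_mul] at h3
        rw [mul_assoc, mul_comm ((starRingEnd ℂ) _), hone, mul_one] at h3
        exact h3
      rw [← rootU_pow_mod b A, ← rootU_pow_mod b B] at h2
      exact (isPrimitiveRoot_rootU b).pow_inj (Nat.mod_lt _ (base_pos b))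
        (Nat.mod_lt _ (base_pos b)) h2
    have hzb : z ^ b = 1 := by
      rw [hz, mul_pow, hconj, mul_one, ← pow_mul, mul_comm, pow_mul,
        (isPrimitiveRoot_rootU b).pow_eq_one, one_pow]
    have h3 := mul_neg_geom_sum z b
    rw [hzb, sub_self] at h3
    rcases mul_eq_zero.1 h3 with h4 | h4
    · exact absurd (sub_eq_zero.1 h4).symm hne
    · exact h4

open Classical in
/-- The Dirichlet kernel of the Walsh system, for the difference of two digital shifts. -/
def walDirichlet (M : ℕ) (x y x' y' : ℝ) : ℝ :=
  if ∀ i < M, (dig b x i + dig b y' i) % b = (dig b x' i + dig b y i) % b then (b : ℝ) ^ M else 0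

lemma sum_wal_eq_walDirichlet (M : ℕ) (x y x' y' : ℝ) :
    ∑ k ∈ Finset.range (b ^ M), wal b k x * (starRingEnd ℂ) (wal b k x') *
      ((starRingEnd ℂ) (wal b k y) * wal b k y') = (walDirichlet b M x y x' y' : ℂ) := by
  induction M with
  | zero => simp [walDirichlet]
  | succ M ih =>
    rw [pow_succ, sum_range_mul_eq]
    have e : ∀ κ ∈ Finset.range b, ∑ k ∈ Finset.range (b ^ M),
        wal b (k + κ * b ^ M) x * (starRingEnd ℂ) (wal b (k + κ * b ^ M) x') *
        ((starRingEnd ℂ) (wal b (k + κ * b ^ M) y) * wal b (k + κ * b ^ M) y') =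
        (walDirichlet b M x y x' y' : ℂ) * (rootU b ^ (κ * (dig b x M + dig b y' M)) *
          (starRingEnd ℂ) (rootU b ^ (κ * (dig b x' M + dig b y M)))) := by
      intro κ hκ
      rw [← ih, Finset.sum_mul]
      refine Finset.sum_congr rfl fun k hk => ?_
      rw [Finset.mem_range] at hk hκ
      simp only [wal_add_mul_pow b hk hκ, map_mul, mul_add, pow_add]
      ring
    rw [Finset.sum_congr rfl e, ← Finset.mul_sum, sum_rootU_pow_mul_conj]
    unfold walDirichlet
    by_cases h1 : ∀ i < M, (dig b x i + dig b y' i) % b = (dig b x' i + dig b y i) % b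
    · by_cases h2 : (dig b x M + dig b y' M) % b = (dig b x' M + dig b y M) % b
      · rw [if_pos h1, if_pos h2, if_pos]
        · push_cast; rw [pow_succ]
        · intro i hi
          rcases Nat.lt_succ_iff_lt_or_eq.1 hi with h | rfl
          · exact h1 i h
          · exact h2
      · have h3 : ¬ ∀ i < M + 1, (dig b x i + dig b y' i) % b = (dig b x' i + dig b y i) % b :=
          fun h => h2 (h M (Nat.lt_succ_self M))
        rw [if_neg h2, if_neg h3, mul_zero, Complex.ofReal_zero]
    · have h3 : ¬ ∀ i < M + 1, (dig b x i + dig b y' i) % b = (dig b x' i + dig b y i) % b :=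
        fun h => h1 fun i hi => h i (by omega)
      rw [if_neg h1, if_neg h3, Complex.ofReal_zero, zero_mul]

end DigitShift

section ShiftedKernel

/-! ### The digital shift invariant kernel -/

lemma integrable_sobKer_mul (α r : ℕ) (x x' : ℝ) :
    Integrable (fun z => sobKer α r x z * sobKer α r x' z) unitMeas :=
  Integrable.of_bound
    ((measurable_sobKer α r x).mul (measurable_sobKer α r x')).aestronglyMeasurable
    (2 ^ α * 2 ^ α) (ae_unitMeas_of_forall fun z hz => by
      rw [norm_mul]
      have hz' := Set.Ico_subset_Icc_self hz
      exact mul_le_mul (abs_sobKer_le α r x hz') (abs_sobKer_le α r x' hz') (norm_nonneg _)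
        (by positivity))

lemma measurable_sobRK_uncurry (α : ℕ) : Measurable (Function.uncurry (sobRK α)) := by
  change Measurable fun p : ℝ × ℝ => ∑ r ∈ Finset.Icc 1 α,
    ∫ z, sobKer α r p.1 z * sobKer α r p.2 z ∂unitMeas
  refine Finset.measurable_sum _ fun r _ => ?_
  refine (Measurable.stronglyMeasurable (f := Function.uncurry fun (p : ℝ × ℝ) (z : ℝ) =>
    sobKer α r p.1 z * sobKer α r p.2 z) ?_).integral_prod_right.measurable
  have h := measurable_sobKer_uncurry α r
  exact (h.comp ((measurable_fst.comp measurable_fst).prodMk measurable_snd)).mul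
    (h.comp ((measurable_snd.comp measurable_fst).prodMk measurable_snd))

lemma abs_sobRK_le (α : ℕ) (x x' : ℝ) : |sobRK α x x'| ≤ α * (2 ^ α * 2 ^ α) := by
  rw [sobRK]
  refine (Finset.abs_sum_le_sum_abs _ _).trans ?_
  have h : ∀ r ∈ Finset.Icc 1 α, |∫ z, sobKer α r x z * sobKer α r x' z ∂unitMeas| ≤
      2 ^ α * 2 ^ α := by
    intro r _
    refine abs_integral_le_integral_abs.trans
      (integral_unitMeas_le_of_forall (fun _ _ => abs_nonneg _) fun z hz => ?_)
    have hz' := Set.Ico_subset_Icc_self hz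
    rw [abs_mul]
    exact mul_le_mul (abs_sobKer_le α r x hz') (abs_sobKer_le α r x' hz') (abs_nonneg _)
      (by positivity)
  refine (Finset.sum_le_sum h).trans (le_of_eq ?_)
  simp

lemma abs_sobRK_sub_le {α : ℕ} (hα : 2 ≤ α) (x x' x'' : ℝ) :
    |sobRK α x x' - sobRK α x x''| ≤ α * (2 ^ α * 2 ^ α) * |x' - x''| := by
  rw [sobRK, sobRK, ← Finset.sum_sub_distrib]
  refine (Finset.abs_sum_le_sum_abs _ _).trans ?_
  have h : ∀ r ∈ Finset.Icc 1 α, |∫ z, sobKer α r x z * sobKer α r x' z ∂unitMeas -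
      ∫ z, sobKer α r x z * sobKer α r x'' z ∂unitMeas| ≤ 2 ^ α * 2 ^ α * |x' - x''| := by
    intro r _
    rw [← integral_sub (integrable_sobKer_mul α r x x') (integrable_sobKer_mul α r x x'')]
    refine abs_integral_le_integral_abs.trans
      (integral_unitMeas_le_of_forall (fun _ _ => abs_nonneg _) fun z hz => ?_)
    have hz' := Set.Ico_subset_Icc_self hz
    rw [← mul_sub, abs_mul, mul_assoc]
    exact mul_le_mul (abs_sobKer_le α r x hz') (abs_sobKer_sub_le hα r x' x'' hz') (abs_nonneg _)
      (by positivity)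
  refine (Finset.sum_le_sum h).trans (le_of_eq ?_)
  simp [mul_assoc]

variable (b : ℕ) [Fact b.Prime]

/-- Integrating the reproducing functions against a Walsh function. -/
lemma integral_sobKer_mul_wal {α r : ℕ} (hr : r ∈ Finset.Icc 1 α) (k : ℕ) {z : ℝ}
    (hz : z ∈ Set.Ico (0 : ℝ) 1) :
    ∫ y, (sobKer α r y z : ℂ) * wal b k y ∂unitMeas =
      if r < α then primMean b r k else adjPrim^[α] (wal b k) z := by
  rw [Finset.mem_Icc] at hr
  simp only [sobKer, if_neg (show ¬ r = 0 by omega)]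
  split_ifs with h
  · obtain ⟨n, rfl⟩ : ∃ n, r = n + 1 := ⟨r - 1, by omega⟩
    rw [Nat.add_sub_cancel, primMean_eq]
    have e1 : ∫ z, adjPrim^[n + 1] (wal b k) z ∂unitMeas =
        ∫ z, ∫ y, (iterKer n y z : ℂ) * wal b k y ∂unitMeas ∂unitMeas :=
      integral_congr_ae (ae_unitMeas_of_forall fun z hz =>
        (integral_iterKer_mul n (integrable_wal b k) z (Set.Ico_subset_Icc_self hz)).symm)
    rw [e1, integral_integral_swap]
    · refine integral_congr_ae (Filter.Eventually.of_forall fun y => ?_)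
      simp only
      rw [integral_mul_const, integral_complex_ofReal]
    · have hm : AEStronglyMeasurable (Function.uncurry fun z y => (iterKer n y z : ℂ) * wal b k y)
          (unitMeas.prod unitMeas) :=
        ((Complex.measurable_ofReal.comp ((measurable_iterKer_uncurry n).comp
          measurable_swap)).mul ((measurable_wal b k).comp measurable_snd)).aestronglyMeasurable
      refine Integrable.of_bound hm (2 ^ n) ?_
      have h1 : ∀ᵐ p ∂(unitMeas.prod unitMeas), p.1 ∈ Set.Ico (0 : ℝ) 1 :=
        Measure.quasiMeasurePreserving_fst.ae (ae_unitMeas_of_forall fun z hz => hz)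
      filter_upwards [h1] with p hp
      simp only [Function.uncurry, norm_mul, Complex.norm_real, norm_wal, mul_one]
      exact abs_iterKer_le n _ (Set.Ico_subset_Icc_self hp)
  · have hα : r = α := by omega
    subst hα
    have h1 := integral_iterKer_mul (r - 1) (integrable_wal b k) z (Set.Ico_subset_Icc_self hz)
    rwa [show r - 1 + 1 = r by omega] at h1

/-- The Walsh coefficient of the kernel on the diagonal. -/
lemma walCoef_eq_integral_sobRK {α : ℕ} (hα : 1 ≤ α) (k : ℕ) :
    (walCoef b α k : ℂ) = ∫ p : ℝ × ℝ, (sobRK α p.1 p.2 : ℂ) *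
      ((starRingEnd ℂ) (wal b k p.1) * wal b k p.2) ∂(unitMeas.prod unitMeas) := by
  have hK := measurable_sobKer_uncurry α
  have hw := measurable_wal b k
  have hwc : Measurable fun y => (starRingEnd ℂ) (wal b k y) :=
    Complex.continuous_conj.measurable.comp hw
  -- The square integral of the transform of one reproducing function, as a double integral.
  have key : ∀ r ∈ Finset.Icc 1 α,
      ((∫ z, ‖(if r < α then primMean b r k else adjPrim^[α] (wal b k) z)‖ ^ 2 ∂unitMeas : ℝ) : ℂ) =
      ∫ p : ℝ × ℝ, ((∫ z, sobKer α r p.1 z * sobKer α r p.2 z ∂unitMeas : ℝ) : ℂ) *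
        ((starRingEnd ℂ) (wal b k p.1) * wal b k p.2) ∂(unitMeas.prod unitMeas) := by
    intro r hr
    have e1 : ∀ z ∈ Set.Ico (0 : ℝ) 1,
        ((‖(if r < α then primMean b r k else adjPrim^[α] (wal b k) z)‖ ^ 2 : ℝ) : ℂ) =
        ∫ p : ℝ × ℝ, (sobKer α r p.1 z : ℂ) * (starRingEnd ℂ) (wal b k p.1) *
          ((sobKer α r p.2 z : ℂ) * wal b k p.2) ∂(unitMeas.prod unitMeas) := by
      intro z hz
      rw [integral_prod_mul (fun y => (sobKer α r y z : ℂ) * (starRingEnd ℂ) (wal b k y))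
        (fun y => (sobKer α r y z : ℂ) * wal b k y), integral_sobKer_mul_wal b hr k hz]
      have e2 : ∫ y, (sobKer α r y z : ℂ) * (starRingEnd ℂ) (wal b k y) ∂unitMeas =
          (starRingEnd ℂ) (∫ y, (sobKer α r y z : ℂ) * wal b k y ∂unitMeas) := by
        rw [← integral_conj]
        simp
      rw [e2, integral_sobKer_mul_wal b hr k hz, mul_comm, Complex.mul_conj,
        Complex.normSq_eq_norm_sq]
    rw [← integral_complex_ofReal, integral_congr_ae (ae_unitMeas_of_forall e1),
      integral_integral_swap]
    · refine integral_congr_ae (Filter.Eventually.of_forall fun p => ?_)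
      simp only
      rw [← integral_complex_ofReal, ← integral_mul_const]
      refine integral_congr_ae (Filter.Eventually.of_forall fun z => ?_)
      simp only
      push_cast
      ring
    · have hm : AEStronglyMeasurable (Function.uncurry fun (z : ℝ) (p : ℝ × ℝ) =>
          (sobKer α r p.1 z : ℂ) * (starRingEnd ℂ) (wal b k p.1) *
          ((sobKer α r p.2 z : ℂ) * wal b k p.2)) (unitMeas.prod (unitMeas.prod unitMeas)) := by
        have h1 : Measurable fun q : ℝ × (ℝ × ℝ) => q.2.1 := measurable_fst.comp measurable_snd
        have h2 : Measurable fun q : ℝ × (ℝ × ℝ) => q.2.2 := measurable_snd.comp measurable_snd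
        exact (((Complex.measurable_ofReal.comp ((hK r).comp (h1.prodMk measurable_fst))).mul
          (hwc.comp h1)).mul ((Complex.measurable_ofReal.comp ((hK r).comp
          (h2.prodMk measurable_fst))).mul (hw.comp h2))).aestronglyMeasurable
      refine Integrable.of_bound hm (2 ^ α * 2 ^ α) ?_
      have h1 : ∀ᵐ q ∂(unitMeas.prod (unitMeas.prod unitMeas)), q.1 ∈ Set.Ico (0 : ℝ) 1 :=
        Measure.quasiMeasurePreserving_fst.ae (ae_unitMeas_of_forall fun z hz => hz)
      filter_upwards [h1] with q hq
      have hq' := Set.Ico_subset_Icc_self hq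
      simp only [Function.uncurry, norm_mul, Complex.norm_real, norm_wal, mul_one, RCLike.norm_conj]
      exact mul_le_mul (abs_sobKer_le α r _ hq') (abs_sobKer_le α r _ hq') (norm_nonneg _)
        (by positivity)
  have hsplit : walCoef b α k = ∑ r ∈ Finset.Icc 1 α,
      ∫ z, ‖(if r < α then primMean b r k else adjPrim^[α] (wal b k) z)‖ ^ 2 ∂unitMeas := by
    obtain ⟨n, rfl⟩ : ∃ n, α = n + 1 := ⟨α - 1, by omega⟩
    rw [Finset.sum_Icc_succ_top (by omega), walCoef, Nat.add_sub_cancel]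
    congr 1
    · refine Finset.sum_congr rfl fun r hr => ?_
      rw [Finset.mem_Icc] at hr
      simp [show r < n + 1 by omega]
    · simp
  rw [hsplit]
  push_cast
  rw [Finset.sum_congr rfl key, ← integral_finsetSum]
  · refine integral_congr_ae (Filter.Eventually.of_forall fun p => ?_)
    simp only [sobRK]
    rw [← Finset.sum_mul]
    push_cast
    rfl
  · intro r hr
    have hm : Measurable fun p : ℝ × ℝ => ∫ z, sobKer α r p.1 z * sobKer α r p.2 z ∂unitMeas := by
      refine (Measurable.stronglyMeasurable (f := Function.uncurry fun (p : ℝ × ℝ) (z : ℝ) =>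
        sobKer α r p.1 z * sobKer α r p.2 z) ?_).integral_prod_right.measurable
      exact ((hK r).comp ((measurable_fst.comp measurable_fst).prodMk measurable_snd)).mul
        ((hK r).comp ((measurable_snd.comp measurable_fst).prodMk measurable_snd))
    refine Integrable.of_bound ((Complex.measurable_ofReal.comp hm).mul
      ((hwc.comp measurable_fst).mul (hw.comp measurable_snd))).aestronglyMeasurable
      (2 ^ α * 2 ^ α) (Filter.Eventually.of_forall fun p => ?_)
    simp only [norm_mul, Complex.norm_real, norm_wal, mul_one, RCLike.norm_conj]
    refine abs_integral_le_integral_abs.trans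
      (integral_unitMeas_le_of_forall (fun _ _ => abs_nonneg _) fun z hz => ?_)
    have hz' := Set.Ico_subset_Icc_self hz
    rw [abs_mul]
    exact mul_le_mul (abs_sobKer_le α r _ hz') (abs_sobKer_le α r _ hz') (abs_nonneg _)
      (by positivity)

lemma measurable_walDirichlet (M : ℕ) (x x' : ℝ) :
    Measurable fun p : ℝ × ℝ => walDirichlet b M x p.1 x' p.2 := by
  unfold walDirichlet
  refine Measurable.ite ?_ measurable_const measurable_const
  have : {p : ℝ × ℝ | ∀ i < M, (dig b x i + dig b p.2 i) % b = (dig b x' i + dig b p.1 i) % b} =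
      ⋂ i ∈ Finset.range M,
        {p | (dig b x i + dig b p.2 i) % b = (dig b x' i + dig b p.1 i) % b} := by
    ext p; simp
  rw [this]
  refine Finset.measurableSet_biInter _ fun i _ => ?_
  have h1 : Measurable fun p : ℝ × ℝ => (dig b x i + dig b p.2 i) % b :=
    (measurable_from_top (f := fun n : ℕ => (dig b x i + n) % b)).comp
      ((measurable_dig b i).comp measurable_snd)
  have h2 : Measurable fun p : ℝ × ℝ => (dig b x' i + dig b p.1 i) % b :=
    (measurable_from_top (f := fun n : ℕ => (dig b x' i + n) % b)).comp
      ((measurable_dig b i).comp measurable_fst)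
  exact measurableSet_eq_fun h1 h2

lemma abs_walDirichlet_le (M : ℕ) (x y x' y' : ℝ) : |walDirichlet b M x y x' y'| ≤ b ^ M := by
  have := base_pos_real b
  unfold walDirichlet
  split_ifs
  · rw [abs_of_nonneg (by positivity)]
  · rw [abs_zero]; positivity

/-- The partial sums of the Walsh expansion, as an integral against the Dirichlet kernel. -/
lemma sum_walCoef_mul_wal {α : ℕ} (hα : 1 ≤ α) (M : ℕ) (x x' : ℝ) :
    ∑ k ∈ Finset.range (b ^ M), (walCoef b α k : ℂ) * (wal b k x * (starRingEnd ℂ) (wal b k x')) =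
      ((∫ p : ℝ × ℝ, sobRK α p.1 p.2 * walDirichlet b M x p.1 x' p.2
        ∂(unitMeas.prod unitMeas) : ℝ) : ℂ) := by
  rw [← integral_complex_ofReal]
  simp_rw [walCoef_eq_integral_sobRK b hα, ← integral_mul_const]
  rw [← integral_finsetSum]
  · refine integral_congr_ae (Filter.Eventually.of_forall fun p => ?_)
    simp only
    push_cast
    rw [← sum_wal_eq_walDirichlet, Finset.mul_sum]
    exact Finset.sum_congr rfl fun k _ => by ring
  · intro k _
    have hw := measurable_wal b k
    have hwc : Measurable fun y => (starRingEnd ℂ) (wal b k y) :=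
      Complex.continuous_conj.measurable.comp hw
    refine Integrable.mul_const ?_ _
    refine Integrable.of_bound ((Complex.measurable_ofReal.comp (measurable_sobRK_uncurry α)).mul
      ((hwc.comp measurable_fst).mul (hw.comp measurable_snd))).aestronglyMeasurable
      (α * (2 ^ α * 2 ^ α)) (Filter.Eventually.of_forall fun p => ?_)
    simp only [norm_mul, Complex.norm_real, norm_wal, mul_one, RCLike.norm_conj]
    exact abs_sobRK_le α _ _

/-- The kernel averaged over all digital shifts. -/
def shiftKer (α : ℕ) (x x' : ℝ) : ℝ :=
  ∫ σ, sobRK α (digitAdd b x σ) (digitAdd b x' σ) ∂unitMeas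

section

variable {b} {x x' : ℝ} {M₀ : ℕ}

/-- On a shifted point, the Dirichlet kernel is the normalized indicator function of the elementary
interval of the other shifted point. -/
lemma walDirichlet_digitAdd (hx : ∀ i, M₀ ≤ i → dig b x i = 0)
    (hx' : ∀ i, M₀ ≤ i → dig b x' i = 0) {σ y' : ℝ} (hσ : σ ∈ Set.Ico (0 : ℝ) 1)
    (hy' : y' ∈ Set.Ico (0 : ℝ) 1) (M : ℕ) :
    walDirichlet b M x (digitAdd b x σ) x' y' =
      (Set.Ico ((⌊digitAdd b x' σ * b ^ M⌋₊ : ℝ) / b ^ M)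
        ((⌊digitAdd b x' σ * b ^ M⌋₊ + 1) / b ^ M)).indicator (fun _ => (b : ℝ) ^ M) y' := by
  have hb := base_pos_real b
  have hB : (0 : ℝ) < b ^ M := by positivity
  have hz := digitAdd_mem hx' hσ
  have hiff : (∀ i < M, (dig b x i + dig b y' i) % b =
      (dig b x' i + dig b (digitAdd b x σ) i) % b) ↔
      ⌊y' * b ^ M⌋₊ = ⌊digitAdd b x' σ * b ^ M⌋₊ := by
    rw [floor_eq_iff_dig_eq b hy' hz]
    refine forall₂_congr fun i _ => ?_
    rw [dig_digitAdd hx hσ, dig_digitAdd hx' hσ, Nat.add_mod_mod]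
    constructor
    · intro h
      have h1 : dig b x i + dig b y' i ≡ dig b x i + (dig b x' i + dig b σ i) [MOD b] := by
        rw [show dig b x i + (dig b x' i + dig b σ i) =
          dig b x' i + (dig b x i + dig b σ i) by ring]
        exact h
      have h2 : dig b y' i % b = (dig b x' i + dig b σ i) % b := Nat.ModEq.add_left_cancel' _ h1
      rwa [Nat.mod_eq_of_lt (dig_lt b y' i)] at h2
    · intro h
      rw [h, Nat.add_mod_mod]
      congr 1
      ring
  have hcell : ⌊y' * b ^ M⌋₊ = ⌊digitAdd b x' σ * b ^ M⌋₊ ↔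
      y' ∈ Set.Ico ((⌊digitAdd b x' σ * b ^ M⌋₊ : ℝ) / b ^ M)
        ((⌊digitAdd b x' σ * b ^ M⌋₊ + 1) / b ^ M) := by
    rw [Nat.floor_eq_iff (mul_nonneg hy'.1 hB.le), Set.mem_Ico, div_le_iff₀ hB, lt_div_iff₀ hB]
  rw [walDirichlet, Set.indicator_apply]
  exact if_congr (hiff.trans hcell) rfl rfl

/-- The Dirichlet kernel averages the kernel over an elementary interval of length `b^{-M}`, and the
kernel is Lipschitz in its second variable. -/
lemma abs_integral_walDirichlet_sub_le {α : ℕ} (hα : 2 ≤ α)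
    (hx : ∀ i, M₀ ≤ i → dig b x i = 0)
    (hx' : ∀ i, M₀ ≤ i → dig b x' i = 0) (M : ℕ) :
    |∫ p : ℝ × ℝ, sobRK α p.1 p.2 * walDirichlet b M x p.1 x' p.2 ∂(unitMeas.prod unitMeas) -
      shiftKer b α x x'| ≤ α * (2 ^ α * 2 ^ α) * ((b : ℝ) ^ M)⁻¹ := by
  have hb := base_pos_real b
  have hB : (0 : ℝ) < b ^ M := by positivity
  set L : ℝ := α * (2 ^ α * 2 ^ α) with hL
  have hm : Measurable fun p : ℝ × ℝ => sobRK α p.1 p.2 * walDirichlet b M x p.1 x' p.2 :=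
    (measurable_sobRK_uncurry α).mul (measurable_walDirichlet b M x x')
  have hbd : ∀ p : ℝ × ℝ, ‖sobRK α p.1 p.2 * walDirichlet b M x p.1 x' p.2‖ ≤ L * b ^ M := by
    intro p
    rw [norm_mul]
    exact mul_le_mul (abs_sobRK_le α _ _) (abs_walDirichlet_le b M _ _ _ _) (abs_nonneg _)
      (by positivity)
  have hi : Integrable (fun p : ℝ × ℝ => sobRK α p.1 p.2 * walDirichlet b M x p.1 x' p.2)
      (unitMeas.prod unitMeas) :=
    Integrable.of_bound hm.aestronglyMeasurable (L * b ^ M) (Filter.Eventually.of_forall hbd)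
  rw [integral_prod _ hi]
  have hHm : Measurable fun y => ∫ y', sobRK α y y' * walDirichlet b M x y x' y' ∂unitMeas :=
    hm.stronglyMeasurable.integral_prod_right.measurable
  have hHb : ∀ y, |∫ y', sobRK α y y' * walDirichlet b M x y x' y' ∂unitMeas| ≤ L * b ^ M :=
    fun y => abs_integral_le_integral_abs.trans
      (integral_unitMeas_le_of_forall (fun _ _ => abs_nonneg _) fun y' _ => hbd (y, y'))
  -- The first variable is replaced by its shift by `x`.
  rw [← integral_digitAdd hx hHm fun t _ => hHb t, shiftKer, ← integral_sub]
  rotate_left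
  · exact Integrable.of_bound (hHm.comp (measurable_digitAdd b x)).aestronglyMeasurable (L * b ^ M)
      (Filter.Eventually.of_forall fun t => hHb _)
  · exact Integrable.of_bound ((measurable_sobRK_uncurry α).comp
      ((measurable_digitAdd b x).prodMk (measurable_digitAdd b x'))).aestronglyMeasurable L
      (Filter.Eventually.of_forall fun t => abs_sobRK_le α _ _)
  refine abs_integral_le_integral_abs.trans
      (integral_unitMeas_le_of_forall (fun _ _ => abs_nonneg _) fun σ hσ => ?_)
  set y := digitAdd b x σ with hy
  set z := digitAdd b x' σ with hz
  have hzm : z ∈ Set.Ico (0 : ℝ) 1 := digitAdd_mem hx' hσ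
  set n := ⌊z * b ^ M⌋₊ with hn
  set I : Set ℝ := Set.Ico ((n : ℝ) / b ^ M) ((n + 1) / b ^ M) with hI
  have hzI : z ∈ I := by
    rw [hI, Set.mem_Ico, div_le_iff₀ hB, lt_div_iff₀ hB]
    exact ⟨Nat.floor_le (mul_nonneg hzm.1 hB.le), Nat.lt_floor_add_one _⟩
  have hIsub : I ⊆ Set.Ico 0 1 := by
    intro t ht
    refine ⟨le_trans (by positivity) ht.1, ht.2.trans_le ?_⟩
    rw [div_le_one hB]
    have : n < b ^ M := by
      rw [hn, Nat.floor_lt (mul_nonneg hzm.1 hB.le)]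
      push_cast
      exact mul_lt_of_lt_one_left hB hzm.2
    exact_mod_cast this
  have hone : ∫ y', I.indicator (fun _ => (b : ℝ) ^ M) y' ∂unitMeas = 1 := by
    rw [integral_indicator measurableSet_Ico, unitMeas,
      Measure.restrict_restrict measurableSet_Ico, Set.inter_eq_left.2 hIsub, setIntegral_const,
      Measure.real, Real.volume_Ico, ENNReal.toReal_ofReal (by
        rw [← sub_div]; exact div_nonneg (by linarith) hB.le), ← sub_div, smul_eq_mul]
    field_simp
    ring
  have e1 : ∫ y', sobRK α y y' * walDirichlet b M x y x' y' ∂unitMeas - sobRK α y z =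
      ∫ y', (sobRK α y y' - sobRK α y z) * I.indicator (fun _ => (b : ℝ) ^ M) y' ∂unitMeas := by
    have e2 : ∫ y', sobRK α y y' * walDirichlet b M x y x' y' ∂unitMeas =
        ∫ y', sobRK α y y' * I.indicator (fun _ => (b : ℝ) ^ M) y' ∂unitMeas :=
      integral_congr_ae (ae_unitMeas_of_forall fun y' hy' => by
        simp only; rw [hy, walDirichlet_digitAdd hx hx' hσ hy' M])
    have iI : Integrable (I.indicator fun _ => (b : ℝ) ^ M) unitMeas :=
      (integrable_const _).indicator measurableSet_Ico
    simp_rw [sub_mul]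
    rw [integral_sub, integral_const_mul, hone, mul_one, e2]
    · refine Integrable.bdd_mul (c := L) iI ?_ (Filter.Eventually.of_forall fun t =>
        abs_sobRK_le α _ _)
      exact ((measurable_sobRK_uncurry α).comp measurable_prodMk_left).aestronglyMeasurable
    · exact iI.const_mul _
  rw [e1]
  refine abs_integral_le_integral_abs.trans ?_
  calc ∫ y', |(sobRK α y y' - sobRK α y z) * I.indicator (fun _ => (b : ℝ) ^ M) y'| ∂unitMeas
      ≤ ∫ y', L * ((b : ℝ) ^ M)⁻¹ * I.indicator (fun _ => (b : ℝ) ^ M) y' ∂unitMeas := by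
        refine integral_mono_of_nonneg (Filter.Eventually.of_forall fun _ => abs_nonneg _)
          (((integrable_const _).indicator measurableSet_Ico).const_mul _)
          (Filter.Eventually.of_forall fun y' => ?_)
        simp only [Set.indicator_apply]
        split_ifs with h
        · rw [abs_mul, abs_of_pos hB]
          refine mul_le_mul_of_nonneg_right ((abs_sobRK_sub_le hα y y' z).trans ?_) hB.le
          refine mul_le_mul_of_nonneg_left ?_ (by positivity)
          have h1 : ((n : ℝ) + 1) / b ^ M = n / b ^ M + ((b : ℝ) ^ M)⁻¹ := by
            rw [add_div, one_div]
          have h2 := h.1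
          have h3 := h.2
          have h4 := hzI.1
          have h5 := hzI.2
          rw [h1] at h3 h5
          rw [abs_le]
          constructor <;> linarith
        · simp
    _ = _ := by rw [integral_const_mul, hone, mul_one]

/-- The Walsh expansion of the shift-averaged kernel. -/
lemma tendsto_sum_walCoef_mul_wal {α : ℕ} (hα : 2 ≤ α) (hx : ∀ i, M₀ ≤ i → dig b x i = 0)
    (hx' : ∀ i, M₀ ≤ i → dig b x' i = 0) :
    Filter.Tendsto (fun M => ∑ k ∈ Finset.range (b ^ M), (walCoef b α k : ℂ) *
      (wal b k x * (starRingEnd ℂ) (wal b k x'))) Filter.atTop (nhds (shiftKer b α x x' : ℂ)) := by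
  simp_rw [sum_walCoef_mul_wal b (by omega : 1 ≤ α)]
  refine (Complex.continuous_ofReal.tendsto _).comp ?_
  rw [tendsto_iff_norm_sub_tendsto_zero]
  have hb1 : (1 : ℝ) < b := by exact_mod_cast one_lt_base b
  have hlim : Filter.Tendsto (fun M : ℕ => (α * (2 ^ α * 2 ^ α) : ℝ) * ((b : ℝ) ^ M)⁻¹)
      Filter.atTop (nhds ((α * (2 ^ α * 2 ^ α) : ℝ) * 0)) :=
    ((tendsto_inv_atTop_zero).comp (tendsto_pow_atTop_atTop_of_one_lt hb1)).const_mul _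
  rw [mul_zero] at hlim
  exact squeeze_zero (fun M => norm_nonneg _)
    (fun M => abs_integral_walDirichlet_sub_le hα hx hx' M) hlim

end

end ShiftedKernel

section MeanSquare

variable (b : ℕ) [Fact b.Prime] {s : ℕ}

/-! ### The mean square worst-case error in terms of Walsh functions -/

lemma errorPart_nonneg {N : ℕ} (α : ℕ) (P : Fin N → Fin s → ℝ) (u : Finset (Fin s)) :
    0 ≤ errorPart α P u := by
  rw [← sum_integral_errorRep_sq]
  exact Finset.sum_nonneg fun ρ _ => integral_nonneg fun z => sq_nonneg _

/-- The Walsh coefficients with the value `1` for the constant function. -/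
def walWeight (α k : ℕ) : ℝ := if k = 0 then 1 else walCoef b α k

lemma walWeight_nonneg (α k : ℕ) : 0 ≤ walWeight b α k := by
  unfold walWeight
  split_ifs
  · exact zero_le_one
  · exact walCoef_nonneg b α k

/-- The Walsh frequencies below `b ^ M` with support `u`. -/
def freqs (u : Finset (Fin s)) (M : ℕ) : Finset (Fin s → ℕ) :=
  Fintype.piFinset fun j => if j ∈ u then Finset.Ico 1 (b ^ M) else {0}

/-- The exponential sum of the point set `P` belonging to the Walsh frequency `k`. -/
def walSum {N : ℕ} (P : Fin N → Fin s → ℝ) (k : Fin s → ℕ) : ℂ := ∑ n, ∏ j, wal b (k j) (P n j)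

/-- The partial sum of the mean square worst-case error over the Walsh frequencies below `b ^ M`. -/
def walError {N : ℕ} (α : ℕ) (γ : Finset (Fin s) → ℝ≥0) (P : Fin N → Fin s → ℝ) (M : ℕ) : ℝ :=
  ∑ u ∈ Finset.univ.filter (fun u : Finset (Fin s) => u.Nonempty),
    γ u * ∑ k ∈ freqs b u M, (∏ j, walWeight b α (k j)) * ‖(1 / (N : ℂ)) * walSum b P k‖ ^ 2

/-- The diagonal form of the Walsh series is a double sum over the points of the net. -/
lemma sum_freqs_eq {N : ℕ} {α : ℕ} (hα : 1 ≤ α) (P : Fin N → Fin s → ℝ) (u : Finset (Fin s))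
    (M : ℕ) :
    ((∑ k ∈ freqs b u M, (∏ j, walWeight b α (k j)) * ‖(1 / (N : ℂ)) * walSum b P k‖ ^ 2 : ℝ) : ℂ) =
      (1 / (N : ℂ)) ^ 2 * ∑ n, ∑ n', ∏ j ∈ u, ∑ k ∈ Finset.range (b ^ M),
        (walCoef b α k : ℂ) * (wal b k (P n j) * (starRingEnd ℂ) (wal b k (P n' j))) := by
  have h1 : ∀ n n', ∏ j ∈ u, ∑ k ∈ Finset.range (b ^ M),
        (walCoef b α k : ℂ) * (wal b k (P n j) * (starRingEnd ℂ) (wal b k (P n' j))) =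
      ∑ k ∈ freqs b u M, (∏ j, (walWeight b α (k j) : ℂ)) *
        ((∏ j, wal b (k j) (P n j)) * (starRingEnd ℂ) (∏ j, wal b (k j) (P n' j))) := by
    intro n n'
    have e : ∀ k : Fin s → ℕ, (∏ j, (walWeight b α (k j) : ℂ)) *
        ((∏ j, wal b (k j) (P n j)) * (starRingEnd ℂ) (∏ j, wal b (k j) (P n' j))) =
        ∏ j, ((walWeight b α (k j) : ℂ) * (wal b (k j) (P n j) *
          (starRingEnd ℂ) (wal b (k j) (P n' j)))) := by
      intro k
      rw [map_prod, ← Finset.prod_mul_distrib, ← Finset.prod_mul_distrib]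
    simp_rw [e]
    rw [freqs, ← Finset.prod_univ_sum (fun j => if j ∈ u then Finset.Ico 1 (b ^ M) else {0})
      fun j k => (walWeight b α k : ℂ) * (wal b k (P n j) * (starRingEnd ℂ) (wal b k (P n' j)))]
    have e2 : ∀ j, (∑ k ∈ if j ∈ u then Finset.Ico 1 (b ^ M) else {0},
        (walWeight b α k : ℂ) * (wal b k (P n j) * (starRingEnd ℂ) (wal b k (P n' j)))) =
        if j ∈ u then ∑ k ∈ Finset.range (b ^ M),
          (walCoef b α k : ℂ) * (wal b k (P n j) * (starRingEnd ℂ) (wal b k (P n' j))) else 1 := by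
      intro j
      split_ifs
      · rw [Finset.range_eq_Ico, Finset.sum_eq_sum_Ico_succ_bot (pow_pos (base_pos b) M),
          walCoef_zero b hα, Complex.ofReal_zero, zero_mul, zero_add]
        refine Finset.sum_congr rfl fun k hk => ?_
        rw [Finset.mem_Ico] at hk
        rw [walWeight, if_neg (by omega)]
      · simp [walWeight]
    simp_rw [e2]
    rw [Finset.prod_ite_mem, Finset.univ_inter]
  simp_rw [h1]
  push_cast
  have h2 : ∑ n, ∑ n', ∑ k ∈ freqs b u M, (∏ j, (walWeight b α (k j) : ℂ)) *
        ((∏ j, wal b (k j) (P n j)) * (starRingEnd ℂ) (∏ j, wal b (k j) (P n' j))) =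
      ∑ k ∈ freqs b u M, (∏ j, (walWeight b α (k j) : ℂ)) *
        (walSum b P k * (starRingEnd ℂ) (walSum b P k)) := by
    simp_rw [walSum, map_sum, Finset.sum_mul_sum, Finset.mul_sum]
    rw [Finset.sum_comm]
    refine (Finset.sum_congr rfl fun n _ => Finset.sum_comm).trans ?_
    rw [Finset.sum_comm]
    exact Finset.sum_congr rfl fun k _ => Finset.sum_comm
  rw [h2, Finset.mul_sum]
  refine Finset.sum_congr rfl fun k _ => ?_
  rw [Complex.mul_conj, Complex.normSq_eq_norm_sq, norm_mul, norm_div, norm_one,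
    Complex.norm_natCast]
  push_cast
  ring

lemma digitAdd_mem_unitCube {N M₀ : ℕ} {P : Fin N → Fin s → ℝ}
    (hP : ∀ n j i, M₀ ≤ i → dig b (P n j) i = 0) {σ : Fin s → ℝ} (hσ : σ ∈ unitCube (Fin s))
    (n : Fin N) : digitalShift b P σ n ∈ unitCube (Fin s) :=
  fun j _ => digitAdd_mem (hP n j) (hσ j (Set.mem_univ j))

/-- Averaging over all digital shifts acts on each coordinate separately. -/
lemma integral_errorPart {N : ℕ} (α : ℕ) (P : Fin N → Fin s → ℝ) (u : Finset (Fin s)) :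
    Integrable (fun σ => errorPart α (digitalShift b P σ) u)
      (volume.restrict (unitCube (Fin s))) ∧
    ∫ σ in unitCube (Fin s), errorPart α (digitalShift b P σ) u =
      (1 / (N : ℝ)) ^ 2 * ∑ n, ∑ n', ∏ j ∈ u, shiftKer b α (P n j) (P n' j) := by
  have e : ∀ n n' (σ : Fin s → ℝ),
      ∏ j ∈ u, sobRK α (digitalShift b P σ n j) (digitalShift b P σ n' j) =
      tensor (fun j t => if j ∈ u then sobRK α (digitAdd b (P n j) t) (digitAdd b (P n' j) t)
        else 1) σ := by
    intro n n' σ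
    rw [tensor, Finset.prod_ite_mem, Finset.univ_inter]
    rfl
  have hm1 : ∀ n n' j, Measurable fun t => sobRK α (digitAdd b (P n j) t) (digitAdd b (P n' j) t) :=
    fun n n' j => (measurable_sobRK_uncurry α).comp
      ((measurable_digitAdd b (P n j)).prodMk (measurable_digitAdd b (P n' j)))
  have hI : ∀ n n', Integrable (tensor (fun j t => if j ∈ u then
      sobRK α (digitAdd b (P n j) t) (digitAdd b (P n' j) t) else 1))
      (volume.restrict (unitCube (Fin s))) := by
    intro n n'
    rw [restrict_unitCube_eq_pi]
    refine Integrable.fintype_prod (μ := fun _ : Fin s => unitMeas)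
      (f := fun j t => if j ∈ u then sobRK α (digitAdd b (P n j) t) (digitAdd b (P n' j) t) else 1)
      fun j => ?_
    by_cases hj : j ∈ u
    · simp only [hj, if_true]
      exact Integrable.of_bound (hm1 n n' j).aestronglyMeasurable (α * (2 ^ α * 2 ^ α))
        (Filter.Eventually.of_forall fun t => abs_sobRK_le α _ _)
    · simp only [hj, if_false]
      exact integrable_const _
  simp only [errorPart]
  simp_rw [e]
  refine ⟨(integrable_finsetSum _ fun n _ => integrable_finsetSum _ fun n' _ =>
    hI n n').const_mul _, ?_⟩
  rw [integral_const_mul, integral_finsetSum _ fun n _ => integrable_finsetSum _ fun n' _ =>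
    hI n n']
  congr 1
  refine Finset.sum_congr rfl fun n _ => ?_
  rw [integral_finsetSum _ fun n' _ => hI n n']
  refine Finset.sum_congr rfl fun n' _ => ?_
  have e2 : ∀ j, ∫ t, (if j ∈ u then sobRK α (digitAdd b (P n j) t) (digitAdd b (P n' j) t)
      else 1) ∂unitMeas = if j ∈ u then shiftKer b α (P n j) (P n' j) else 1 := by
    intro j
    split_ifs
    · rfl
    · simp
  rw [integral_tensor]
  simp_rw [e2]
  rw [Finset.prod_ite_mem, Finset.univ_inter]

/-- The mean square worst-case error is bounded by the limit of its Walsh partial sums. -/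
theorem meanSquareError_le_of_walError_le {N : ℕ} (hN : N ≠ 0) {α : ℕ} (hα : 2 ≤ α)
    (γ : Finset (Fin s) → ℝ≥0) {P : Fin N → Fin s → ℝ} {M₀ : ℕ}
    (hP : ∀ n j i, M₀ ≤ i → dig b (P n j) i = 0) {C : ℝ≥0∞}
    (hC : ∀ M, ENNReal.ofReal (walError b α γ P M) ≤ C) : meanSquareError b α γ P ≤ C := by
  set Φ : (Fin s → ℝ) → ℝ := fun σ => ∑ u ∈ Finset.univ.filter
    (fun u : Finset (Fin s) => u.Nonempty), γ u * errorPart α (digitalShift b P σ) u with hΦ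
  have hI := integral_errorPart b α P
  have hΦi : Integrable Φ (volume.restrict (unitCube (Fin s))) :=
    integrable_finsetSum _ fun u _ => (hI u).1.const_mul _
  have hΦ0 : ∀ σ, 0 ≤ Φ σ := fun σ =>
    Finset.sum_nonneg fun u _ => mul_nonneg (γ u).2 (errorPart_nonneg α _ u)
  have h1 : meanSquareError b α γ P ≤ ENNReal.ofReal (∫ σ in unitCube (Fin s), Φ σ) := by
    rw [ofReal_integral_eq_lintegral_ofReal hΦi (Filter.Eventually.of_forall hΦ0)]
    refine setLIntegral_mono' (measurableSet_unitCube _) fun σ hσ => ?_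
    exact worstCaseError_sq_le hN hα γ fun n => digitAdd_mem_unitCube b hP hσ n
  have h2 : ∫ σ in unitCube (Fin s), Φ σ = ∑ u ∈ Finset.univ.filter
      (fun u : Finset (Fin s) => u.Nonempty), γ u * ((1 / (N : ℝ)) ^ 2 *
        ∑ n, ∑ n', ∏ j ∈ u, shiftKer b α (P n j) (P n' j)) := by
    rw [hΦ, integral_finsetSum _ fun u _ => (hI u).1.const_mul _]
    exact Finset.sum_congr rfl fun u _ => by rw [integral_const_mul, (hI u).2]
  have h3 : Filter.Tendsto (fun M => walError b α γ P M) Filter.atTop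
      (nhds (∫ σ in unitCube (Fin s), Φ σ)) := by
    have h4 : Filter.Tendsto (fun M => (walError b α γ P M : ℂ)) Filter.atTop
        (nhds ((∫ σ in unitCube (Fin s), Φ σ : ℝ) : ℂ)) := by
      rw [h2]
      simp only [walError, Complex.ofReal_sum, Complex.ofReal_mul]
      refine tendsto_finsetSum _ fun u _ => Filter.Tendsto.const_mul _ ?_
      simp_rw [← Complex.ofReal_mul, ← Complex.ofReal_sum]
      simp_rw [sum_freqs_eq b (by omega : 1 ≤ α)]
      push_cast
      refine Filter.Tendsto.const_mul _ (tendsto_finsetSum _ fun n _ =>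
        tendsto_finsetSum _ fun n' _ =>
        tendsto_finsetProd _ fun j _ => ?_)
      exact tendsto_sum_walCoef_mul_wal hα (hP n j) (hP n' j)
    exact (Complex.continuous_re.tendsto _).comp h4
  exact h1.trans (le_of_tendsto' ((ENNReal.continuous_ofReal.tendsto _).comp h3) hC)

end MeanSquare

section Interlacing

variable (b : ℕ) [Fact b.Prime]

/-! ### Deinterlacing and digit weights -/

omit [Fact b.Prime] in
lemma sum_digits_lt {c : ℕ → ℕ} (hc : ∀ i, c i < b) (n : ℕ) :
    ∑ i ∈ Finset.range n, c i * b ^ i < b ^ n := by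
  induction n with
  | zero => simp
  | succ n ih => rw [Finset.sum_range_succ]; exact lt_pow_succ_of_digit b ih (hc n)

lemma add_mul_pow_div_mod {x c n i : ℕ} (hi : i < n) :
    (x + c * b ^ n) / b ^ i % b = x / b ^ i % b := by
  have e : c * b ^ n = b ^ i * (b * (c * b ^ (n - i - 1))) := by
    have h : b ^ n = b ^ i * (b * b ^ (n - i - 1)) := by
      rw [← pow_succ', ← pow_add]
      congr 1
      omega
    rw [h]; ring
  rw [e, Nat.add_mul_div_left _ _ (pow_pos (base_pos b) i), Nat.add_mul_mod_self_left]

lemma sum_digits_div_mod {c : ℕ → ℕ} (hc : ∀ i, c i < b) (n a : ℕ) :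
    (∑ i ∈ Finset.range n, c i * b ^ i) / b ^ a % b = if a < n then c a else 0 := by
  induction n with
  | zero => simp
  | succ n ih =>
    rw [Finset.sum_range_succ]
    rcases lt_trichotomy a n with h | rfl | h
    · rw [add_mul_pow_div_mod b h, ih, if_pos h, if_pos (by omega)]
    · rw [if_pos (by omega), mul_comm, Nat.add_mul_div_left _ _ (pow_pos (base_pos b) a),
        Nat.div_eq_of_lt (sum_digits_lt b hc a), zero_add, Nat.mod_eq_of_lt (hc a)]
    · rw [if_neg (by omega), Nat.div_eq_of_lt, Nat.zero_mod]
      exact (lt_pow_succ_of_digit b (sum_digits_lt b hc n) (hc n)).trans_le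
        (Nat.pow_le_pow_right (base_pos b) (by omega))

/-- The `r`-th of the `d` numbers from which the digits of `k` are interlaced. Its digits beyond
the position `k` vanish. -/
def deint (d r k : ℕ) : ℕ := ∑ a ∈ Finset.range k, (k / b ^ (r + a * d) % b) * b ^ a

lemma div_pow_eq_zero {k i : ℕ} (h : k ≤ i) : k / b ^ i = 0 :=
  Nat.div_eq_of_lt ((Nat.lt_pow_self (one_lt_base b)).trans_le
    (Nat.pow_le_pow_right (base_pos b) h))

variable {b} {d : ℕ}

lemma deint_div_mod (hd : 0 < d) (r k a : ℕ) :
    deint b d r k / b ^ a % b = k / b ^ (r + a * d) % b := by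
  rw [deint, sum_digits_div_mod b (fun i => Nat.mod_lt _ (base_pos b))]
  split_ifs with h
  · rfl
  · have : a ≤ a * d := Nat.le_mul_of_pos_right a hd
    rw [div_pow_eq_zero b (by omega), Nat.zero_mod]

omit [Fact b.Prime] in
@[simp] lemma deint_zero (d r : ℕ) : deint b d r 0 = 0 := by simp [deint]

/-- A number is determined by its deinterlaced components. -/
lemma eq_of_deint_eq (hd : 0 < d) {k k' : ℕ} (h : ∀ r : Fin d, deint b d r k = deint b d r k') :
    k = k' := by
  have hlt : ∀ n, n ≤ k + k' → n < b ^ (k + k') := fun n hn =>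
    (Nat.lt_pow_self (one_lt_base b)).trans_le (Nat.pow_le_pow_right (base_pos b) hn)
  refine eq_of_digit_eq (hlt k (by omega)) (hlt k' (by omega)) fun j _ => ?_
  have h1 := h ⟨j % d, Nat.mod_lt j hd⟩
  have h2 := deint_div_mod (b := b) hd (j % d) k (j / d)
  have h3 := deint_div_mod (b := b) hd (j % d) k' (j / d)
  simp only at h1
  rw [h1, h3, Nat.mod_add_div' j d] at h2
  exact h2.symm

lemma exists_deint_ne_zero (hd : 0 < d) {k : ℕ} (hk : k ≠ 0) : ∃ r : Fin d, deint b d r k ≠ 0 := by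
  by_contra! h
  exact hk (eq_of_deint_eq (b := b) hd fun r => by rw [h r, deint_zero])

lemma le_log_of_digit_ne_zero {k i : ℕ} (h : k / b ^ i % b ≠ 0) : i ≤ Nat.log b k := by
  by_contra! hlt
  rw [Nat.div_eq_of_lt (Nat.lt_pow_of_log_lt (one_lt_base b) hlt), Nat.zero_mod] at h
  exact h rfl

lemma digit_log_ne_zero {k : ℕ} (hk : k ≠ 0) : k / b ^ Nat.log b k % b ≠ 0 := by
  have h1 : 0 < k / b ^ Nat.log b k :=
    Nat.div_pos (Nat.pow_log_le_self b hk) (pow_pos (base_pos b) _)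
  have h2 : k / b ^ Nat.log b k < b := by
    rw [Nat.div_lt_iff_lt_mul (pow_pos (base_pos b) _), mul_comm, ← pow_succ]
    exact lt_pow_topPos b k
  rw [Nat.mod_eq_of_lt h2]
  exact h1.ne'

lemma lowPart_div_mod (k : ℕ) {i : ℕ} (hi : i < Nat.log b k) :
    lowPart b k / b ^ i % b = k / b ^ i % b := by
  have h := add_mul_pow_div_mod b (x := lowPart b k) (c := k / b ^ Nat.log b k) hi
  rw [← h, lowPart, Nat.mod_add_div']

/-- The sum of at most `α` positions of nonzero digits is at most the sum of the `α` largest. -/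
lemma sum_le_topWeight {α k : ℕ} {S : Finset ℕ} (hS : ∀ i ∈ S, k / b ^ i % b ≠ 0)
    (hc : S.card ≤ α) : ∑ i ∈ S, (i + 1) ≤ topWeight b α k := by
  induction α generalizing k S with
  | zero =>
    rw [Nat.le_zero, Finset.card_eq_zero] at hc
    simp [hc]
  | succ α ih =>
    rcases S.eq_empty_or_nonempty with rfl | hne
    · simp
    have hk : k ≠ 0 := by
      rintro rfl
      obtain ⟨i, hi⟩ := hne
      exact hS i hi (by simp)
    have hmax := S.max'_mem hne
    rw [topWeight_succ b hk, ← Finset.add_sum_erase S _ hmax, topPos]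
    refine add_le_add (Nat.succ_le_succ (le_log_of_digit_ne_zero (hS _ hmax))) (ih ?_ ?_)
    · intro i hi
      rw [Finset.mem_erase] at hi
      have h1 : i < S.max' hne := lt_of_le_of_ne (S.le_max' i hi.2) hi.1
      rw [lowPart_div_mod k (h1.trans_le (le_log_of_digit_ne_zero (hS _ hmax)))]
      exact hS i hi.2
    · rw [Finset.card_erase_of_mem hmax]; omega

/-- Among the subsets with `a` elements there is one whose average is at least the average over the
whole set. -/
lemma exists_subset_card_mul_sum_le {ι : Type*} [DecidableEq ι] (W : Finset ι) (f : ι → ℕ) {a : ℕ}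
    (ha : a ≤ W.card) : ∃ V ⊆ W, V.card = a ∧ a * ∑ i ∈ W, f i ≤ W.card * ∑ i ∈ V, f i := by
  induction hn : W.card generalizing W with
  | zero => exact ⟨∅, by simp, by simp; omega, by simp [show a = 0 by omega]⟩
  | succ n ih =>
    rcases ha.eq_or_lt with h | h
    · exact ⟨W, subset_rfl, h.symm, by rw [← hn, h]⟩
    · obtain ⟨x, hx, hmin⟩ := W.exists_min_image f (Finset.card_pos.1 (by omega))
      have hcard := Finset.card_erase_of_mem hx
      obtain ⟨V, hV, hVc, hVs⟩ := ih (W.erase x) (by omega) (by omega)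
      refine ⟨V, hV.trans (Finset.erase_subset _ _), hVc, ?_⟩
      have h1 : a * f x ≤ ∑ i ∈ V, f i := by
        rw [← hVc, ← smul_eq_mul]
        exact Finset.card_nsmul_le_sum V f _ fun i hi => hmin i (Finset.mem_of_mem_erase (hV hi))
      rw [← Finset.add_sum_erase W f hx, mul_add, add_mul, one_mul]
      omega

lemma card_mul_succ_le_sum (W : Finset ℕ) : W.card * (W.card + 1) ≤ 2 * ∑ i ∈ W, (i + 1) := by
  induction W using Finset.induction_on_max with
  | empty => simp
  | insert a W hlt ih =>
    have ha : a ∉ W := fun h => lt_irrefl _ (hlt a h)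
    have hc : W.card ≤ a := by
      have := Finset.card_le_card (s := W) (t := Finset.range a) fun x hx =>
        Finset.mem_range.2 (hlt x hx)
      simpa using this
    rw [Finset.card_insert_of_notMem ha, Finset.sum_insert ha]
    nlinarith

variable (b d) in
/-- The indices of the nonzero deinterlaced components of `k`. -/
def deintSupp (k : ℕ) : Finset (Fin d) := Finset.univ.filter fun r : Fin d => deint b d r k ≠ 0

omit [Fact b.Prime] in
lemma mem_deintSupp {k : ℕ} {r : Fin d} : r ∈ deintSupp b d k ↔ deint b d r k ≠ 0 := by
  simp [deintSupp]

/-- The interlacing inequality: up to a constant, the weight of a number dominates `min(α, d)` times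
the sum of the leading positions of its deinterlaced components. If more than `α` components are
nonzero, the leading digits of the best `α` of them are used. -/
lemma sum_topPos_deint_le (hd : 0 < d) (α k : ℕ) :
    2 * min α d * ∑ r ∈ deintSupp b d k, topPos b (deint b d r k) +
      α * (deintSupp b d k).card ≤
      2 * topWeight b α k + (2 * d - 1) * α := by
  set W := deintSupp b d k with hW
  -- The position in `k` of the leading digit of the `r`-th component.
  set p : Fin d → ℕ := fun r => r + Nat.log b (deint b d r k) * d with hp
  have hinj : Function.Injective p := by
    intro r r' h
    simp only [hp] at h
    have h1 := congrArg (· % d) h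
    simp only [Nat.add_mul_mod_self_right, Nat.mod_eq_of_lt r.2, Nat.mod_eq_of_lt r'.2] at h1
    exact Fin.ext h1
  have hV : ∀ V ⊆ W, V.card ≤ α → ∑ r ∈ V, (p r + 1) ≤ topWeight b α k := by
    intro V hVW hc
    rw [← Finset.sum_image (f := fun i => i + 1) (g := p) hinj.injOn]
    refine sum_le_topWeight (fun i hi => ?_) (Finset.card_image_le.trans hc)
    rw [Finset.mem_image] at hi
    obtain ⟨r, hr, rfl⟩ := hi
    have h1 := mem_deintSupp.1 (hVW hr)
    rw [hp, ← deint_div_mod hd]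
    exact digit_log_ne_zero h1
  obtain ⟨V, hVW, hVc, hVs⟩ := exists_subset_card_mul_sum_le W (fun r => p r + 1)
    (min_le_right α W.card)
  have hVT := hV V hVW (by omega)
  have hFT := hV W subset_rfl
  have hn : W.card ≤ d := by simpa using Finset.card_le_univ W
  have hF : ∑ r ∈ W, (p r + 1) + d * W.card =
      ∑ r ∈ W, ((r : ℕ) + 1) + d * ∑ r ∈ W, topPos b (deint b d r k) := by
    rw [Finset.mul_sum, mul_comm d, ← smul_eq_mul, ← Finset.sum_const, ← Finset.sum_add_distrib,
      ← Finset.sum_add_distrib]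
    refine Finset.sum_congr rfl fun r _ => ?_
    simp only [hp, topPos]
    ring
  have hQ : W.card * (W.card + 1) ≤ 2 * ∑ r ∈ W, ((r : ℕ) + 1) := by
    have h1 := card_mul_succ_le_sum (W.map Fin.valEmbedding)
    rwa [Finset.card_map, Finset.sum_map] at h1
  have ht : W.card ≤ ∑ r ∈ W, topPos b (deint b d r k) := by
    rw [Finset.card_eq_sum_ones]
    exact Finset.sum_le_sum fun r _ => Nat.succ_le_succ (Nat.zero_le _)
  generalize ∑ r ∈ W, topPos b (deint b d r k) = t at *
  generalize ∑ r ∈ W, (p r + 1) = F at *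
  generalize ∑ r ∈ W, ((r : ℕ) + 1) = Q at *
  generalize ∑ r ∈ V, (p r + 1) = FV at *
  generalize topWeight b α k = T at *
  generalize W.card = n at *
  obtain ⟨e, rfl⟩ : ∃ e, d = e + 1 := ⟨d - 1, by omega⟩
  rw [show 2 * (e + 1) - 1 = 2 * e + 1 by omega]
  clear hinj hV hVc hVW hp
  zify at *
  rcases le_or_gt n α with hnα | hnα
  · -- At most `α` components: the leading digits of all of them are used.
    have hFT' : (F : ℤ) ≤ T := hFT (by exact_mod_cast hnα)
    rcases le_or_gt (e + 1) α with hdα | hdα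
    · rw [min_eq_right (by exact_mod_cast hdα)]
      have h1 : (0 : ℤ) ≤ (α - n) * (2 * e + 1 - n) :=
        mul_nonneg (by zify at hnα; linarith) (by linarith)
      nlinarith
    · rw [min_eq_left (by exact_mod_cast hdα.le)]
      zify at hdα hnα
      have h1 : (0 : ℤ) ≤ (α - n) * (2 * α - n) := mul_nonneg (by linarith) (by linarith)
      have h2 : (0 : ℤ) ≤ (e - α) * α := mul_nonneg (by linarith) (by linarith)
      have h3 : (0 : ℤ) ≤ (e + 1 - α) * (t - n) := mul_nonneg (by linarith) (by linarith)
      nlinarith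
  · -- More than `α` components: those in `V` are used.
    have hdα : α ≤ e + 1 := by omega
    rw [min_eq_left (by exact_mod_cast hdα)]
    rw [min_eq_left (by exact_mod_cast hnα.le)] at hVs
    have h0 : (0 : ℤ) < n := by exact_mod_cast (Nat.zero_le α).trans_lt hnα
    have h1 : (0 : ℤ) ≤ α * ((e + 1 - n) * t) :=
      mul_nonneg (Nat.cast_nonneg _) (mul_nonneg (by linarith) (Nat.cast_nonneg _))
    have h2 : (n : ℤ) * FV ≤ n * T := mul_le_mul_of_nonneg_left hVT h0.le
    have h3 : (α : ℤ) * (n * (n + 1)) ≤ α * (2 * Q) :=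
      mul_le_mul_of_nonneg_left hQ (Nat.cast_nonneg _)
    have h4 : (α : ℤ) * (F + (e + 1) * n) = α * (Q + (e + 1) * t) := by rw [hF]
    refine le_of_mul_le_mul_left ?_ h0
    nlinarith

variable (b) in
lemma dickWeight_one {l : ℕ} (hl : l ≠ 0) : dickWeight b 1 l = topPos b l := by
  rw [dickWeight, Nat.length_digits b l (one_lt_base b) hl, List.range_succ, List.reverse_append]
  simp [digit_log_ne_zero hl, topPos]

lemma prod_rFun_deint (α d k : ℕ) :
    ∏ r : Fin d, rFun b α d (deint b d r k) =
      ((b : ℝ) ^ (2 * min α d * ∑ r ∈ deintSupp b d k, topPos b (deint b d r k) +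
      α * (deintSupp b d k).card))⁻¹ := by
  set W := deintSupp b d k with hW
  have h1 : ∏ r : Fin d, rFun b α d (deint b d r k) = ∏ r ∈ W, rFun b α d (deint b d r k) := by
    symm
    refine Finset.prod_subset (Finset.subset_univ _) fun r _ hr => ?_
    have : deint b d r k = 0 := by
      by_contra h
      exact hr (mem_deintSupp.2 h)
    rw [rFun, if_pos this]
  have h2 : ∀ r ∈ W, rFun b α d (deint b d r k) =
      ((b : ℝ) ^ (2 * min α d * topPos b (deint b d r k) + α))⁻¹ := by
    intro r hr
    have hr0 := mem_deintSupp.1 hr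
    rw [rFun, if_neg hr0, dickWeight_one b hr0, zpow_neg]
    exact_mod_cast congrArg Inv.inv <|
      zpow_natCast (b : ℝ) (2 * min α d * topPos b (deint b d r k) + α)
  rw [h1, Finset.prod_congr rfl h2, Finset.prod_inv_distrib, Finset.prod_pow_eq_pow_sum,
    Finset.sum_add_distrib, ← Finset.mul_sum, Finset.sum_const, smul_eq_mul, mul_comm α]

/-- The Walsh coefficients in terms of the deinterlaced frequencies. -/
lemma walCoef_le_prod_rFun {α : ℕ} (hα : 1 ≤ α) (hd : 0 < d) {k : ℕ} (hk : k ≠ 0) :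
    walCoef b α k ≤ constDtilde b α d * ∏ r : Fin d, rFun b α d (deint b d r k) := by
  have hb := base_pos_real b
  have hb1 : (1 : ℝ) ≤ b := by exact_mod_cast (one_lt_base b).le
  refine (walCoef_le b hα hk).trans ?_
  rw [prod_rFun_deint, constDtilde, mul_comm ((b : ℝ) ^ _), mul_assoc]
  refine mul_le_mul_of_nonneg_left ?_ (constD_pos b hα).le
  rw [← div_eq_mul_inv, le_div_iff₀ (by positivity), inv_pow, inv_mul_le_iff₀ (by positivity),
    ← pow_mul, ← pow_add]
  refine pow_le_pow_right₀ hb1 ?_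
  have := sum_topPos_deint_le (b := b) hd α k
  rw [mul_comm (topWeight b α k)]
  exact this

end Interlacing

section DualNet

variable (b : ℕ) [Fact b.Prime]

/-! ### Digits of interlaced polynomial lattice points -/

lemma dig_sum_div_pow {c : ℕ → ℕ} (hc : ∀ i, c i < b) (M i : ℕ) :
    dig b (∑ i ∈ Finset.range M, (c i : ℝ) / (b : ℝ) ^ (i + 1)) i = if i < M then c i else 0 := by
  set a : ℕ → Fin b := fun i => if i < M then ⟨c i, hc i⟩ else 0 with ha
  have hval : ∀ i, (a i : ℕ) = if i < M then c i else 0 := fun i => by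
    simp only [ha]; split_ifs <;> simp
  have e : ∑ i ∈ Finset.range M, (c i : ℝ) / (b : ℝ) ^ (i + 1) = Real.ofDigits a := by
    rw [Real.ofDigits, tsum_eq_sum (s := Finset.range M)]
    · refine Finset.sum_congr rfl fun i hi => ?_
      rw [Real.ofDigitsTerm, hval, if_pos (Finset.mem_range.1 hi), div_eq_mul_inv]
    · intro i hi
      rw [Real.ofDigitsTerm, hval, if_neg (by simpa using hi)]
      simp
  rw [e, dig_ofDigits b (ofDigits_tail_lt_one_of_eventually_zero b (M₀ := M) fun i hi => ?_), hval]
  simp [ha, not_lt.2 hi]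

lemma laurentTrunc_eq (m : ℕ) (L : LaurentSeries (ZMod b)) :
    laurentTrunc b m L =
      ∑ i ∈ Finset.range m, ((L.coeff ((i : ℤ) + 1)).val : ℝ) / (b : ℝ) ^ (i + 1) := by
  have h := Finset.sum_Ico_add' (fun l : ℕ => ((L.coeff (l : ℤ)).val : ℝ) / (b : ℝ) ^ l) 0 m 1
  push_cast at h
  rw [laurentTrunc, Finset.range_eq_Ico, h]
  rfl

lemma dig_laurentTrunc (m : ℕ) (L : LaurentSeries (ZMod b)) (i : ℕ) :
    dig b (laurentTrunc b m L) i = if i < m then (L.coeff ((i : ℤ) + 1)).val else 0 := by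
  rw [laurentTrunc_eq]
  exact dig_sum_div_pow b (c := fun i => (L.coeff ((i : ℤ) + 1)).val) (fun i => ZMod.val_lt _) m i

/-- The digit of an interlaced number at position `r + a d` is the digit at position `a` of
component `r`. -/
lemma dig_interlace {d m : ℕ} {y : Fin d → ℝ} (hy : ∀ r i, m ≤ i → dig b (y r) i = 0)
    (hd : 0 < d) (i : ℕ) :
    dig b (interlace b y) i = dig b (y ⟨i % d, Nat.mod_lt i hd⟩) (i / d) := by
  have e : interlace b y = ∑ i ∈ Finset.range (d * m),
      ((dig b (y ⟨i % d, Nat.mod_lt i hd⟩) (i / d) : ℕ) : ℝ) / (b : ℝ) ^ (i + 1) := by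
    rw [sum_range_mul_eq, interlace, tsum_eq_sum (s := Finset.range m)]
    · refine Finset.sum_congr rfl fun a _ => ?_
      rw [Finset.sum_range]
      refine Finset.sum_congr rfl fun r _ => ?_
      have h1 : ((r : ℕ) + a * d) % d = r := by
        rw [Nat.add_mul_mod_self_right, Nat.mod_eq_of_lt r.2]
      have h2 : ((r : ℕ) + a * d) / d = a := by
        rw [Nat.add_mul_div_right _ _ hd, Nat.div_eq_of_lt r.2, zero_add]
      have h3 : (⟨((r : ℕ) + a * d) % d, Nat.mod_lt _ hd⟩ : Fin d) = r := Fin.ext h1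
      rw [h3, h2, dig, add_right_comm]
    · intro a ha
      refine Finset.sum_eq_zero fun r _ => ?_
      have := hy r a (by simpa using ha)
      rw [dig] at this
      rw [this]; simp
  rw [e, dig_sum_div_pow b (c := fun i => dig b (y ⟨i % d, Nat.mod_lt i hd⟩) (i / d))
    (fun i => dig_lt b _ _)]
  split_ifs with h
  · rfl
  · rw [hy]
    rw [Nat.le_div_iff_mul_le hd, mul_comm]
    omega

lemma wal_eq_prod_of_dig_eq_zero {x : ℝ} {M : ℕ} (hx : ∀ i, M ≤ i → dig b x i = 0) (k : ℕ) :
    wal b k x = rootU b ^ ∑ i ∈ Finset.range M, k / b ^ i % b * dig b x i := by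
  have hk : k < b ^ (k + M) := (Nat.lt_pow_self (one_lt_base b)).trans_le
    (Nat.pow_le_pow_right (base_pos b) (by omega))
  rw [wal_eq_prod b hk, ← Finset.prod_pow_eq_pow_sum]
  refine (Finset.prod_subset (Finset.range_mono (by omega)) fun i _ hi => ?_).symm
  rw [hx i (by simpa using hi)]
  simp

/-! ### Polynomials as Laurent series -/

lemma sum_digits_C_mul_X_pow {n A B : ℕ} (hn : n < b ^ A) (hAB : A ≤ B) :
    ∑ i ∈ Finset.range A, Polynomial.C ((n / b ^ i % b : ℕ) : ZMod b) * Polynomial.X ^ i =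
      ∑ i ∈ Finset.range B, Polynomial.C ((n / b ^ i % b : ℕ) : ZMod b) * Polynomial.X ^ i := by
  refine Finset.sum_subset (Finset.range_mono hAB) fun i _ hi => ?_
  have hi' : A ≤ i := by simpa using hi
  rw [Nat.div_eq_of_lt (hn.trans_le (Nat.pow_le_pow_right (base_pos b) hi'))]
  simp

lemma truncPoly_eq (m k : ℕ) : truncPoly b m k =
    ∑ i ∈ Finset.range m, Polynomial.C ((k / b ^ i % b : ℕ) : ZMod b) * Polynomial.X ^ i := by
  rw [truncPoly]
  rcases le_total (Nat.digits b k).length m with h | h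
  · rw [min_eq_left h]
    exact sum_digits_C_mul_X_pow b (Nat.lt_base_pow_length_digits (one_lt_base b)) h
  · rw [min_eq_right h]

lemma natPoly_eq_truncPoly {m n : ℕ} (hn : n < b ^ m) : natPoly b n = truncPoly b m n := by
  rw [truncPoly_eq, natPoly, sum_digits_C_mul_X_pow b
    (Nat.lt_base_pow_length_digits (one_lt_base b)) (le_max_left _ m),
    sum_digits_C_mul_X_pow b hn (le_max_right _ m)]

lemma toLaurent_C_mul_X_pow (c : ZMod b) (i : ℕ) :
    toLaurent b (Polynomial.C c * Polynomial.X ^ i) = HahnSeries.single (-(i : ℤ)) c := by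
  rw [toLaurent, map_mul, Polynomial.aeval_C, map_pow, Polynomial.aeval_X, HahnSeries.single_pow,
    one_pow]
  have h : algebraMap (ZMod b) (LaurentSeries (ZMod b)) c = HahnSeries.single 0 c := by
    rw [HahnSeries.algebraMap_apply']
    simp
  rw [h, HahnSeries.single_mul_single]
  simp

lemma toLaurent_mul (f g : Polynomial (ZMod b)) :
    toLaurent b (f * g) = toLaurent b f * toLaurent b g := map_mul _ f g

lemma toLaurent_add (f g : Polynomial (ZMod b)) :
    toLaurent b (f + g) = toLaurent b f + toLaurent b g := map_add _ f g

lemma toLaurent_sum {ι : Type*} (s : Finset ι) (f : ι → Polynomial (ZMod b)) :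
    toLaurent b (∑ i ∈ s, f i) = ∑ i ∈ s, toLaurent b (f i) := map_sum _ f s

lemma coeff_toLaurent (f : Polynomial (ZMod b)) (z : ℤ) : (toLaurent b f).coeff z =
    ∑ i ∈ Finset.range (f.natDegree + 1), if z = -(i : ℤ) then f.coeff i else 0 := by
  conv_lhs => rw [f.as_sum_range_C_mul_X_pow, toLaurent_sum, HahnSeries.coeff_sum]
  refine Finset.sum_congr rfl fun i _ => ?_
  rw [toLaurent_C_mul_X_pow]
  split_ifs with h
  · rw [h, HahnSeries.coeff_single_same]
  · rw [HahnSeries.coeff_single_of_ne h]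

lemma coeff_toLaurent_of_pos (f : Polynomial (ZMod b)) {z : ℤ} (hz : 0 < z) :
    (toLaurent b f).coeff z = 0 := by
  rw [coeff_toLaurent]
  exact Finset.sum_eq_zero fun i _ => if_neg (by omega)

lemma coeff_toLaurent_natDegree_ne_zero {f : Polynomial (ZMod b)} (hf : f ≠ 0) :
    (toLaurent b f).coeff (-(f.natDegree : ℤ)) ≠ 0 := by
  rw [coeff_toLaurent, Finset.sum_eq_single f.natDegree, if_pos rfl]
  · exact Polynomial.leadingCoeff_ne_zero.2 hf
  · intro i _ hi
    exact if_neg (by omega)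
  · simp

lemma toLaurent_ne_zero {f : Polynomial (ZMod b)} (hf : f ≠ 0) : toLaurent b f ≠ 0 := fun h =>
  coeff_toLaurent_natDegree_ne_zero b hf (by rw [h]; rfl)

lemma order_toLaurent {f : Polynomial (ZMod b)} (hf : f ≠ 0) :
    (toLaurent b f).order = -(f.natDegree : ℤ) := by
  refine le_antisymm
    (HahnSeries.order_le_of_coeff_ne_zero (coeff_toLaurent_natDegree_ne_zero b hf)) ?_
  by_contra! h
  refine HahnSeries.coeff_order_eq_zero.not.2 (toLaurent_ne_zero b hf) ?_
  rw [coeff_toLaurent]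
  refine Finset.sum_eq_zero fun i hi => if_neg ?_
  have := Finset.mem_range.1 hi
  omega

/-- A rational function is a polynomial as soon as the first `deg p` coefficients of its expansion
at infinity following the polynomial part vanish, `p` being a denominator. -/
lemma dvd_of_coeff_eq_zero {f p : Polynomial (ZMod b)} (hp : p ≠ 0)
    (h : ∀ i < p.natDegree, (toLaurent b f / toLaurent b p).coeff ((i : ℤ) + 1) = 0) : p ∣ f := by
  have hp' := toLaurent_ne_zero b hp
  by_contra hdvd
  have hr : f % p ≠ 0 := fun h0 => hdvd (EuclideanDomain.mod_eq_zero.1 h0)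
  set R := toLaurent b (f % p) / toLaurent b p with hR
  have e : toLaurent b f / toLaurent b p = toLaurent b (f / p) + R := by
    conv_lhs => rw [← EuclideanDomain.div_add_mod f p]
    rw [toLaurent_add, toLaurent_mul, add_div, mul_div_cancel_left₀ _ hp']
  have hdeg : (f % p).natDegree < p.natDegree :=
    Polynomial.natDegree_lt_natDegree hr (Polynomial.degree_mod_lt f hp)
  have hR0 : R ≠ 0 := div_ne_zero (toLaurent_ne_zero b hr) hp'
  have horder : R.order = p.natDegree - (f % p).natDegree := by
    have h1 : R * toLaurent b p = toLaurent b (f % p) := div_mul_cancel₀ _ hp'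
    have h2 := congrArg HahnSeries.order h1
    rw [HahnSeries.order_mul hR0 hp', order_toLaurent b hp, order_toLaurent b hr] at h2
    omega
  have h3 := h (p.natDegree - (f % p).natDegree - 1) (by omega)
  rw [show (((p.natDegree - (f % p).natDegree - 1 : ℕ) : ℤ) + 1) = R.order by omega, e,
    HahnSeries.coeff_add, coeff_toLaurent_of_pos b _ (by omega), zero_add] at h3
  exact hR0 (HahnSeries.coeff_order_eq_zero.1 h3)

/-- The residue of a product with a polynomial is the inner product of digits that defines Walsh
functions on a digital net. -/
lemma coeff_one_toLaurent_truncPoly_mul (m l : ℕ) (L : LaurentSeries (ZMod b)) :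
    (toLaurent b (truncPoly b m l) * L).coeff 1 =
      ∑ a ∈ Finset.range m, ((l / b ^ a % b : ℕ) : ZMod b) * L.coeff ((a : ℤ) + 1) := by
  rw [truncPoly_eq, toLaurent_sum, Finset.sum_mul, HahnSeries.coeff_sum]
  refine Finset.sum_congr rfl fun a _ => ?_
  rw [toLaurent_C_mul_X_pow, HahnSeries.coeff_single_mul]
  congr 2
  ring

/-! ### Character sums over the dual net -/

lemma rootU_pow_congr {A B : ℕ} (h : (A : ZMod b) = B) : rootU b ^ A = rootU b ^ B := by
  rw [← rootU_pow_mod b A, ← rootU_pow_mod b B]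
  congr 1
  exact (ZMod.natCast_eq_natCast_iff' A B b).1 h

/-- The sum of a nontrivial character of `𝔽_b^m`, whose elements are written as numbers
`n < b^m`, vanishes. -/
lemma sum_rootU_digits_eq_zero {m : ℕ} {v : ℕ → ZMod b} {i₀ : ℕ} (hi₀ : i₀ < m) (hv : v i₀ ≠ 0) :
    ∑ n ∈ Finset.range (b ^ m),
      rootU b ^ ∑ i ∈ Finset.range m, n / b ^ i % b * (v i).val = 0 := by
  set x : ℝ := ∑ i ∈ Finset.range m, ((v i).val : ℝ) / (b : ℝ) ^ (i + 1) with hx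
  have hdig := dig_sum_div_pow b (c := fun i => (v i).val) (fun i => ZMod.val_lt _) m
  have h0 : ∀ i, dig b 0 i = 0 := fun i => by simp [dig_eq]
  have hw0 : ∀ k, wal b k 0 = 1 := fun k => by simp [wal, h0]
  have h1 := sum_wal_eq_walDirichlet b m x 0 0 0
  have h2 : walDirichlet b m x 0 0 0 = 0 := by
    rw [walDirichlet, if_neg]
    push Not
    refine ⟨i₀, hi₀, ?_⟩
    rw [h0, hdig, if_pos hi₀, add_zero, add_zero, Nat.zero_mod, Nat.mod_eq_of_lt (ZMod.val_lt _)]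
    rwa [Ne, ZMod.val_eq_zero]
  rw [h2, Complex.ofReal_zero] at h1
  rw [← h1]
  refine Finset.sum_congr rfl fun n _ => ?_
  rw [hw0, map_one, mul_one, mul_one, mul_one, wal_eq_prod_of_dig_eq_zero b (M := m) (x := x)
    (fun i hi => by rw [hdig, if_neg (by omega)])]
  congr 1
  refine Finset.sum_congr rfl fun i hi => ?_
  rw [hdig, if_pos (Finset.mem_range.1 hi)]

/-- The vector of the deinterlaced components of all entries of `k`. -/
def deintVec {s : ℕ} (d : ℕ) (k : Fin s → ℕ) : Fin (s * d) → ℕ := fun t =>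
  deint b d (finProdFinEquiv.symm t).2 (k (finProdFinEquiv.symm t).1)

omit [Fact b.Prime] in
lemma deintVec_apply {s d : ℕ} (k : Fin s → ℕ) (j : Fin s) (r : Fin d) :
    deintVec b d k (finProdFinEquiv (j, r)) = deint b d r (k j) := by
  simp [deintVec]

variable {b} {m s d : ℕ} {q : Fin (s * d) → Polynomial (ZMod b)} {p : Polynomial (ZMod b)}

lemma dig_polyLatticePoint_eq_zero {n : ℕ} (t : Fin (s * d)) {i : ℕ} (hi : m ≤ i) :
    dig b (polyLatticePoint b m q p n t) i = 0 := by
  rw [polyLatticePoint, dig_laurentTrunc, if_neg (by omega)]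

lemma dig_higherOrderNet (hd : 0 < d) (n : Fin (b ^ m)) (j : Fin s) (i : ℕ) :
    dig b (higherOrderNet b m s d q p n j) i =
      dig b (polyLatticePoint b m q p n (finProdFinEquiv (j, ⟨i % d, Nat.mod_lt i hd⟩)))
        (i / d) :=
  dig_interlace b (m := m)
    (y := fun r : Fin d => polyLatticePoint b m q p n (finProdFinEquiv (j, r)))
    (fun _ _ hi => dig_polyLatticePoint_eq_zero _ hi) hd i

lemma dig_higherOrderNet_eq_zero (hd : 0 < d) (n : Fin (b ^ m)) (j : Fin s) {i : ℕ}
    (hi : d * m ≤ i) : dig b (higherOrderNet b m s d q p n j) i = 0 := by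
  rw [dig_higherOrderNet hd, dig_polyLatticePoint_eq_zero]
  rwa [Nat.le_div_iff_mul_le hd, mul_comm]

/-- On the points of the interlaced net, Walsh functions are characters of `𝔽_b^m`. -/
lemma prod_wal_higherOrderNet (hd : 0 < d) (k : Fin s → ℕ) (n : Fin (b ^ m)) :
    ∏ j, wal b (k j) (higherOrderNet b m s d q p n j) =
      rootU b ^ ∑ i ∈ Finset.range m, (n : ℕ) / b ^ i % b *
        ((toLaurent b (∑ t, truncPoly b m (deintVec b d k t) * q t) / toLaurent b p).coeff
          ((i : ℤ) + 1)).val := by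
  have h1 : ∀ j, wal b (k j) (higherOrderNet b m s d q p n j) =
      rootU b ^ ∑ r : Fin d, ∑ a ∈ Finset.range m,
        deintVec b d k (finProdFinEquiv (j, r)) / b ^ a % b *
          ((toLaurent b (natPoly b n * q (finProdFinEquiv (j, r))) / toLaurent b p).coeff
            ((a : ℤ) + 1)).val := fun j => by
    rw [wal_eq_prod_of_dig_eq_zero b (M := d * m)
      (fun i hi => dig_higherOrderNet_eq_zero hd n j hi), sum_range_mul_eq, Finset.sum_comm]
    congr 1
    rw [Finset.sum_range]
    refine Finset.sum_congr rfl fun r _ => Finset.sum_congr rfl fun a ha => ?_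
    have h1 : ((r : ℕ) + a * d) % d = r := by
      rw [Nat.add_mul_mod_self_right, Nat.mod_eq_of_lt r.2]
    have h2 : ((r : ℕ) + a * d) / d = a := by
      rw [Nat.add_mul_div_right _ _ hd, Nat.div_eq_of_lt r.2, zero_add]
    have h3 : (⟨((r : ℕ) + a * d) % d, Nat.mod_lt _ hd⟩ : Fin d) = r := Fin.ext h1
    rw [dig_higherOrderNet hd, h3, h2, deintVec_apply, deint_div_mod hd, polyLatticePoint,
      dig_laurentTrunc, if_pos (Finset.mem_range.1 ha)]
  simp_rw [h1]
  rw [Finset.prod_pow_eq_pow_sum, ← Finset.sum_product', Finset.univ_product_univ,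
    Equiv.sum_comp finProdFinEquiv (fun t => ∑ a ∈ Finset.range m,
        deintVec b d k t / b ^ a % b *
          ((toLaurent b (natPoly b n * q t) / toLaurent b p).coeff ((a : ℤ) + 1)).val)]
  apply rootU_pow_congr
  push_cast [ZMod.natCast_zmod_val]
  have h2 := fun t => coeff_one_toLaurent_truncPoly_mul b m (deintVec b d k t)
    (toLaurent b (natPoly b n * q t) / toLaurent b p)
  have h3 := coeff_one_toLaurent_truncPoly_mul b m n
    (toLaurent b (∑ t, truncPoly b m (deintVec b d k t) * q t) / toLaurent b p)
  rw [← h3]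
  simp_rw [← h2]
  rw [← HahnSeries.coeff_sum, ← natPoly_eq_truncPoly b n.2, toLaurent_sum, Finset.sum_div,
    Finset.mul_sum]
  congr 1
  refine Finset.sum_congr rfl fun t _ => ?_
  rw [toLaurent_mul, toLaurent_mul]
  ring

/-- The Walsh functions whose deinterlaced frequencies are outside the dual net are integrated
exactly. -/
theorem walSum_eq_zero (hd : 0 < d) (hp0 : p ≠ 0) (hp : p.natDegree = m) {k : Fin s → ℕ}
    (hk : deintVec b d k ∉ dualNet b m q p) : walSum b (higherOrderNet b m s d q p) k = 0 := by
  have hdvd : ¬ p ∣ ∑ t, truncPoly b m (deintVec b d k t) * q t := hk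
  obtain ⟨i₀, hi₀, hne⟩ : ∃ i < m,
      (toLaurent b (∑ t, truncPoly b m (deintVec b d k t) * q t) / toLaurent b p).coeff
        ((i : ℤ) + 1) ≠ 0 := by
    by_contra! h
    exact hdvd (dvd_of_coeff_eq_zero b hp0 fun i hi => h i (hp ▸ hi))
  rw [walSum]
  simp_rw [prod_wal_higherOrderNet hd]
  rw [← Finset.sum_range (fun n => rootU b ^ ∑ i ∈ Finset.range m, n / b ^ i % b *
        ((toLaurent b (∑ t, truncPoly b m (deintVec b d k t) * q t) / toLaurent b p).coeff
          ((i : ℤ) + 1)).val)]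
  exact sum_rootU_digits_eq_zero b hi₀ hne

lemma norm_walSum_le (b : ℕ) [Fact b.Prime] {N : ℕ} (P : Fin N → Fin s → ℝ) (k : Fin s → ℕ) :
    ‖walSum b P k‖ ≤ N := by
  refine (norm_sum_le _ _).trans ?_
  simp [norm_prod, norm_wal]

end DualNet

section Criterion

/-! ### The quality criterion -/

lemma constDtilde_pos (b : ℕ) [Fact b.Prime] {α : ℕ} (hα : 1 ≤ α) (d : ℕ) :
    0 < constDtilde b α d :=
  mul_pos (pow_pos (base_pos_real b) _) (constD_pos b hα)

lemma rFun_nonneg (b α d l : ℕ) : 0 ≤ rFun b α d l := by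
  unfold rFun
  split_ifs <;> positivity

lemma rFun_le_one_div_sq (b : ℕ) [Fact b.Prime] {α d : ℕ} (hα : 1 ≤ α) (hd : 0 < d) {l : ℕ}
    (hl : l ≠ 0) : rFun b α d l ≤ 1 / (l : ℝ) ^ 2 := by
  have hb1 : (1 : ℝ) ≤ b := by exact_mod_cast (one_lt_base b).le
  have hl0 : (0 : ℝ) < l := by exact_mod_cast Nat.pos_of_ne_zero hl
  have hlt : (l : ℝ) ≤ (b : ℝ) ^ topPos b l := by exact_mod_cast (lt_pow_topPos b l).le
  rw [rFun, if_neg hl, dickWeight_one b hl, zpow_neg, ← one_div]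
  refine one_div_le_one_div_of_le (by positivity) ?_
  calc (l : ℝ) ^ 2 ≤ ((b : ℝ) ^ topPos b l) ^ 2 := by gcongr
    _ = (b : ℝ) ^ ((topPos b l * 2 : ℕ) : ℤ) := by rw [zpow_natCast, pow_mul]
    _ ≤ _ := by
      refine zpow_le_zpow_right₀ hb1 ?_
      have h1 : 1 ≤ min α d := le_min hα hd
      have h2 : topPos b l * 2 ≤ 2 * min α d * topPos b l + α := by nlinarith
      exact_mod_cast h2

/-- As `min α d ≥ 1`, the terms decay at least like `l^{-2}`. -/
lemma tsum_rFun_lt_top (b : ℕ) [Fact b.Prime] {α d : ℕ} (hα : 1 ≤ α) (hd : 0 < d) :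
    ∑' l : ℕ+, ENNReal.ofReal (rFun b α d l) < ⊤ := by
  have hs : Summable fun n : ℕ => 1 / (n : ℝ) ^ 2 := Real.summable_one_div_nat_pow.2 one_lt_two
  calc ∑' l : ℕ+, ENNReal.ofReal (rFun b α d l)
      ≤ ∑' l : ℕ+, ENNReal.ofReal (1 / ((l : ℕ) : ℝ) ^ 2) :=
        ENNReal.tsum_le_tsum fun l =>
          ENNReal.ofReal_le_ofReal (rFun_le_one_div_sq b hα hd l.ne_zero)
    _ ≤ ∑' n : ℕ, ENNReal.ofReal (1 / (n : ℝ) ^ 2) :=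
        ENNReal.tsum_comp_le_tsum_of_injective PNat.coe_injective
          fun n : ℕ => ENNReal.ofReal (1 / (n : ℝ) ^ 2)
    _ < ⊤ := hs.tsum_ofReal_lt_top

lemma tsum_pi_prod_le {ι κ : Type*} [Fintype ι] [DecidableEq ι] (g : κ → ℝ≥0∞) :
    ∑' l : ι → κ, ∏ j, g (l j) ≤ ∏ _j : ι, ∑' x, g x := by
  classical
  rw [ENNReal.tsum_eq_iSup_sum]
  refine iSup_le fun F => ?_
  set A : ι → Finset κ := fun j => F.image fun l => l j with hA
  have hsub : F ⊆ Fintype.piFinset A := fun l hl =>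
    Fintype.mem_piFinset.2 fun j => Finset.mem_image_of_mem (fun l : ι → κ => l j) hl
  calc ∑ l ∈ F, ∏ j, g (l j)
      ≤ ∑ l ∈ Fintype.piFinset A, ∏ j, g (l j) := Finset.sum_le_sum_of_subset hsub
    _ = ∏ j, ∑ x ∈ A j, g x := (Finset.prod_univ_sum A fun _ x => g x).symm
    _ ≤ ∏ _j : ι, ∑' x, g x := Finset.prod_le_prod' fun j _ => ENNReal.sum_le_tsum _

theorem criterion_lt_top (b : ℕ) [Fact b.Prime] (m s : ℕ) {α d : ℕ} (hα : 1 ≤ α) (hd : 0 < d)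
    (γ : Finset (Fin s) → ℝ≥0) (q : Fin (s * d) → Polynomial (ZMod b)) (p : Polynomial (ZMod b)) :
    criterion b m s α d γ q p < ⊤ := by
  refine ENNReal.sum_lt_top.2 fun w _ => ENNReal.mul_lt_top ENNReal.ofReal_lt_top ?_
  calc ∑' l : {l : {j // j ∈ w} → ℕ+ // extendZero w l ∈ dualNet b m q p},
        ENNReal.ofReal (∏ j, rFun b α d (l.1 j))
      ≤ ∑' l : {j // j ∈ w} → ℕ+, ENNReal.ofReal (∏ j, rFun b α d (l j)) :=
        ENNReal.tsum_comp_le_tsum_of_injective Subtype.val_injective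
          fun l : {j // j ∈ w} → ℕ+ => ENNReal.ofReal (∏ j, rFun b α d (l j))
    _ = ∑' l : {j // j ∈ w} → ℕ+, ∏ j, ENNReal.ofReal (rFun b α d (l j)) :=
        tsum_congr fun l => ENNReal.ofReal_prod_of_nonneg fun j _ => rFun_nonneg b α d _
    _ ≤ ∏ _j : {j // j ∈ w}, ∑' l : ℕ+, ENNReal.ofReal (rFun b α d l) :=
        tsum_pi_prod_le fun l : ℕ+ => ENNReal.ofReal (rFun b α d l)
    _ < ⊤ := ENNReal.prod_lt_top fun _ _ => tsum_rFun_lt_top b hα hd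

/-! ### The bound for the interlaced net -/

lemma prod_rFun_extendZero (b α d : ℕ) {t : ℕ} (w : Finset (Fin t)) (l : {j // j ∈ w} → ℕ+) :
    ∏ j, rFun b α d (extendZero w l j) = ∏ j, rFun b α d (l j) := by
  rw [← Finset.prod_subset (Finset.subset_univ w), ← Finset.prod_coe_sort]
  · refine Finset.prod_congr rfl fun j _ => ?_
    rw [extendZero, dif_pos j.2]
  · intro j _ hj
    rw [extendZero, dif_neg hj, rFun, if_pos rfl]

lemma exists_extendZero_eq {t : ℕ} (v : Fin t → ℕ) :
    ∃ l, extendZero (Finset.univ.filter fun j => v j ≠ 0) l = v := by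
  refine ⟨fun j => ⟨v j, Nat.pos_of_ne_zero (Finset.mem_filter.1 j.2).2⟩, ?_⟩
  funext j
  simp only [extendZero, PNat.mk_coe, Finset.mem_filter, Finset.mem_univ, true_and, dite_eq_ite]
  split_ifs with h
  · rfl
  · exact (not_not.1 h).symm

variable (b : ℕ) [Fact b.Prime] {m s α d : ℕ}

lemma deintVec_injective (hd : 0 < d) :
    Function.Injective (deintVec b d : (Fin s → ℕ) → Fin (s * d) → ℕ) := by
  intro k k' h
  funext j
  refine eq_of_deint_eq (b := b) hd fun r => ?_
  rw [← deintVec_apply, ← deintVec_apply, h]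

/-- The support of the vector of deinterlaced components. -/
def deintVecSupp (d : ℕ) (k : Fin s → ℕ) : Finset (Fin (s * d)) :=
  Finset.univ.filter fun t => deintVec b d k t ≠ 0

lemma blocks_deintVecSupp (hd : 0 < d) {u : Finset (Fin s)} {M : ℕ} {k : Fin s → ℕ}
    (hk : k ∈ freqs b u M) : blocks (deintVecSupp b d k) = u := by
  rw [freqs, Fintype.mem_piFinset] at hk
  ext j
  have hj := hk j
  simp only [blocks, deintVecSupp, Finset.mem_filter, Finset.mem_univ, true_and, deintVec_apply]
  split_ifs at hj with hu
  · exact iff_of_true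
      (exists_deint_ne_zero hd (Nat.one_le_iff_ne_zero.1 (Finset.mem_Ico.1 hj).1)) hu
  · rw [Finset.mem_singleton.1 hj]
    simp [hu]

lemma prod_walWeight_le (hα : 1 ≤ α) (hd : 0 < d) {u : Finset (Fin s)} {M : ℕ} {k : Fin s → ℕ}
    (hk : k ∈ freqs b u M) : ∏ j, walWeight b α (k j) ≤
      constDtilde b α d ^ u.card * ∏ t, rFun b α d (deintVec b d k t) := by
  rw [freqs, Fintype.mem_piFinset] at hk
  have h1 : ∏ t, rFun b α d (deintVec b d k t) =
      ∏ j, ∏ r : Fin d, rFun b α d (deint b d r (k j)) := by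
    rw [← Equiv.prod_comp finProdFinEquiv, Fintype.prod_prod_type]
    simp_rw [deintVec_apply]
  have h2 : constDtilde b α d ^ u.card = ∏ j, if j ∈ u then constDtilde b α d else 1 := by
    rw [Finset.prod_ite_mem, Finset.univ_inter, Finset.prod_const]
  rw [h1, h2, ← Finset.prod_mul_distrib]
  refine Finset.prod_le_prod (fun j _ => walWeight_nonneg b α _) fun j _ => ?_
  have hj := hk j
  split_ifs at hj ⊢ with hu
  · have hk0 := Nat.one_le_iff_ne_zero.1 (Finset.mem_Ico.1 hj).1
    rw [walWeight, if_neg hk0]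
    exact walCoef_le_prod_rFun hα hd hk0
  · rw [Finset.mem_singleton.1 hj]
    simp [walWeight, rFun]

variable {b} {q : Fin (s * d) → Polynomial (ZMod b)} {p : Polynomial (ZMod b)}

open Classical in
/-- A frequency is mapped to the vector of its nonzero components; this map is injective. -/
lemma sum_dualNet_le (hd : 0 < d) (S : Finset (Fin s → ℕ)) (w : Finset (Fin (s * d))) :
    ∑ k ∈ S with deintVec b d k ∈ dualNet b m q p ∧ deintVecSupp b d k = w,
        ENNReal.ofReal (∏ t, rFun b α d (deintVec b d k t)) ≤
      ∑' l : {l : {j // j ∈ w} → ℕ+ // extendZero w l ∈ dualNet b m q p},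
        ENNReal.ofReal (∏ j, rFun b α d (l.1 j)) := by
  set T := S.filter fun k => deintVec b d k ∈ dualNet b m q p ∧ deintVecSupp b d k = w with hT
  have h : ∀ k : T, ∃ l : {l : {j // j ∈ w} → ℕ+ // extendZero w l ∈ dualNet b m q p},
      extendZero w l.1 = deintVec b d k := by
    rintro ⟨k, hk⟩
    obtain ⟨-, hk1, rfl⟩ := Finset.mem_filter.1 hk
    obtain ⟨l, hl⟩ := exists_extendZero_eq (deintVec b d k)
    exact ⟨⟨l, hl.symm ▸ hk1⟩, hl⟩
  choose φ hφ using h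
  have hinj : Function.Injective φ := fun k k' hkk => by
    have := hφ k
    rw [hkk, hφ k'] at this
    exact Subtype.ext (deintVec_injective b hd this.symm)
  rw [← Finset.sum_coe_sort, ← tsum_fintype (L := .unconditional _)]
  refine le_trans (le_of_eq ?_) (ENNReal.tsum_comp_le_tsum_of_injective hinj _)
  refine tsum_congr fun k => ?_
  rw [← hφ k, prod_rFun_extendZero]

open Classical in
/-- The contribution of the frequencies with support `u` is grouped by the support `w` of the vector
of components, whose blocks are the elements of `u`. -/
lemma ofReal_sum_freqs_le (hα : 1 ≤ α) (hd : 0 < d) (hp0 : p ≠ 0) (hp : p.natDegree = m)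
    (γ : Finset (Fin s) → ℝ≥0) {u : Finset (Fin s)} (hu : u.Nonempty) (M : ℕ) :
    ENNReal.ofReal (γ u * ∑ k ∈ freqs b u M, (∏ j, walWeight b α (k j)) *
        ‖(1 / ((b ^ m : ℕ) : ℂ)) * walSum b (higherOrderNet b m s d q p) k‖ ^ 2) ≤
      ∑ w ∈ (Finset.univ : Finset (Finset (Fin (s * d)))).filter (fun w => w.Nonempty)
        with blocks w = u,
        ENNReal.ofReal ((γ (blocks w) : ℝ) * constDtilde b α d ^ (blocks w).card) *
          ∑' l : {l : {j // j ∈ w} → ℕ+ // extendZero w l ∈ dualNet b m q p},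
            ENNReal.ofReal (∏ j, rFun b α d (l.1 j)) := by
  have hD := (constDtilde_pos b hα d).le
  have hR : ∀ k : Fin s → ℕ, 0 ≤ ∏ t, rFun b α d (deintVec b d k t) := fun k =>
    Finset.prod_nonneg fun t _ => rFun_nonneg b α d _
  set F := (freqs b u M).filter fun k => deintVec b d k ∈ dualNet b m q p with hF
  have h1 : ∑ k ∈ freqs b u M, (∏ j, walWeight b α (k j)) *
        ‖(1 / ((b ^ m : ℕ) : ℂ)) * walSum b (higherOrderNet b m s d q p) k‖ ^ 2 ≤
      ∑ k ∈ F, constDtilde b α d ^ u.card * ∏ t, rFun b α d (deintVec b d k t) := by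
    rw [hF, Finset.sum_filter]
    refine Finset.sum_le_sum fun k hk => ?_
    split_ifs with hdual
    · have hle : ‖(1 / ((b ^ m : ℕ) : ℂ)) * walSum b (higherOrderNet b m s d q p) k‖ ≤ 1 := by
        have hb : (0 : ℝ) < ((b ^ m : ℕ) : ℝ) := by exact_mod_cast pow_pos (base_pos b) m
        rw [norm_mul, norm_div, norm_one, Complex.norm_natCast, one_div,
          inv_mul_le_iff₀ hb, mul_one]
        exact norm_walSum_le b _ k
      refine le_trans ?_ (prod_walWeight_le b hα hd hk)
      exact mul_le_of_le_one_right (Finset.prod_nonneg fun j _ => walWeight_nonneg b α _)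
        (pow_le_one₀ (norm_nonneg _) hle)
    · rw [walSum_eq_zero hd hp0 hp hdual]
      simp
  refine (ENNReal.ofReal_le_ofReal (mul_le_mul_of_nonneg_left h1 (γ u).2)).trans ?_
  rw [← Finset.mul_sum, ← mul_assoc, ENNReal.ofReal_mul (mul_nonneg (γ u).2 (pow_nonneg hD _)),
    ENNReal.ofReal_sum_of_nonneg fun k _ => hR k]
  have hmaps : ∀ k ∈ F, deintVecSupp b d k ∈
      ((Finset.univ : Finset (Finset (Fin (s * d)))).filter (fun w => w.Nonempty)).filter
        fun w => blocks w = u := by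
    intro k hk
    have hbl := blocks_deintVecSupp b hd (Finset.mem_filter.1 hk).1
    refine Finset.mem_filter.2 ⟨Finset.mem_filter.2 ⟨Finset.mem_univ _, ?_⟩, hbl⟩
    by_contra hne
    rw [Finset.not_nonempty_iff_eq_empty.1 hne] at hbl
    rw [← hbl] at hu
    simp [blocks] at hu
  rw [← Finset.sum_fiberwise_of_maps_to hmaps, Finset.mul_sum]
  refine Finset.sum_le_sum fun w hw => ?_
  rw [(Finset.mem_filter.1 hw).2, hF, Finset.filter_filter]
  exact mul_le_mul' le_rfl (sum_dualNet_le (b := b) hd _ w)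

lemma ofReal_walError_le (hα : 1 ≤ α) (hd : 0 < d) (hp0 : p ≠ 0) (hp : p.natDegree = m)
    (γ : Finset (Fin s) → ℝ≥0) (M : ℕ) :
    ENNReal.ofReal (walError b α γ (higherOrderNet b m s d q p) M) ≤ criterion b m s α d γ q p := by
  classical
  have hmaps : ∀ w ∈ (Finset.univ : Finset (Finset (Fin (s * d)))).filter (fun w => w.Nonempty),
      blocks w ∈ (Finset.univ : Finset (Finset (Fin s))).filter (fun u => u.Nonempty) := by
    intro w hw
    obtain ⟨t, ht⟩ := (Finset.mem_filter.1 hw).2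
    refine Finset.mem_filter.2 ⟨Finset.mem_univ _, (finProdFinEquiv.symm t).1, ?_⟩
    exact Finset.mem_filter.2 ⟨Finset.mem_univ _, (finProdFinEquiv.symm t).2,
      by rwa [Prod.mk.eta, Equiv.apply_symm_apply]⟩
  rw [criterion, ← Finset.sum_fiberwise_of_maps_to hmaps, walError,
    ENNReal.ofReal_sum_of_nonneg]
  · exact Finset.sum_le_sum fun u hu =>
      ofReal_sum_freqs_le hα hd hp0 hp γ (Finset.mem_filter.1 hu).2 M
  · exact fun u _ => mul_nonneg (γ u).2 (Finset.sum_nonneg fun k _ =>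
      mul_nonneg (Finset.prod_nonneg fun j _ => walWeight_nonneg b α _) (sq_nonneg _))

theorem meanSquareError_higherOrderNet_le (hα : 2 ≤ α) (hd : 0 < d) (hp0 : p ≠ 0)
    (hp : p.natDegree = m) (γ : Finset (Fin s) → ℝ≥0) :
    meanSquareError b α γ (higherOrderNet b m s d q p) ≤ criterion b m s α d γ q p :=
  meanSquareError_le_of_walError_le b (pow_pos (base_pos b) m).ne' hα γ
    (fun n j _ hi => dig_higherOrderNet_eq_zero hd n j hi)
    (ofReal_walError_le (by omega) hd hp0 hp γ)

end Criterion

end HODN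

end

theorem theorem1 (b : ℕ) [Fact b.Prime] (m s α d : ℕ) (hm : 0 < m) (hs : 0 < s) (hd : 0 < d)
    (hα : 2 ≤ α) (γ : Finset (Fin s) → NNReal)
    (p : Polynomial (ZMod b)) (hp : p.natDegree = m)
    (q : Fin (s * d) → Polynomial (ZMod b)) :
    0 < HODN.constDtilde b α d ∧
      HODN.meanSquareError b α γ (HODN.higherOrderNet b m s d q p)
        ≤ HODN.criterion b m s α d γ q p ∧
      HODN.criterion b m s α d γ q p < ⊤ := by
  have hα1 : 1 ≤ α := one_le_two.trans hα
  have hp0 : p ≠ 0 := Polynomial.ne_zero_of_natDegree_gt (hp ▸ hm)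
  exact ⟨HODN.constDtilde_pos b hα1 d, HODN.meanSquareError_higherOrderNet_le hα hd hp0 hp γ,
    HODN.criterion_lt_top b m s hα1 hd γ q p⟩
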